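/- **Setting.** PROMPT-LTL formulas over a set $AP$ of atomic propositions are given by $$\varphi ::= a \mid \neg a \mid \varphi\wedge\varphi \mid \varphi\vee\varphi \mid \mathbf{X}\varphi \mid \varphi\,\mathbf{U}\,\varphi \mid \varphi\,\mathbf{R}\,\varphi \mid \mathbf{F_P}\varphi ,\qquad a\in AP.$$ For an infinite word $w=w_0w_1\cdots$ of subsets of $AP$ and a bound $k\in\mathbb{N}$, $(w,k)\models\varphi$ is defined as for LTL, where $\mathbf{F_P}\varphi$ holds at position $i$ iff $\varphi$ holds at some position $j$ with $i\le j\le i+k$. An assume-guarantee specification is a pair $\langle\varphi,\psi\rangle$ of PROMPT-LTL formulas. A $2^O$-labeled $2^I$-transition system $\mathcal{S}=\langle S,s_0,\Delta,\ell\rangle$ has a set $S$ of states, an initial state $s_0 \in S$, a transition function $\Delta\colon S\times 2^I\to S$ and a labeling $\ell\colon S\to 2^O$; $\Delta^*(v)$ is the state reached from $s_0$ on $v\in(2^I)^*$. Its size is $|S|$. Its paths are the words $w\in(2^{I\cup O})^\omega$ with $w_n\cap O=\ell(\Delta^*((w_0\cap I)\cdots(w_{n-1}\cap I)))$ for all $n$.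 It satisfies $\langle\varphi,\psi\rangle$ if for every $k\in\mathbb{N}$ there is $l\in\mathbb{N}$ such that for every path $w$, $(w,k)\models\varphi$ implies $(w,l)\models\psi$. An architecture consists of a finite set $P$ of processes with a distinguished environment process $p_{env}$, and finite sets $I_p,O_p$ of inputs and outputs for each $p\in P$, where the $O_p$ are pairwise disjoint and each $I_p$ is contained in $\bigcup_q O_q$. Put $P^-=P\setminus\{p_{env}\}$. The asynchronous architecture $\mathcal{A}^*$ adds fresh propositions $\mathit{sched}_p$ ($p\in P^-$): $O^*_{p_{env}}=O_{p_{env}}\cup\{\mathit{sched}_p\mid p\in P^-\}$, and $I_p^*=I_p\cup\{\mathit{sched}_p\}$, $O^*_p=O_p$ for $p\in P^-$. An implementation of $p\in P^-$ in $\mathcal{A}^*$ is a $2^{O_p^*}$-labeled $2^{I_p^*}$-transition system $\mathcal{S}_p$ whose state does not change when $p$ is not scheduled: $\Delta_p^*(v\upsilon)=\Delta_p^*(v)$ for all $v\in (2^{I_p^*})^*$ and all $\upsilon\subseteq I_p^*$ with $\mathit{sched}_p\notin\upsilon$. The distributed product $\bigotimes_{p\in P^-}\mathcal{S}_p$ has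 the states $(s_p)_{p\in P^-}$, inputs $O^*_{p_{env}}$, outputs $\bigcup_{p\in P^-}O^*_p$, label $\bigcup_p\ell_p(s_p)$ at $(s_p)_p$, and on input $\upsilon$ it moves each component from $s_p$ to $\Delta_p\bigl(s_p,(\upsilon\cup\bigcup_q\ell_q(s_q))\cap I_p^*\bigr)$. A constraint system is a quantifier-free sentence of first-order logic modulo the theory of a partial order $\le$, over a signature with countably many uninterpreted function and relation symbols of every arity. It is satisfiable if it holds in some nonempty structure in which $\le$ is a partial order; such a structure is a solution. **Statement.** Satisfiability of constraint systems is decidable, and there is an algorithm that constructs from a PROMPT-LTL assume-guarantee specification $\langle\varphi,\psi\rangle$, an asynchronous architecture $\mathcal{A}^*$ and a family of bounds $(b_p)_{p\in P^-}$ in $\mathbb{N}$ a constraint system that is satisfiable if, and only if, there exist implementations $\mathcal{S}_p$ of size $b_p$ for each $p\in P^-$ such that $\bigotimes_{p\in P^-}\mathcal{S}_p$ satisfies $\langle\varphi,\psi\rangle$ in $\mathcal{A}^*$. Moreover, the solutions directly represent these implementations. Fix constant symbols for the natural numbers (which name the states $0,\dots,b_p-1$ and the input valuations, through their binary codes), a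 constant symbol for the initial state of each process, a binary function symbol for each transition function $\Delta_p$, and a unary relation symbol for each output $o\in O_p$. Then every solution interprets these symbols as some family of transition systems $\mathcal{S}_p$ on the states $\{0,\dots,b_p-1\}$ with inputs $I_p^*$ and outputs $O_p^*$, and such a family is represented in this way by some solution if, and only if, it consists of implementations in $\mathcal{A}^*$ whose distributed product satisfies $\langle\varphi,\psi\rangle$. -/

import Mathlib

/-- Atomic propositions: the ordinary variables `var a`, and the scheduling propositions `sched p`
(`sched p` holds when the system process number `p` is scheduled). -/
inductive Atom : Type
  | var (a : ℕ) : Atom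
  | sched (p : ℕ) : Atom
deriving DecidableEq

/-- An infinite word over the alphabet of (finite) sets of atomic propositions. -/
abbrev Word : Type := ℕ → Finset Atom

/-! ### PROMPT-LTL -/

/-- PROMPT-LTL formulas, in negation normal form; `promptF φ` is the prompt-eventually operator. -/
inductive PromptLTL : Type
  | atom (a : Atom) : PromptLTL
  | natom (a : Atom) : PromptLTL
  | and (φ ψ : PromptLTL) : PromptLTL
  | or (φ ψ : PromptLTL) : PromptLTL
  | next (φ : PromptLTL) : PromptLTL
  | untl (φ ψ : PromptLTL) : PromptLTL
  | release (φ ψ : PromptLTL) : PromptLTL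
  | promptF (φ : PromptLTL) : PromptLTL

/-- `φ.HoldsAt w k i`: the formula `φ` holds at position `i` of the word `w` with respect to the
bound `k` on the prompt-eventually operators. -/
def PromptLTL.HoldsAt (w : Word) (k : ℕ) : PromptLTL → ℕ → Prop
  | .atom a, i => a ∈ w i
  | .natom a, i => a ∉ w i
  | .and φ ψ, i => φ.HoldsAt w k i ∧ ψ.HoldsAt w k i
  | .or φ ψ, i => φ.HoldsAt w k i ∨ ψ.HoldsAt w k i
  | .next φ, i => φ.HoldsAt w k (i + 1)
  | .untl φ ψ, i => ∃ j, i ≤ j ∧ ψ.HoldsAt w k j ∧ ∀ m, i ≤ m → m < j → φ.HoldsAt w k m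
  | .release φ ψ, i =>
      ∀ j, i ≤ j → ψ.HoldsAt w k j ∨ ∃ m, i ≤ m ∧ m < j ∧ φ.HoldsAt w k m
  | .promptF φ, i => ∃ j, i ≤ j ∧ j ≤ i + k ∧ φ.HoldsAt w k j

/-- `(w, k) ⊨ φ`. -/
def PromptLTL.Holds (φ : PromptLTL) (w : Word) (k : ℕ) : Prop := φ.HoldsAt w k 0

/-! ### Transition systems -/

/-- The set `2^I` of valuations of `I`. -/
abbrev PropVal (I : Finset Atom) : Type := {v : Finset Atom // v ⊆ I}

/-- The valuation `σ ∩ I` of `I`. -/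
def PropVal.restrict (I : Finset Atom) (σ : Finset Atom) : PropVal I :=
  ⟨σ ∩ I, Finset.inter_subset_right⟩

/-- A `2^O`-labeled `2^I`-transition system with set of states `S`. -/
structure TransitionSystem (I O : Finset Atom) (S : Type) where
  init : S
  step : S → PropVal I → S
  label : S → PropVal O

namespace TransitionSystem

variable {I O : Finset Atom} {S : Type}

/-- The state `Δ*(v)` that is reached on the finite input word `v`. -/
def reach (T : TransitionSystem I O S) (v : List (PropVal I)) : S := v.foldl T.step T.init

/-- The strategy `(2^I)* → 2^O` generated by `T`. -/
def strategy (T : TransitionSystem I O S) (v : List (PropVal I)) : PropVal O :=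
  T.label (T.reach v)

/-- The infinite word `w` over `2^(I ∪ O)` is a path of the strategy generated by `T`: at each
position, the outputs are those that the strategy assigns to the inputs read so far. -/
def IsPath (T : TransitionSystem I O S) (w : Word) : Prop :=
  ∀ n, w n ⊆ I ∪ O ∧
    PropVal.restrict O (w n) = T.strategy ((List.range n).map fun m => PropVal.restrict I (w m))

/-- `T` satisfies the assume-guarantee specification `⟨φ, ψ⟩`: for every bound `k` on the
assumption there is a bound `l` on the guarantee that works for all paths. -/
def Satisfies (T : TransitionSystem I O S) (φ ψ : PromptLTL) : Prop :=
  ∀ k : ℕ, ∃ l : ℕ, ∀ w : Word, T.IsPath w → φ.Holds w k → ψ.Holds w l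

/-- The state does not change whenever the proposition `a` is absent from the input. -/
def FrozenWithout (T : TransitionSystem I O S) (a : Atom) : Prop :=
  ∀ (v : List (PropVal I)) (υ : PropVal I), a ∉ υ.1 → T.reach (v ++ [υ]) = T.reach v

end TransitionSystem

/-! ### Architectures -/

/-- A (synchronous) architecture. The processes are `Option (Fin n)`: the environment is `none`,
the system processes are `some p`. -/
structure Architecture where
  n : ℕ
  inp : Option (Fin n) → Finset ℕ
  out : Option (Fin n) → Finset ℕ
  out_disjoint : ∀ p q, p ≠ q → Disjoint (out p) (out q)
  inp_subset : ∀ p, inp p ⊆ Finset.univ.biUnion out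

namespace Architecture

/-- The outputs `O*_env = O_env ∪ Sched` of the environment in the asynchronous architecture. -/
def asyncEnvOut (A : Architecture) : Finset Atom :=
  (A.out none).image Atom.var ∪ Finset.univ.image fun p : Fin A.n => Atom.sched p

/-- The inputs `I*_p = I_p ∪ {sched_p}` of a system process in the asynchronous architecture. -/
def asyncInp (A : Architecture) (p : Fin A.n) : Finset Atom :=
  (A.inp (some p)).image Atom.var ∪ {Atom.sched p}

/-- The outputs `O*_p = O_p` of a system process in the asynchronous architecture. -/
def asyncOut (A : Architecture) (p : Fin A.n) : Finset Atom :=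
  (A.out (some p)).image Atom.var

/-- The outputs of the composition of the system processes. -/
def sysOut (A : Architecture) : Finset Atom := Finset.univ.biUnion A.asyncOut

/-- A family of transition systems, one for each system process `p`, of size `b p` and with the
inputs and outputs that the asynchronous architecture gives to `p`. -/
abbrev Family (A : Architecture) (b : Fin A.n → ℕ) : Type :=
  ∀ p : Fin A.n, TransitionSystem (A.asyncInp p) (A.asyncOut p) (Fin (b p))

/-- The distributed product: every process reads its part of the environment outputs and of the
current outputs of all the processes. -/
def product (A : Architecture) {b : Fin A.n → ℕ} (T : A.Family b) :
    TransitionSystem A.asyncEnvOut A.sysOut (∀ p : Fin A.n, Fin (b p)) :=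
  let label : (∀ p : Fin A.n, Fin (b p)) → PropVal A.sysOut := fun s =>
    ⟨Finset.univ.biUnion fun p => ((T p).label (s p)).1,
      Finset.biUnion_mono fun p _ => ((T p).label (s p)).2⟩
  { init := fun p => (T p).init
    step := fun s υ p => (T p).step (s p) (PropVal.restrict _ (υ.1 ∪ (label s).1))
    label := label }

/-- The family is a family of implementations for the asynchronous architecture (the state of a
process does not change when the process is not scheduled), and its distributed product satisfies
the assume-guarantee specification `⟨φ, ψ⟩`. -/
def Realizes (A : Architecture) {b : Fin A.n → ℕ} (T : A.Family b) (φ ψ : PromptLTL) : Prop :=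
  (∀ p, (T p).FrozenWithout (Atom.sched p)) ∧ (A.product T).Satisfies φ ψ

end Architecture

/-! ### Constraint systems

Quantifier-free first-order logic modulo the theory of a partial order, with uninterpreted
function and relation symbols. -/

/-- The signature: countably many function symbols and countably many relation symbols of every
arity. -/
def constraintLanguage : FirstOrder.Language.{0, 0} := ⟨fun _ => ℕ, fun _ => ℕ⟩

/-- The binary relation symbol number `0` is `≤`; all other symbols are uninterpreted. -/
instance : constraintLanguage.IsOrdered := ⟨(0 : ℕ)⟩

/-- The theory: `≤` is a partial order. -/
def constraintTheory : constraintLanguage.Theory := constraintLanguage.partialOrderTheory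

/-- A constraint system is a quantifier-free sentence (the conjunction of its constraints). -/
abbrev ConstraintSystem : Type := {σ : constraintLanguage.Sentence // σ.IsQF}

/-- The solutions of a constraint system: the models of the theory in which it holds. -/
abbrev ConstraintSystem.Solution (C : ConstraintSystem) : Type 1 :=
  FirstOrder.Language.Theory.ModelType.{0, 0, 0} (constraintTheory ∪ {C.1})

def ConstraintSystem.Satisfiable (C : ConstraintSystem) : Prop :=
  (constraintTheory ∪ {C.1}).IsSatisfiable

/-! ### Gödel numbers -/

/-- The number with binary digits `1` exactly at the places in `s`. -/
def setCode (s : Finset ℕ) : ℕ := ∑ a ∈ s, 2 ^ a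

def Atom.code : Atom → ℕ
  | .var a => 2 * a
  | .sched p => 2 * p + 1

def PropVal.code {I : Finset Atom} (υ : PropVal I) : ℕ := setCode (υ.1.image Atom.code)

def PromptLTL.code : PromptLTL → ℕ
  | .atom a => Nat.pair 0 a.code
  | .natom a => Nat.pair 1 a.code
  | .and φ ψ => Nat.pair 2 (Nat.pair φ.code ψ.code)
  | .or φ ψ => Nat.pair 3 (Nat.pair φ.code ψ.code)
  | .next φ => Nat.pair 4 φ.code
  | .untl φ ψ => Nat.pair 5 (Nat.pair φ.code ψ.code)
  | .release φ ψ => Nat.pair 6 (Nat.pair φ.code ψ.code)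
  | .promptF φ => Nat.pair 7 φ.code

/-- The code of one process of an architecture. -/
def Architecture.processCode (A : Architecture) (p : Option (Fin A.n)) : ℕ :=
  Nat.pair (setCode (A.inp p)) (setCode (A.out p))

def Architecture.code (A : Architecture) : ℕ :=
  Nat.pair (A.processCode none)
    (Encodable.encode (List.ofFn fun p : Fin A.n => A.processCode (some p)))

/-- The code of an instance of the bounded realizability problem. -/
def instanceCode (φ ψ : PromptLTL) (A : Architecture) (b : Fin A.n → ℕ) : ℕ :=
  Nat.pair (Nat.pair φ.code ψ.code) (Nat.pair A.code (Encodable.encode (List.ofFn b)))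

def termCode {n : ℕ} : constraintLanguage.Term (Empty ⊕ Fin n) → ℕ
  | .var (.inl e) => e.elim
  | .var (.inr i) => Nat.pair 0 i
  | .func f ts => Nat.pair 1 (Nat.pair (show ℕ from f)
      (Encodable.encode (List.ofFn fun i => termCode (ts i))))

def formulaCode : {n : ℕ} → constraintLanguage.BoundedFormula Empty n → ℕ
  | _, .falsum => Nat.pair 0 0
  | _, .equal t₁ t₂ => Nat.pair 1 (Nat.pair (termCode t₁) (termCode t₂))
  | _, .rel R ts => Nat.pair 2 (Nat.pair (show ℕ from R)
      (Encodable.encode (List.ofFn fun i => termCode (ts i))))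
  | _, .imp f₁ f₂ => Nat.pair 3 (Nat.pair (formulaCode f₁) (formulaCode f₂))
  | _, .all f => Nat.pair 4 (formulaCode f)

def ConstraintSystem.code (C : ConstraintSystem) : ℕ := formulaCode C.1

/-! ### Reading implementations off the solutions of a constraint system -/

section Represents

variable (M : Type) [constraintLanguage.Structure M]

/-- The value of the constant symbol that stands for the number `m` (a state, or the code of an
input valuation). -/
def numeral (m : ℕ) : M :=
  FirstOrder.Language.Structure.funMap (L := constraintLanguage) (n := 0) (2 * m : ℕ) ![]

/-- The value of the constant symbol for the initial state of process `p`. -/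
def initSymbol (p : ℕ) : M :=
  FirstOrder.Language.Structure.funMap (L := constraintLanguage) (n := 0) (2 * p + 1 : ℕ) ![]

/-- The interpretation of the binary function symbol for the transition function of process
`p`. -/
def stepSymbol (p : ℕ) (x y : M) : M :=
  FirstOrder.Language.Structure.funMap (L := constraintLanguage) (n := 2) (p : ℕ) ![x, y]

/-- The interpretation of the unary relation symbol for the output `o`. -/
def labelSymbol (o : ℕ) (x : M) : Prop :=
  FirstOrder.Language.Structure.RelMap (L := constraintLanguage) (n := 1) (o : ℕ) ![x]

/-- In the structure `M`, the uninterpreted symbols for the initial states, the transition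
functions and the labelings have the values that the family `T` prescribes. -/
def Represents {A : Architecture} {b : Fin A.n → ℕ} (T : A.Family b) : Prop :=
  ∀ p : Fin A.n,
    initSymbol M p = numeral M (T p).init ∧
    (∀ (s : Fin (b p)) (υ : PropVal (A.asyncInp p)),
      stepSymbol M p (numeral M s) (numeral M υ.code) = numeral M ((T p).step s υ)) ∧
    ∀ (s : Fin (b p)), ∀ o ∈ A.out (some p),
      (labelSymbol M o (numeral M s) ↔ Atom.var o ∈ ((T p).label s).1)

end Represents

-- The core is a decision procedure for a fixed family of transition systems; the rest is coding.
-- The product violates `⟨φ, ψ⟩` when some `k` is such that, for every `l`, some path satisfies `φ`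
-- with bound `k` and falsifies `ψ` with bound `l`. `Instance.accepts_iff_not_satisfies` turns this
-- into a property of one finite graph. A vertex carries a letter, the current states, formulas
-- claimed to hold (a tableau for `φ`), formulas claimed to fail (a tableau for `ψ`), and possibly a
-- mark. In the first tableau, a prompt formula must be discharged by the next visit to a set that
-- recurs at bounded distances. In the second, the argument of a failing prompt formula stays false
-- until the second mark ahead; marks at distance at least `L` then prove failure with bound `L`,
-- and conversely failure with bound `2 * (L + 1)` allows marks at the multiples of `L + 1`. So a
-- violation amounts to: for some `K` and all `L` there is a fair path with recurrence bound `K` and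
-- gaps `L` between marks (`PromptGraph.IsPath`).
--
-- `PromptGraph.accepting_iff` decides this by pumping. Between two marks a counter has to record `N
-- * h` visits to the sets `H m`, taken in cyclic order, where `N` bounds the vertices and `h` is
-- the number of sets. If the gaps are long compared with `K`, the counter fills up. If it fills up,
-- the pigeonhole principle yields between consecutive marks a loop that visits every `H m`;
-- repeating it `L` times drives the marks apart, and the recurrence bound does not depend on `L`.
-- What remains is to find a reachable cycle in a finite graph.
--
-- Diagrams of families, vertices and sets of nodes are numbers read as bit sets, and the tests use
-- bounded quantifiers only, so `Instance.IsSolution` is primitive recursive. The constraint system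
-- of an instance is the disjunction, over all diagrams that pass the test, of the complete
-- description of the diagram by literals. A model therefore selects a diagram, and a family it
-- represents has that diagram (`IsDiagram.of_represents`); conversely a realizing family is
-- represented in a structure on the natural numbers.
--
-- Satisfiability is decidable because the truth of a quantifier-free sentence with code `c`
-- involves only closed terms with codes below `c`. A certificate is a preorder on the numbers up to
-- `c` with truth values compatible with the function and relation symbols. The quotient by the
-- preorder is a model (`Certificate.exists_satisfiable`), and every model induces a certificate
-- (`Certificate.exists_of_model`).

attribute [fun_prop] Primrec PrimrecPred
attribute [fun_prop] Primrec.id Primrec.const Primrec.comp Primrec.fst Primrec.snd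

/-! ### Bounded quantification and primitive recursion -/

/-- Bounded universal quantification. -/
def BAll (n : ℕ) (P : ℕ → Prop) : Prop := ∀ i < n, P i

/-- Bounded existential quantification. -/
def BEx (n : ℕ) (P : ℕ → Prop) : Prop := ∃ i < n, P i

/-- Implication, as a constant. -/
def Impl (p q : Prop) : Prop := p → q

section PrimrecToolkit

variable {α β γ : Type*} [Primcodable α] [Primcodable β] [Primcodable γ]

@[fun_prop] theorem Primrec.fun_add {f g : α → ℕ} (hf : Primrec f) (hg : Primrec g) :
    Primrec fun a => f a + g a := Primrec.nat_add.comp hf hg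

@[fun_prop] theorem Primrec.fun_mul {f g : α → ℕ} (hf : Primrec f) (hg : Primrec g) :
    Primrec fun a => f a * g a := Primrec.nat_mul.comp hf hg

@[fun_prop] theorem Primrec.fun_div {f g : α → ℕ} (hf : Primrec f) (hg : Primrec g) :
    Primrec fun a => f a / g a := Primrec.nat_div.comp hf hg

@[fun_prop] theorem Primrec.fun_mod {f g : α → ℕ} (hf : Primrec f) (hg : Primrec g) :
    Primrec fun a => f a % g a := Primrec.nat_mod.comp hf hg

@[fun_prop] theorem Primrec.fun_pow {f g : α → ℕ} (hf : Primrec f) (hg : Primrec g) :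
    Primrec fun a => f a ^ g a :=
  (Primrec₂.unpaired'.1 Nat.Primrec.pow).comp hf hg

@[fun_prop] theorem Primrec.fun_natPair {f g : α → ℕ} (hf : Primrec f) (hg : Primrec g) :
    Primrec fun a => Nat.pair (f a) (g a) := Primrec₂.natPair.comp hf hg

@[fun_prop] theorem Primrec.fun_unpair {f : α → ℕ} (hf : Primrec f) :
    Primrec fun a => Nat.unpair (f a) := Primrec.unpair.comp hf

@[fun_prop] theorem PrimrecPred.fun_and {p q : α → Prop} (hp : PrimrecPred p)
    (hq : PrimrecPred q) : PrimrecPred fun a => p a ∧ q a := hp.and hq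

@[fun_prop] theorem PrimrecPred.fun_or {p q : α → Prop} (hp : PrimrecPred p)
    (hq : PrimrecPred q) : PrimrecPred fun a => p a ∨ q a := hp.or hq

@[fun_prop] theorem PrimrecPred.fun_not {p : α → Prop} (hp : PrimrecPred p) :
    PrimrecPred fun a => ¬ p a := hp.not

@[fun_prop] theorem PrimrecPred.fun_impl {p q : α → Prop} (hp : PrimrecPred p)
    (hq : PrimrecPred q) : PrimrecPred fun a => Impl (p a) (q a) :=
  (hp.not.or hq).of_eq fun _ => imp_iff_not_or.symm

@[fun_prop] theorem PrimrecPred.fun_iff {p q : α → Prop} (hp : PrimrecPred p)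
    (hq : PrimrecPred q) : PrimrecPred fun a => (p a ↔ q a) :=
  ((hp.fun_impl hq).and (hq.fun_impl hp)).of_eq fun _ => iff_iff_implies_and_implies.symm

@[fun_prop] theorem PrimrecPred.fun_lt {f g : α → ℕ} (hf : Primrec f) (hg : Primrec g) :
    PrimrecPred fun a => f a < g a := Primrec.nat_lt.comp hf hg

@[fun_prop] theorem PrimrecPred.fun_eq {f g : α → ℕ} (hf : Primrec f) (hg : Primrec g) :
    PrimrecPred fun a => f a = g a := Primrec.eq.comp hf hg

-- A bounded quantifier is a test on all members of `List.range`. With this rule and its dual,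
-- predicates written with `BAll`, `BEx` and `Impl` become primitive recursive by mere unfolding.
@[fun_prop] theorem PrimrecPred.fun_bAll {f : α → ℕ} {P : α → ℕ → Prop} (hf : Primrec f)
    (hP : PrimrecPred fun z : α × ℕ => P z.1 z.2) : PrimrecPred fun a => BAll (f a) (P a) := by
  have h : PrimrecRel fun (i : ℕ) (a : α) => P a i :=
    PrimrecPred.comp (p := fun z : α × ℕ => P z.1 z.2) (f := fun z : ℕ × α => (z.2, z.1)) hP
      (Primrec.pair Primrec.snd Primrec.fst)
  refine ((PrimrecRel.forall_mem_list h).comp (Primrec.list_range.comp hf) Primrec.id).of_eq ?_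
  simp [BAll]

@[fun_prop] theorem PrimrecPred.fun_bEx {f : α → ℕ} {P : α → ℕ → Prop} (hf : Primrec f)
    (hP : PrimrecPred fun z : α × ℕ => P z.1 z.2) : PrimrecPred fun a => BEx (f a) (P a) := by
  refine (PrimrecPred.fun_bAll (P := fun a i => ¬ P a i) hf hP.not).not.of_eq ?_
  simp [BAll, BEx]

end PrimrecToolkit

/-! ### Finite sets of numbers, coded by their binary digits -/

/-- `i` belongs to the set with code `s`. -/
def Bit (s i : ℕ) : Prop := s.testBit i = true

@[fun_prop] theorem PrimrecPred.fun_bit {α : Type*} [Primcodable α] {f g : α → ℕ}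
    (hf : Primrec f) (hg : Primrec g) : PrimrecPred fun a => Bit (f a) (g a) := by
  have h : PrimrecPred fun a => f a / 2 ^ g a % 2 = 1 := by fun_prop
  exact h.of_eq fun a => by simp [Bit, Nat.testBit_eq_decide_div_mod_eq]

theorem bit_setCode (s : Finset ℕ) (i : ℕ) : Bit (setCode s) i ↔ i ∈ s := by
  have h := Finset.toFinset_bitIndices_sum_two_pow s
  conv_rhs => rw [← h]
  rw [List.mem_toFinset, Nat.mem_bitIndices, Bit, setCode]

theorem setCode_lt {s : Finset ℕ} {n : ℕ} (h : ∀ i ∈ s, i < n) : setCode s < 2 ^ n := by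
  refine Nat.lt_pow_two_of_testBit _ fun i hi => ?_
  by_contra hne
  have : Bit (setCode s) i := by simpa [Bit] using hne
  exact absurd (h i ((bit_setCode s i).1 this)) (by omega)

/-- Comprehension for coded sets: it supplies the invariants, vertices, diagrams and certificates
over which bounded quantifiers range. -/
theorem exists_bitset (n : ℕ) (P : ℕ → Prop) : ∃ s < 2 ^ n, ∀ i, Bit s i ↔ i < n ∧ P i := by
  classical
  refine ⟨setCode ((Finset.range n).filter P), setCode_lt fun i hi => ?_, fun i => ?_⟩
  · simpa using (Finset.mem_filter.1 hi).1
  · simp [bit_setCode]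

theorem Bit.lt_self {s i : ℕ} (h : Bit s i) : i < s := by
  have := Nat.ge_two_pow_of_testBit h
  exact lt_of_lt_of_le Nat.lt_two_pow_self this

theorem Bit.lt_of_lt {s i n : ℕ} (h : Bit s i) (hs : s < 2 ^ n) : i < n := by
  have := Nat.ge_two_pow_of_testBit h
  exact (Nat.pow_lt_pow_iff_right (by norm_num)).1 (lt_of_le_of_lt this hs)

theorem bit_ext {s t : ℕ} (h : ∀ i, Bit s i ↔ Bit t i) : s = t :=
  Nat.eq_of_testBit_eq fun i => Bool.eq_iff_iff.2 (h i)

/-! ### Lists of numbers -/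

/-- The list of numbers with code `n`. -/
def natList (n : ℕ) : List ℕ := Denumerable.ofNat (List ℕ) n

def natListLen (n : ℕ) : ℕ := (natList n).length

def natListGet (n i : ℕ) : ℕ := (natList n).getD i 0

@[simp] theorem natList_encode (l : List ℕ) : natList (Encodable.encode l) = l :=
  Denumerable.ofNat_encode l

@[simp] theorem encode_natList (n : ℕ) : Encodable.encode (natList n) = n :=
  Denumerable.encode_ofNat n

section

variable {α : Type*} [Primcodable α] {f g : α → ℕ}

@[fun_prop] theorem Primrec.fun_natListLen (hf : Primrec f) :
    Primrec fun a => natListLen (f a) :=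
  Primrec.list_length.comp ((Primrec.ofNat (List ℕ)).comp hf)

@[fun_prop] theorem Primrec.fun_natListGet (hf : Primrec f) (hg : Primrec g) :
    Primrec fun a => natListGet (f a) (g a) :=
  (Primrec.list_getD 0).comp ((Primrec.ofNat (List ℕ)).comp hf) hg

end

/-- The source of termination: arguments of a term or a relational atom have smaller codes than the
term or atom itself. -/
theorem lt_encode_of_mem {a : ℕ} {l : List ℕ} (h : a ∈ l) : a < Encodable.encode l := by
  induction l with
  | nil => simp at h
  | cons b l ih =>
    rw [Encodable.encode_list_cons]
    rcases List.mem_cons.1 h with rfl | h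
    · exact Nat.lt_succ_of_le (Nat.left_le_pair _ _)
    · exact (ih h).trans (Nat.lt_succ_of_le (Nat.right_le_pair _ _))

theorem natListGet_lt {n i : ℕ} (h : i < natListLen n) : natListGet n i < n := by
  have h1 : natListGet n i ∈ natList n := by
    unfold natListGet natListLen at *
    rw [List.getD_eq_getElem _ _ h]
    exact List.getElem_mem h
  simpa using lt_encode_of_mem h1

theorem natListLen_le (n : ℕ) : natListLen n ≤ n := by
  simpa [natListLen] using Encodable.length_le_encode (natList n)

theorem natListLen_ofFn {n : ℕ} (f : Fin n → ℕ) :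
    natListLen (Encodable.encode (List.ofFn f)) = n := by simp [natListLen]

theorem natListGet_ofFn {n : ℕ} (f : Fin n → ℕ) (i : Fin n) :
    natListGet (Encodable.encode (List.ofFn f)) i = f i := by simp [natListGet]

theorem encode_ofFn_eq {n k : ℕ} (f : Fin n → ℕ) (hn : natListLen k = n)
    (h : ∀ i : Fin n, f i = natListGet k i) : Encodable.encode (List.ofFn f) = k := by
  subst hn
  refine Eq.trans ?_ (encode_natList k)
  congr 1
  refine List.ext_getElem (List.length_ofFn) fun i h1 h2 => ?_
  simp [h, natListGet, h2]

/-! ### Pumping loops of a sequence -/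

/-- A discrete intermediate value theorem. -/
theorem exists_step_eq {c : ℕ → ℕ} {s e x : ℕ} (hse : s ≤ e)
    (hc : ∀ i, s ≤ i → i < e → c (i + 1) ≤ c i + 1) (hs : c s ≤ x) (he : x < c e) :
    ∃ i, s ≤ i ∧ i < e ∧ c i = x ∧ c (i + 1) = x + 1 := by
  induction e, hse using Nat.le_induction with
  | base => omega
  | succ e hse ih =>
    by_cases h : x < c e
    · obtain ⟨i, h1, h2, h3⟩ := ih (fun i h1 h2 => hc i h1 (by omega)) h
      exact ⟨i, h1, by omega, h3⟩
    · have := hc e hse (by omega)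
      exact ⟨e, hse, by omega, by omega, by omega⟩

/-- The number of extra steps taken at position `i` when the loop that ends at `i` is repeated. -/
def pumpLen (lp : ℕ → Option ℕ) (i : ℕ) : ℕ := (lp i).elim 0 fun a => i - a

/-- The time at which position `i` is first reached if each loop is repeated `L` times. -/
def pumpTime (lp : ℕ → Option ℕ) (L : ℕ) : ℕ → ℕ
  | 0 => 0
  | i + 1 => pumpTime lp L i + L * pumpLen lp i + 1

theorem pumpTime_strictMono (lp : ℕ → Option ℕ) (L : ℕ) : StrictMono (pumpTime lp L) :=
  strictMono_nat_of_lt_succ fun i => by simp only [pumpTime]; omega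

/-- Time is tiled by blocks: the block of `j` is its first arrival time followed by the `L`
repetitions of the loop that ends at `j`, if there is one. -/
theorem exists_pumpTime (lp : ℕ → Option ℕ) (L n : ℕ) :
    ∃ p : ℕ × ℕ, n = pumpTime lp L p.1 + p.2 ∧ p.2 ≤ L * pumpLen lp p.1 := by
  induction n with
  | zero => exact ⟨(0, 0), rfl, Nat.zero_le _⟩
  | succ n ih =>
    obtain ⟨⟨j, d⟩, h1, h2⟩ := ih
    dsimp only at h1 h2
    rcases h2.lt_or_eq with h | h
    · exact ⟨(j, d + 1), by simp only; omega, h⟩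
    · refine ⟨(j + 1, 0), ?_, Nat.zero_le _⟩
      simp only [pumpTime]; omega

theorem pumpTime_unique {lp : ℕ → Option ℕ} {L j d j' d' : ℕ}
    (h : pumpTime lp L j + d = pumpTime lp L j' + d') (hd : d ≤ L * pumpLen lp j)
    (hd' : d' ≤ L * pumpLen lp j') : j = j' ∧ d = d' := by
  have key : ∀ {j j'}, j < j' → pumpTime lp L j + L * pumpLen lp j + 1 ≤ pumpTime lp L j' :=
    fun {j j'} h => (pumpTime_strictMono lp L).monotone (show j + 1 ≤ j' from h)
  rcases lt_trichotomy j j' with h1 | h1 | h1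
  · have := key h1; omega
  · subst h1; omega
  · have := key h1; omega

/-- The position at time `n` if each loop is repeated `L` times. -/
noncomputable def pumpPos (lp : ℕ → Option ℕ) (L n : ℕ) : ℕ :=
  let p := (exists_pumpTime lp L n).choose
  if p.2 = 0 then p.1 else p.1 - pumpLen lp p.1 + 1 + (p.2 - 1) % pumpLen lp p.1

/-- Offset `0` is the first arrival at `j`; later offsets cycle through `a + 1, ..., j`, where `a =
j - pumpLen lp j` is the start of the loop. -/
theorem pumpPos_eq {lp : ℕ → Option ℕ} {L j d : ℕ} (hd : d ≤ L * pumpLen lp j) :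
    pumpPos lp L (pumpTime lp L j + d) =
      if d = 0 then j else j - pumpLen lp j + 1 + (d - 1) % pumpLen lp j := by
  have h := (exists_pumpTime lp L (pumpTime lp L j + d)).choose_spec
  obtain ⟨h1, h2⟩ := pumpTime_unique h.1 hd h.2
  simp only [pumpPos, ← h1, ← h2]

theorem pumpPos_pumpTime (lp : ℕ → Option ℕ) (L j : ℕ) :
    pumpPos lp L (pumpTime lp L j) = j := by
  simpa using pumpPos_eq (lp := lp) (L := L) (j := j) (d := 0) (Nat.zero_le _)

theorem le_pumpTime (lp : ℕ → Option ℕ) (L j : ℕ) : j ≤ pumpTime lp L j :=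
  (pumpTime_strictMono lp L).le_apply

theorem succ_mod_of_eq_pred {e n : ℕ} (hn : 0 < n) (h : e % n = n - 1) : (e + 1) % n = 0 := by
  rw [Nat.add_mod, h]
  rcases Nat.lt_or_ge 1 n with h1 | h1
  · rw [Nat.mod_eq_of_lt h1, Nat.sub_add_cancel hn, Nat.mod_self]
  · obtain rfl : n = 1 := by omega
    rfl

theorem succ_mod_of_ne_pred {e n : ℕ} (hn : 0 < n) (h : e % n ≠ n - 1) :
    (e + 1) % n = e % n + 1 := by
  have := Nat.mod_lt e hn
  rw [Nat.add_mod, Nat.mod_eq_of_lt (show 1 < n by omega), Nat.mod_eq_of_lt (by omega)]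

theorem pumpLen_spec {lp : ℕ → Option ℕ} (hlt : ∀ b a, lp b = some a → a < b) {j : ℕ}
    (h : 0 < pumpLen lp j) :
    ∃ a, lp j = some a ∧ j = a + pumpLen lp j := by
  cases ha : lp j with
  | none => simp [pumpLen, ha] at h
  | some a =>
    have := hlt _ _ ha
    refine ⟨a, rfl, ?_⟩
    simp only [pumpLen, ha, Option.elim]
    omega

/-- The only jumps go from the end of a loop to the successor of its start. They follow edges of a
graph as soon as both ends of each loop carry the same vertex. -/
theorem pumpPos_succ {lp : ℕ → Option ℕ} (hlt : ∀ b a, lp b = some a → a < b) (L n : ℕ) :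
    pumpPos lp L (n + 1) = pumpPos lp L n + 1 ∨
    ∃ a, lp (pumpPos lp L n) = some a ∧ pumpPos lp L (n + 1) = a + 1 := by
  obtain ⟨⟨j, d⟩, h1, h2⟩ := exists_pumpTime lp L n
  dsimp only at h1 h2
  subst h1
  rw [pumpPos_eq h2]
  rcases h2.lt_or_eq with h | h
  · have hpos : 0 < pumpLen lp j := by
      rcases Nat.eq_zero_or_pos (pumpLen lp j) with h0 | h0
      · simp [h0] at h
      · exact h0
    obtain ⟨a, ha, hj⟩ := pumpLen_spec hlt hpos
    have hja : j - pumpLen lp j = a := by omega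
    rw [add_assoc, pumpPos_eq (d := d + 1) h, if_neg d.succ_ne_zero, Nat.add_sub_cancel, hja]
    by_cases hd : d = 0
    · right
      exact ⟨a, by simp [hd, ha], by simp [hd]⟩
    · simp only [hd, if_false]
      obtain ⟨e, rfl⟩ : ∃ e, d = e + 1 := ⟨d - 1, by omega⟩
      rw [Nat.add_sub_cancel]
      have hm := Nat.mod_lt e hpos
      by_cases he : e % pumpLen lp j = pumpLen lp j - 1
      · right
        refine ⟨a, ?_, ?_⟩
        · rw [he, show a + 1 + (pumpLen lp j - 1) = j by omega, ha]
        · rw [succ_mod_of_eq_pred hpos he]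
      · left
        rw [succ_mod_of_ne_pred hpos he]
        omega
  · rw [show pumpTime lp L j + d + 1 = pumpTime lp L (j + 1) by simp only [pumpTime]; omega,
      pumpPos_pumpTime]
    left
    by_cases hd : d = 0
    · simp [hd]
    · simp only [hd, if_false]
      have hpos : 0 < pumpLen lp j := by
        rcases Nat.eq_zero_or_pos (pumpLen lp j) with h0 | h0
        · simp [h0] at h; omega
        · exact h0
      have hL : 0 < L := by
        rcases Nat.eq_zero_or_pos L with h0 | h0
        · simp [h0] at h; omega
        · exact h0
      obtain ⟨a, ha, hj⟩ := pumpLen_spec hlt hpos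
      -- The last offset `L * pumpLen lp j` completes a full round, so the block ends at `j` and the
      -- next one starts at `j + 1`.
      have : (d - 1) % pumpLen lp j = pumpLen lp j - 1 := by
        obtain ⟨k, rfl⟩ : ∃ k, L = k + 1 := ⟨L - 1, by omega⟩
        rw [show d - 1 = pumpLen lp j - 1 + pumpLen lp j * k by rw [h]; ring_nf; omega,
          Nat.add_mul_mod_self_left, Nat.mod_eq_of_lt (by omega)]
      rw [this]
      omega

theorem pumpPos_add {lp : ℕ → Option ℕ} (hlt : ∀ b a, lp b = some a → a < b) {L n t : ℕ}
    (h : ∀ s < t, lp (pumpPos lp L n + s) = none) :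
    pumpPos lp L (n + t) = pumpPos lp L n + t := by
  induction t with
  | zero => rfl
  | succ t ih =>
    have ih := ih fun s hs => h s (by omega)
    rw [← add_assoc]
    rcases pumpPos_succ hlt L (n + t) with h1 | ⟨a, ha, -⟩
    · rw [h1, ih]; rfl
    · rw [ih, h t (by omega)] at ha
      simp at ha

/-- If `A` is hit at bounded distances, and in each loop, then it is still hit at bounded distances
after pumping, and the bound does not depend on the number of repetitions. -/
theorem exists_pumpPos_hit {lp : ℕ → Option ℕ} (hlt : ∀ b a, lp b = some a → a < b)
    (hin : ∀ b a, lp b = some a → ∀ i, a < i → i < b → lp i = none) {A : ℕ → Prop} {D : ℕ}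
    (hA : ∀ n, ∃ i, n ≤ i ∧ i ≤ n + D ∧ A i)
    (hloop : ∀ b a, lp b = some a → ∃ i, a < i ∧ i ≤ b ∧ A i) (L n : ℕ) :
    ∃ i, n ≤ i ∧ i ≤ n + (2 * D + 1) ∧ A (pumpPos lp L i) := by
  classical
  -- Either there is a jump back within the next `D` steps, and the loop just entered supplies the
  -- hit, or the sequence runs like the original one for `D` steps.
  by_cases h : ∃ t, t < D ∧ pumpPos lp L (n + t + 1) ≠ pumpPos lp L (n + t) + 1
  · obtain ⟨t, ht, hne⟩ := h
    obtain ⟨a, ha, h1⟩ := (pumpPos_succ hlt L (n + t)).resolve_left hne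
    set b := pumpPos lp L (n + t)
    have hab := hlt _ _ ha
    -- The earlier of the next hit after `a + 1` and a hit inside the loop is both close to `a + 1`
    -- and within the loop, so no second jump comes before it.
    obtain ⟨i, hi1, hi2, hi3, hi4⟩ : ∃ i, a + 1 ≤ i ∧ i ≤ a + 1 + D ∧ i ≤ b ∧ A i := by
      obtain ⟨i, h1, h2, h3⟩ := hA (a + 1)
      obtain ⟨j, h4, h5, h6⟩ := hloop _ _ ha
      rcases le_total i j with hij | hij
      · exact ⟨i, h1, h2, hij.trans h5, h3⟩
      · exact ⟨j, h4, hij.trans h2, h5, h6⟩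
    refine ⟨n + t + 1 + (i - (a + 1)), by omega, by omega, ?_⟩
    rw [pumpPos_add hlt, h1, Nat.add_sub_cancel' hi1]
    · exact hi4
    · intro s hs
      rw [h1]
      exact hin _ _ ha _ (by omega) (by omega)
  · push Not at h
    have h1 : ∀ t ≤ D, pumpPos lp L (n + t) = pumpPos lp L n + t := by
      intro t
      induction t with
      | zero => intro _; rfl
      | succ t ih => intro ht; rw [← add_assoc, h t (by omega), ih (by omega)]; rfl
    obtain ⟨i, h2, h3, h4⟩ := hA (pumpPos lp L n)
    refine ⟨n + (i - pumpPos lp L n), by omega, by omega, ?_⟩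
    rwa [h1 _ (by omega), Nat.add_sub_cancel' h2]

/-- If no loop contains a point of `Q`, but there is a loop between any two points of `Q`, then
their distance is at least `L` if each loop is repeated `L` times. -/
theorem le_of_pumpPos_mem {lp : ℕ → Option ℕ} (hlt : ∀ b a, lp b = some a → a < b)
    {Q : ℕ → Prop} (hQ : ∀ b a, lp b = some a → ∀ i, a < i → i ≤ b → ¬ Q i)
    (hgap : ∀ q q', Q q → Q q' → q < q' → ∃ b a, lp b = some a ∧ q ≤ b ∧ b < q')
    {L n n' : ℕ} (hn : Q (pumpPos lp L n)) (hn' : Q (pumpPos lp L n')) (h : n < n') :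
    n + L ≤ n' := by
  -- Positive offsets lie inside loops, which avoid `Q`; hence points of `Q` occur only at first
  -- arrival times.
  have key : ∀ n, Q (pumpPos lp L n) → n = pumpTime lp L (pumpPos lp L n) := by
    intro n hn
    obtain ⟨⟨j, d⟩, h1, h2⟩ := exists_pumpTime lp L n
    dsimp only at h1 h2
    subst h1
    by_cases hd : d = 0
    · subst hd
      rw [add_zero, pumpPos_pumpTime]
    · have hpos : 0 < pumpLen lp j := by
        rcases Nat.eq_zero_or_pos (pumpLen lp j) with h0 | h0
        · simp [h0] at h2; omega
        · exact h0
      obtain ⟨a, ha, hj⟩ := pumpLen_spec hlt hpos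
      rw [pumpPos_eq h2, if_neg hd] at hn
      have hm := Nat.mod_lt (d - 1) hpos
      exact absurd hn (hQ _ _ ha _ (by omega) (by omega))
  have hmono := pumpTime_strictMono lp L
  have hlt' : pumpPos lp L n < pumpPos lp L n' := by
    rw [← hmono.lt_iff_lt, ← key n hn, ← key n' hn']; exact h
  obtain ⟨b, a, hb, h1, h2⟩ := hgap _ _ hn hn' hlt'
  have h3 := hmono.monotone h1
  have h4 := hmono.monotone (Nat.succ_le_of_lt h2)
  have hab := hlt _ _ hb
  simp only [pumpTime] at h4
  rw [← key n hn] at h3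
  rw [← key n' hn'] at h4
  -- A loop has length at least one, so its `L` repetitions take at least `L` steps.
  have h5 : L * 1 ≤ L * pumpLen lp b := Nat.mul_le_mul_left L (by
    simp only [pumpLen, hb, Option.elim]; omega)
  omega

/-! ### Walks -/

theorem exists_walk {α : Type*} {R : α → α → Prop} {a b : α} (h : Relation.ReflTransGen R a b) :
    ∃ (n : ℕ) (g : ℕ → α), g 0 = a ∧ g n = b ∧ ∀ i < n, R (g i) (g (i + 1)) := by
  induction h with
  | refl => exact ⟨0, fun _ => a, rfl, rfl, by simp⟩
  | @tail b c _ hbc ih =>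
    obtain ⟨n, g, h0, hn, hg⟩ := ih
    refine ⟨n + 1, fun i => if i ≤ n then g i else c, by simp [h0], by simp, fun i hi => ?_⟩
    rcases (Nat.lt_succ_iff.1 hi).lt_or_eq with h | rfl
    · simpa [h.le, h] using hg i h
    · simpa [hn] using hbc

theorem walk_append {α : Type*} {R : α → α → Prop} {n n' : ℕ} {g g' : ℕ → α}
    (hg : ∀ i < n, R (g i) (g (i + 1))) (hg' : ∀ i < n', R (g' i) (g' (i + 1)))
    (h : g n = g' 0) : ∃ f : ℕ → α, (∀ i ≤ n, f i = g i) ∧ (∀ i, f (n + i) = g' i) ∧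
      ∀ i < n + n', R (f i) (f (i + 1)) := by
  have h1 : ∀ i, (if n + i ≤ n then g (n + i) else g' (n + i - n)) = g' i := by
    intro i
    rcases Nat.eq_zero_or_pos i with rfl | hi
    · simp [h]
    · rw [if_neg (by omega), Nat.add_sub_cancel_left]
  refine ⟨fun i => if i ≤ n then g i else g' (i - n), fun i hi => if_pos hi, h1,
    fun i hi => ?_⟩
  rcases Nat.lt_or_ge i n with hin | hin
  · simpa [hin.le, Nat.succ_le_of_lt hin] using hg i hin
  · obtain ⟨k, rfl⟩ := Nat.exists_eq_add_of_le hin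
    have h2 := h1 (k + 1)
    rw [← add_assoc] at h2
    simp only [h1, h2]
    exact hg' k (by omega)

theorem reflTransGen_of_path {α : Type*} {R : α → α → Prop} {g : ℕ → α}
    (hg : ∀ i, R (g i) (g (i + 1))) {i j : ℕ} (h : i ≤ j) :
    Relation.ReflTransGen R (g i) (g j) := by
  induction j, h using Nat.le_induction with
  | base => exact .refl
  | succ j _ ih => exact ih.tail (hg j)

theorem transGen_of_path {α : Type*} {R : α → α → Prop} {g : ℕ → α}
    (hg : ∀ i, R (g i) (g (i + 1))) {i j : ℕ} (h : i < j) :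
    Relation.TransGen R (g i) (g j) :=
  .head' (hg i) (reflTransGen_of_path hg h)

/-- The pigeonhole principle for infinitely many points of a sequence in a finite set. -/
theorem exists_recurrent {α : Type*} {g : ℕ → α} {s : Set α} (hs : s.Finite)
    (hg : ∀ i, g i ∈ s) {P : ℕ → Prop} (hP : ∀ n, ∃ i, n ≤ i ∧ P i) :
    ∃ x, ∀ n, ∃ i, n ≤ i ∧ P i ∧ g i = x := by
  by_contra! h
  choose m hm using h
  obtain ⟨B, hB⟩ := (hs.image m).bddAbove
  obtain ⟨i, hi, hPi⟩ := hP B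
  exact hm (g i) i ((hB ⟨_, hg i, rfl⟩).trans hi) hPi rfl

/-! ### Graphs with bounded and unbounded recurrence conditions -/

/-- A finite graph on the numbers below `N`, with sets `I` of initial vertices and `Q` of marked
vertices, sets `F j` of vertices that have to be visited infinitely often, and sets `H m` of
vertices that have to be visited at bounded distances. -/
structure PromptGraph where
  N : ℕ
  h : ℕ
  J : ℕ
  E : ℕ → ℕ → Prop
  I : ℕ → Prop
  Q : ℕ → Prop
  H : ℕ → ℕ → Prop
  F : ℕ → ℕ → Prop
  lt_of_E : ∀ {u v}, E u v → u < N ∧ v < N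
  not_Q_of_I : ∀ {v}, I v → ¬ Q v
  h_pos : 0 < h
  H_of_F : ∀ m < h, ∃ j < J, ∀ v, F j v → H m v

namespace PromptGraph

variable (G : PromptGraph)

/-- The sequence `π` is a fair path on which the bounded recurrence conditions hold with bound `K`,
and marked vertices have distance at least `L`. -/
structure IsPath (π : ℕ → ℕ) (K L : ℕ) : Prop where
  init : G.I (π 0)
  edge : ∀ i, G.E (π i) (π (i + 1))
  fair : ∀ j < G.J, ∀ n, ∃ i, n ≤ i ∧ G.F j (π i)
  bounded : ∀ m < G.h, ∀ n, ∃ i, n ≤ i ∧ i ≤ n + K ∧ G.H m (π i)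
  gap : ∀ i j, i < j → G.Q (π i) → G.Q (π j) → i + L ≤ j

/-- Between two marked vertices, this many steps of the counter are required. -/
def bound : ℕ := G.N * G.h

/-- The edges of the graph in which a counter counts, between two marked vertices, visits to the
sets `H m`, which have to be visited in a cyclic order. -/
def CounterStep (u v : ℕ × ℕ) : Prop :=
  G.E u.1 v.1 ∧ ((G.Q v.1 ∧ u.2 = G.bound ∧ v.2 = 0) ∨
    (¬ G.Q v.1 ∧ (v.2 = u.2 ∨ (u.2 < G.bound ∧ v.2 = u.2 + 1 ∧ G.H (u.2 % G.h) v.1))))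

/-- There is a reachable cycle that visits all the sets `F j`. -/
def Accepting : Prop :=
  ∃ v x, G.I v ∧ Relation.ReflTransGen G.CounterStep (v, G.bound) x ∧
    Relation.TransGen G.CounterStep x x ∧
    ∀ j < G.J, ∃ u, G.F j u.1 ∧ Relation.ReflTransGen G.CounterStep x u ∧
      Relation.ReflTransGen G.CounterStep u x

variable {G}

theorem CounterStep.le_bound {u v : ℕ × ℕ} (h : G.CounterStep u v) (hu : u.2 ≤ G.bound) :
    v.2 ≤ G.bound := by
  obtain ⟨-, ⟨-, -, h⟩ | ⟨-, h | ⟨h1, h, -⟩⟩⟩ := h <;> omega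

theorem CounterStep.le_succ {u v : ℕ × ℕ} (h : G.CounterStep u v) : v.2 ≤ u.2 + 1 := by
  obtain ⟨-, ⟨-, -, h⟩ | ⟨-, h | ⟨h1, h, -⟩⟩⟩ := h <;> omega

/-- The counter of the canonical run of the counter along a path. -/
noncomputable def runCounter (G : PromptGraph) (π : ℕ → ℕ) : ℕ → ℕ
  | 0 => G.bound
  | i + 1 =>
    open Classical in
    if G.Q (π (i + 1)) then 0 else
      if runCounter G π i < G.bound ∧ G.H (runCounter G π i % G.h) (π (i + 1)) then
        runCounter G π i + 1 else runCounter G π i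

theorem runCounter_le (π : ℕ → ℕ) (i : ℕ) : G.runCounter π i ≤ G.bound := by
  induction i with
  | zero => exact le_rfl
  | succ i ih =>
    simp only [runCounter]
    split_ifs with h1 h2
    · exact Nat.zero_le _
    · exact h2.1
    · exact ih

/-- The counter is reset only at marks, so it is monotone between them. -/
theorem runCounter_le_add {π : ℕ → ℕ} {i : ℕ} (t : ℕ)
    (hQ : ∀ s, i < s → s ≤ i + t → ¬ G.Q (π s)) :
    G.runCounter π i ≤ G.runCounter π (i + t) := by
  induction t with
  | zero => rfl
  | succ t ih =>
    refine (ih fun s h1 h2 => hQ s h1 (by omega)).trans ?_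
    rw [← add_assoc]
    simp only [runCounter]
    rw [if_neg (hQ _ (by omega) (by omega))]
    split_ifs <;> omega

/-- The counter with value `c` waits for the set `H (c % h)`, which is visited within the next `K +
1` steps; so without a mark it advances in that time unless it is full. -/
theorem runCounter_progress {π : ℕ → ℕ} {K : ℕ}
    (hb : ∀ m < G.h, ∀ n, ∃ i, n ≤ i ∧ i ≤ n + K ∧ G.H m (π i)) {i : ℕ}
    (hQ : ∀ s, i < s → s ≤ i + (K + 1) → ¬ G.Q (π s)) :
    min G.bound (G.runCounter π i + 1) ≤ G.runCounter π (i + (K + 1)) := by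
  by_contra! hlt
  have hle := runCounter_le_add (K + 1) hQ
  have hc : ∀ t ≤ K + 1, G.runCounter π (i + t) = G.runCounter π i := by
    intro t ht
    have h1 := runCounter_le_add t (π := π) (i := i) fun s h1 h2 => hQ s h1 (by omega)
    have h2 := runCounter_le_add (K + 1 - t) (π := π) (i := i + t)
      fun s h1 h2 => hQ s (by omega) (by omega)
    rw [show i + t + (K + 1 - t) = i + (K + 1) by omega] at h2
    omega
  obtain ⟨j, h1, h2, h3⟩ := hb (G.runCounter π i % G.h) (Nat.mod_lt _ G.h_pos) (i + 1)
  have h4 := hc (j - 1 - i) (by omega)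
  have h5 := hc (j - i) (by omega)
  rw [show i + (j - 1 - i) = j - 1 by omega] at h4
  rw [show i + (j - i) = j - 1 + 1 by omega] at h5
  simp only [runCounter] at h5
  rw [if_neg (hQ _ (by omega) (by omega)), h4, show j - 1 + 1 = j by omega,
    if_pos ⟨by omega, h3⟩] at h5
  omega

theorem runCounter_ge {π : ℕ → ℕ} {K : ℕ}
    (hb : ∀ m < G.h, ∀ n, ∃ i, n ≤ i ∧ i ≤ n + K ∧ G.H m (π i)) {i : ℕ} (k : ℕ)
    (hQ : ∀ s, i < s → s ≤ i + k * (K + 1) → ¬ G.Q (π s)) :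
    min G.bound k ≤ G.runCounter π (i + k * (K + 1)) := by
  induction k with
  | zero => simp
  | succ k ih =>
    have h1 := ih fun s h1 h2 => hQ s h1 (by rw [Nat.succ_mul]; omega)
    have h2 := runCounter_progress hb (i := i + k * (K + 1)) fun s h1 h2 =>
      hQ s (by omega) (by rw [Nat.succ_mul]; omega)
    rw [Nat.succ_mul, ← add_assoc]
    omega

/-- The only condition at stake is that the counter is full when a mark is reached. Each increment
costs at most `K + 1` steps, and the gap leaves room for `bound` of them. -/
theorem counterStep_runCounter {π : ℕ → ℕ} {K L : ℕ} (hπ : G.IsPath π K L)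
    (hL : (G.bound + 1) * (K + 1) ≤ L) (i : ℕ) :
    G.CounterStep (π i, G.runCounter π i) (π (i + 1), G.runCounter π (i + 1)) := by
  refine ⟨hπ.edge i, ?_⟩
  by_cases hq : G.Q (π (i + 1))
  · refine .inl ⟨hq, ?_, by simp [runCounter, hq]⟩
    refine le_antisymm (runCounter_le π i) ?_
    by_cases hex : ∃ j ≤ i, G.Q (π j)
    · classical
      obtain ⟨j, hj, hjq⟩ := hex
      have hgap := hπ.gap j (i + 1) (by omega) hjq hq
      rw [Nat.succ_mul] at hL
      -- The summand `1` in `bound + 1` gives slack: the whole window before `i` is free of marks.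
      -- Since an earlier mark exists, the gap also shows that the subtraction is not truncated.
      have hno : ∀ s, i - G.bound * (K + 1) < s → s ≤ i → ¬ G.Q (π s) := by
        intro s h1 h2 hs
        have := hπ.gap s (i + 1) (by omega) hs hq
        omega
      have h1 := runCounter_ge hπ.bounded (i := i - G.bound * (K + 1)) G.bound fun s h1 h2 =>
        hno s h1 (by omega)
      rw [show i - G.bound * (K + 1) + G.bound * (K + 1) = i by omega] at h1
      omega
    -- Before the first mark nothing has to be counted: the counter starts full and is never reset.
    · push Not at hex
      have := runCounter_le_add (G := G) (π := π) (i := 0) i fun s _ h => hex s (by omega)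
      rw [zero_add] at this
      exact this
  · refine .inr ⟨hq, ?_⟩
    simp only [runCounter, if_neg hq]
    split_ifs with h
    · exact .inr ⟨h.1, rfl, h.2⟩
    · exact .inl rfl

/-- One sufficiently large `L` is enough. The counted path stays in a finite set, so some node
recurs forever, and fairness places a visit to each `F j` between two of its occurrences. -/
theorem accepting_of_isPath {K : ℕ} (h : ∀ L, ∃ π, G.IsPath π K L) : G.Accepting := by
  obtain ⟨π, hπ⟩ := h ((G.bound + 1) * (K + 1))
  set g : ℕ → ℕ × ℕ := fun i => (π i, G.runCounter π i) with hg
  have hstep : ∀ i, G.CounterStep (g i) (g (i + 1)) := counterStep_runCounter hπ le_rfl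
  have hfin : (Set.Iio G.N ×ˢ Set.Iic G.bound).Finite :=
    (Set.finite_Iio _).prod (Set.finite_Iic _)
  have hmem : ∀ i, g i ∈ Set.Iio G.N ×ˢ Set.Iic G.bound := fun i =>
    ⟨(G.lt_of_E (hπ.edge i)).1, runCounter_le π i⟩
  obtain ⟨x, hx⟩ := exists_recurrent hfin hmem (P := fun _ => True) fun n => ⟨n, le_rfl, trivial⟩
  obtain ⟨i, -, -, hi⟩ := hx 0
  obtain ⟨j, hj, -, hj'⟩ := hx (i + 1)
  refine ⟨π 0, x, hπ.init, ?_, ?_, fun k hk => ?_⟩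
  · have := reflTransGen_of_path hstep (Nat.zero_le i)
    rwa [hi] at this
  · have := transGen_of_path hstep (show i < j by omega)
    rwa [hi, hj'] at this
  · obtain ⟨a, ha, hFa⟩ := hπ.fair k hk i
    obtain ⟨b, hb, -, hb'⟩ := hx a
    refine ⟨g a, hFa, ?_, ?_⟩
    · have := reflTransGen_of_path hstep ha
      rwa [hi] at this
    · have := reflTransGen_of_path hstep hb
      rwa [hb'] at this

/-- The closed walks through the separate witnesses all pass through `x`, so they can be
concatenated. The base case uses the given nonempty cycle, to have positive length. -/
theorem Accepting.exists_cycle {x : ℕ × ℕ} (hx : Relation.TransGen G.CounterStep x x) {J : ℕ}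
    (h : ∀ j < J, ∃ u, G.F j u.1 ∧ Relation.ReflTransGen G.CounterStep x u ∧
      Relation.ReflTransGen G.CounterStep u x) :
    ∃ (n : ℕ) (g : ℕ → ℕ × ℕ), 0 < n ∧ g 0 = x ∧ g n = x ∧
      (∀ i < n, G.CounterStep (g i) (g (i + 1))) ∧ ∀ j < J, ∃ i < n, G.F j (g i).1 := by
  induction J with
  | zero =>
    obtain ⟨y, hy, hxy⟩ := Relation.TransGen.head'_iff.1 hx
    obtain ⟨n, g, h0, hn, hg⟩ := exists_walk hxy
    obtain ⟨f, hf1, hf2, hf3⟩ := walk_append (n := 1) (n' := n) (R := G.CounterStep)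
      (g := fun i => if i = 0 then x else y) (g' := g) (by simpa using hy) hg (by simp [h0])
    refine ⟨1 + n, f, by omega, by simp [hf1], by rw [hf2, hn], hf3, by simp⟩
  | succ J ih =>
    obtain ⟨n, g, hpos, h0, hn, hg, hF⟩ := ih fun j hj => h j (by omega)
    obtain ⟨u, hu, h1, h2⟩ := h J (by omega)
    obtain ⟨n1, g1, h10, h1n, hg1⟩ := exists_walk h1
    obtain ⟨n2, g2, h20, h2n, hg2⟩ := exists_walk h2
    obtain ⟨f2, a1, a2, a3⟩ := walk_append hg2 hg (h2n.trans h0.symm)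
    obtain ⟨f, b1, b2, b3⟩ := walk_append hg1 a3 (h1n.trans (by rw [a1 0 (Nat.zero_le _), h20]))
    refine ⟨n1 + (n2 + n), f, by omega, by rw [b1 0 (Nat.zero_le _), h10],
      by rw [b2, a2, hn], b3, fun j hj => ?_⟩
    rcases (Nat.lt_succ_iff.1 hj).lt_or_eq with h | rfl
    · obtain ⟨i, hi, hFi⟩ := hF j h
      exact ⟨n1 + (n2 + i), by omega, by rwa [b2, a2]⟩
    · exact ⟨n1 + 0, by omega, by rwa [b2, a1 0 (Nat.zero_le _), h20]⟩

/-- An accepting graph has a path of the counter graph that visits each set `F j` at bounded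
distances. -/
theorem Accepting.exists_path (h : G.Accepting) : ∃ (g : ℕ → ℕ × ℕ) (D : ℕ), G.I (g 0).1 ∧
    (g 0).2 = G.bound ∧ (∀ i, G.CounterStep (g i) (g (i + 1))) ∧
    ∀ j < G.J, ∀ n, ∃ i, n ≤ i ∧ i ≤ n + D ∧ G.F j (g i).1 := by
  obtain ⟨v, x, hv, hvx, hxx, hF⟩ := h
  obtain ⟨n1, g1, h10, h1n, hg1⟩ := exists_walk hvx
  obtain ⟨n, g, hpos, h0, hn, hg, hF⟩ := Accepting.exists_cycle hxx hF
  have hcyc : ∀ k, G.CounterStep (g (k % n)) (g ((k + 1) % n)) := by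
    intro k
    have hm := Nat.mod_lt k hpos
    by_cases hk : k % n = n - 1
    · rw [succ_mod_of_eq_pred hpos hk, h0, ← hn]
      have := hg (k % n) hm
      rwa [show k % n + 1 = n by omega] at this
    · rw [succ_mod_of_ne_pred hpos hk]
      exact hg _ hm
  -- A lasso: the access walk, followed by the cycle forever.
  set f : ℕ → ℕ × ℕ := fun i => if i < n1 then g1 i else g ((i - n1) % n) with hf
  have hfge : ∀ k, f (n1 + k) = g (k % n) := by
    intro k
    simp only [hf]
    rw [if_neg (by omega), Nat.add_sub_cancel_left]
  have hfle : ∀ i ≤ n1, f i = g1 i := by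
    intro i hi
    rcases hi.lt_or_eq with hi | rfl
    · simp only [hf, if_pos hi]
    · rw [← add_zero i, hfge, Nat.zero_mod, h0, add_zero, h1n]
  have hf0 : f 0 = (v, G.bound) := by rw [hfle 0 (Nat.zero_le _), h10]
  refine ⟨f, n1 + 2 * n, by rw [hf0]; exact hv, by rw [hf0], fun i => ?_, fun j hj k => ?_⟩
  · rcases Nat.lt_or_ge i n1 with hi | hi
    · rw [hfle i hi.le, hfle (i + 1) hi]
      exact hg1 i hi
    · obtain ⟨k, rfl⟩ := Nat.exists_eq_add_of_le hi
      rw [hfge, add_assoc, hfge]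
      exact hcyc k
  · obtain ⟨i, hi, hFi⟩ := hF j hj
    -- Round `k / n + 1` of the cycle starts after `k`, and it is over before `k + n1 + 2 * n`.
    refine ⟨n1 + ((k / n + 1) * n + i), ?_, ?_, ?_⟩
    · have := Nat.lt_div_mul_add hpos (a := k)
      rw [Nat.succ_mul]; omega
    · have := Nat.div_mul_le_self k n
      rw [Nat.succ_mul]; omega
    · rw [hfge, Nat.add_comm, Nat.add_mul_mod_self_right, Nat.mod_eq_of_lt hi]
      exact hFi

end PromptGraph

/-! ### Pumping the loops between marks -/

namespace PromptGraph

variable {G : PromptGraph}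

/-- Between consecutive marked vertices of a path of the counter graph there is a loop that visits
all the sets `H m`. -/
theorem exists_loop {g : ℕ → ℕ × ℕ} (hI : G.I (g 0).1)
    (hg : ∀ i, G.CounterStep (g i) (g (i + 1))) {q q' : ℕ} (hq : G.Q (g q).1)
    (hq' : G.Q (g q').1) (hqq : q < q') (hno : ∀ i, q < i → i < q' → ¬ G.Q (g i).1) :
    ∃ a b, q ≤ a ∧ a < b ∧ b < q' ∧ (g a).1 = (g b).1 ∧
      ∀ m < G.h, ∃ i, a < i ∧ i ≤ b ∧ G.H m (g i).1 := by
  have hpos := G.h_pos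
  have hN : 0 < G.N := (Nat.zero_le _).trans_lt (G.lt_of_E (hg 0).1).1
  have hM : 0 < G.bound := Nat.mul_pos hN hpos
  -- The mark at `q` has reset the counter; here it matters that the initial vertex, which would
  -- carry a full counter, is unmarked.
  have hc0 : (g q).2 = 0 := by
    rcases Nat.eq_zero_or_pos q with rfl | h
    · exact absurd hq (G.not_Q_of_I hI)
    · obtain ⟨p, rfl⟩ : ∃ p, q = p + 1 := ⟨q - 1, by omega⟩
      obtain ⟨-, ⟨-, -, h⟩ | ⟨h, -⟩⟩ := hg p
      · exact h
      · exact absurd hq h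
  obtain ⟨e, rfl⟩ : ∃ e, q' = e + 1 := ⟨q' - 1, by omega⟩
  have hce : (g e).2 = G.bound := by
    obtain ⟨-, ⟨-, h, -⟩ | ⟨h, -⟩⟩ := hg e
    · exact h
    · exact absurd hq' h
  have hmono : ∀ i j, q ≤ i → i ≤ j → j ≤ e → (g i).2 ≤ (g j).2 := by
    intro i j hi hij
    induction j, hij using Nat.le_induction with
    | base => intro _; rfl
    | succ j hij ih =>
      intro hj
      refine (ih (by omega)).trans ?_
      obtain ⟨-, ⟨h, -⟩ | ⟨-, h | ⟨-, h, -⟩⟩⟩ := hg j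
      · exact absurd h (hno _ (by omega) (by omega))
      · exact h.ge
      · omega
  have hstep : ∀ s t x, q ≤ s → s ≤ t → t ≤ e → (g s).2 ≤ x → x < (g t).2 →
      ∃ i, s ≤ i ∧ i < t ∧ (g i).2 = x ∧ (g (i + 1)).2 = x + 1 := fun s t x _ hst _ hsx hxt =>
    exists_step_eq (c := fun i => (g i).2) hst (fun i _ _ => (hg i).le_succ) hsx hxt
  -- The counter rises from `0` to `N * h` in unit steps and passes all `N + 1` multiples of `h`;
  -- with at most `N` vertices available, two of these times share a vertex.
  have htime : ∀ k : Fin (G.N + 1), ∃ t, q ≤ t ∧ t ≤ e ∧ (g t).2 = k * G.h := by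
    intro k
    have hk : k * G.h ≤ G.bound := Nat.mul_le_mul_right _ (Nat.lt_succ_iff.1 k.2)
    rcases hk.lt_or_eq with hk | hk
    · obtain ⟨i, h1, h2, h3, -⟩ := hstep q e (k * G.h) le_rfl (by omega) le_rfl (by omega)
        (by omega)
      exact ⟨i, h1, h2.le, h3⟩
    · exact ⟨e, by omega, le_rfl, by omega⟩
  choose t ht1 ht2 ht3 using htime
  -- Between two such times the counter passes at least `h` consecutive values, hence every residue
  -- modulo `h`; the increment at residue `m` is a visit to `H m`.
  have hloop : ∀ k k' : Fin (G.N + 1), k < k' → (g (t k)).1 = (g (t k')).1 →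
      ∃ a b, q ≤ a ∧ a < b ∧ b < e + 1 ∧ (g a).1 = (g b).1 ∧
      ∀ m < G.h, ∃ i, a < i ∧ i ≤ b ∧ G.H m (g i).1 := by
    intro k k' hk heq
    have hkk : k * G.h + G.h ≤ k' * G.h := by
      rw [← Nat.succ_mul]
      exact Nat.mul_le_mul_right _ hk
    have hlt : t k < t k' := by
      by_contra! h
      have := hmono _ _ (ht1 k') h (ht2 k)
      rw [ht3, ht3] at this
      omega
    refine ⟨t k, t k', ht1 k, hlt, Nat.lt_succ_of_le (ht2 k'), heq, fun m hm => ?_⟩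
    obtain ⟨i, h1, h2, h3, h4⟩ := hstep (t k) (t k') (k * G.h + m) (ht1 k) hlt.le (ht2 k')
      (by rw [ht3]; omega) (by rw [ht3]; omega)
    refine ⟨i + 1, by omega, h2, ?_⟩
    obtain ⟨-, ⟨h, -⟩ | ⟨-, h | ⟨-, -, h⟩⟩⟩ := hg i
    · have := ht1 k
      have := ht2 k'
      exact absurd h (hno _ (by omega) (by omega))
    · omega
    · rwa [h3, Nat.mul_comm, Nat.mul_add_mod, Nat.mod_eq_of_lt hm] at h
  obtain ⟨k, k', hne, heq⟩ := Fintype.exists_ne_map_eq_of_card_lt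
    (fun k : Fin (G.N + 1) => (⟨(g (t k)).1, (G.lt_of_E (hg _).1).1⟩ : Fin G.N)) (by simp)
  rw [Fin.mk.injEq] at heq
  rcases lt_or_gt_of_ne hne with h | h
  · exact hloop k k' h heq
  · exact hloop k' k h heq.symm

/-- The path of an accepting lasso meets every `F j`, hence every `H m`, at distances at most `D`.
Repeating the loops between consecutive marks `L` times separates the marks and keeps the bound `2 *
D + 1`, since each loop visits all `H m`. -/
theorem exists_isPath_of_accepting (h : G.Accepting) : ∃ K, ∀ L, ∃ π, G.IsPath π K L := by
  classical
  obtain ⟨g, D, hI, -, hg, hF⟩ := h.exists_path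
  set π : ℕ → ℕ := fun i => (g i).1 with hπ
  -- the loops
  have hex : ∀ q, (G.Q (π q) ∧ ∃ q', q < q' ∧ G.Q (π q')) → ∃ a b, q ≤ a ∧ a < b ∧
      (∀ q', q < q' → G.Q (π q') → b < q') ∧ π a = π b ∧
      ∀ m < G.h, ∃ i, a < i ∧ i ≤ b ∧ G.H m (π i) := by
    rintro q ⟨hq, hq'⟩
    obtain ⟨h1, h2⟩ := Nat.find_spec hq'
    obtain ⟨a, b, ha, hab, hb, h3, h4⟩ := exists_loop hI hg hq h2 h1 fun i hi1 hi2 hQ =>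
      Nat.find_min hq' hi2 ⟨hi1, hQ⟩
    exact ⟨a, b, ha, hab, fun q' h5 h6 => hb.trans_le (Nat.find_min' hq' ⟨h5, h6⟩), h3, h4⟩
  choose! α β hα hαβ hβ heq hH using hex
  set Lp : ℕ → ℕ → Prop := fun b q =>
    (G.Q (π q) ∧ ∃ q', q < q' ∧ G.Q (π q')) ∧ β q = b with hLp
  set lp : ℕ → Option ℕ := fun b => if h : ∃ q, Lp b q then some (α h.choose) else none with hlp
  have hsome : ∀ b a, lp b = some a →
      ∃ q, (G.Q (π q) ∧ ∃ q', q < q' ∧ G.Q (π q')) ∧ β q = b ∧ α q = a := by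
    intro b a hab
    simp only [hlp] at hab
    split_ifs at hab with hex
    refine ⟨hex.choose, hex.choose_spec.1, hex.choose_spec.2, by simpa using hab⟩
  have hlt : ∀ b a, lp b = some a → a < b := by
    intro b a hab
    obtain ⟨q, hq, rfl, rfl⟩ := hsome b a hab
    exact hαβ q hq
  -- Loops belonging to different marks are confined to disjoint intervals between consecutive
  -- marks, so no loop ends inside another one.
  have hin : ∀ b a, lp b = some a → ∀ i, a < i → i < b → lp i = none := by
    intro b a hab i hi1 hi2
    by_contra hne
    obtain ⟨a', ha'⟩ := Option.ne_none_iff_exists'.1 hne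
    obtain ⟨q, hq, rfl, rfl⟩ := hsome b a hab
    obtain ⟨q', hq', rfl, rfl⟩ := hsome i a' ha'
    rcases lt_trichotomy q q' with h1 | rfl | h1
    · have := hβ q hq q' h1 hq'.1
      have := hα q' hq'
      have := hαβ q' hq'
      omega
    · omega
    · have := hβ q' hq' q h1 hq.1
      have := hα q hq
      omega
  have hloopQ : ∀ b a, lp b = some a → ∀ i, a < i → i ≤ b → ¬ G.Q (π i) := by
    intro b a hab i hi1 hi2 hQ
    obtain ⟨q, hq, rfl, rfl⟩ := hsome b a hab
    have := hα q hq
    have := hβ q hq i (by omega) hQ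
    omega
  have hgap : ∀ q q', G.Q (π q) → G.Q (π q') → q < q' →
      ∃ b a, lp b = some a ∧ q ≤ b ∧ b < q' := by
    intro q q' hq hq' hqq
    have hs : G.Q (π q) ∧ ∃ q', q < q' ∧ G.Q (π q') := ⟨hq, q', hqq, hq'⟩
    have hex : ∃ r, Lp (β q) r := ⟨q, hs, rfl⟩
    refine ⟨β q, α hex.choose, dif_pos hex, ?_, hβ q hs q' hqq hq'⟩
    have := hα q hs
    have := hαβ q hs
    omega
  have heq' : ∀ b a, lp b = some a → π a = π b := by
    intro b a hab
    obtain ⟨q, hq, rfl, rfl⟩ := hsome b a hab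
    exact heq q hq
  refine ⟨2 * D + 1, fun L => ⟨fun n => π (pumpPos lp L n), ?_, ?_, ?_, ?_, ?_⟩⟩
  · have := pumpPos_pumpTime lp L 0
    rw [pumpTime] at this
    simp only [this]
    exact hI
  · intro n
    rcases pumpPos_succ hlt L n with h1 | ⟨a, ha, h1⟩
    · simp only [h1]
      exact (hg _).1
    -- The jump from the end of the loop uses the edge that leaves its start.
    · simp only [h1, ← heq' _ _ ha]
      exact (hg _).1
  · intro j hj n
    obtain ⟨i, h1, -, h2⟩ := hF j hj n
    -- Pumping skips no position, so fairness is inherited.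
    refine ⟨pumpTime lp L i, h1.trans (le_pumpTime lp L i), ?_⟩
    simp only [pumpPos_pumpTime]
    exact h2
  · intro m hm n
    obtain ⟨j, hj, hjm⟩ := G.H_of_F m hm
    refine exists_pumpPos_hit hlt hin (A := fun i => G.H m (π i)) ?_ ?_ L n
    · intro n
      obtain ⟨i, h1, h2, h3⟩ := hF j hj n
      exact ⟨i, h1, h2, hjm _ h3⟩
    · intro b a hab
      obtain ⟨q, hq, rfl, rfl⟩ := hsome b a hab
      exact hH q hq m hm
  · intro i j hij hi hj
    exact le_of_pumpPos_mem hlt (Q := fun i => G.Q (π i)) hloopQ hgap hi hj hij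

theorem accepting_iff : G.Accepting ↔ ∃ K, ∀ L, ∃ π, G.IsPath π K L :=
  ⟨exists_isPath_of_accepting, fun ⟨_, h⟩ => accepting_of_isPath h⟩

end PromptGraph

/-! ### Tableaux for PROMPT-LTL -/

section CodeParts

/-- The main operator of the formula with code `m`. -/
def opCode (m : ℕ) : ℕ := m.unpair.1

def argCode (m : ℕ) : ℕ := m.unpair.2

def leftCode (m : ℕ) : ℕ := m.unpair.2.unpair.1

def rightCode (m : ℕ) : ℕ := m.unpair.2.unpair.2

@[simp] theorem opCode_pair (a b : ℕ) : opCode (Nat.pair a b) = a := by simp [opCode]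
@[simp] theorem argCode_pair (a b : ℕ) : argCode (Nat.pair a b) = b := by simp [argCode]
@[simp] theorem leftCode_pair (a b c : ℕ) : leftCode (Nat.pair a (Nat.pair b c)) = b := by
  simp [leftCode]
@[simp] theorem rightCode_pair (a b c : ℕ) : rightCode (Nat.pair a (Nat.pair b c)) = c := by
  simp [rightCode]

variable {α : Type*} [Primcodable α] {f : α → ℕ}

@[fun_prop] theorem Primrec.fun_opCode (hf : Primrec f) : Primrec fun a => opCode (f a) := by
  unfold opCode; fun_prop
@[fun_prop] theorem Primrec.fun_argCode (hf : Primrec f) : Primrec fun a => argCode (f a) := by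
  unfold argCode; fun_prop
@[fun_prop] theorem Primrec.fun_leftCode (hf : Primrec f) : Primrec fun a => leftCode (f a) := by
  unfold leftCode; fun_prop
@[fun_prop] theorem Primrec.fun_rightCode (hf : Primrec f) :
    Primrec fun a => rightCode (f a) := by
  unfold rightCode; fun_prop

end CodeParts

/-- The local condition on the set `X` of (codes of) formulas that are claimed to hold at a
position with atoms `W`, if the formulas in `X'` are claimed to hold at the next position. -/
def PosStep (W X X' : ℕ → Prop) (m : ℕ) : Prop :=
  Impl (X m)
    (Impl (opCode m = 0) (W (argCode m)) ∧
    Impl (opCode m = 1) (¬ W (argCode m)) ∧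
    Impl (opCode m = 2) (X (leftCode m) ∧ X (rightCode m)) ∧
    Impl (opCode m = 3) (X (leftCode m) ∨ X (rightCode m)) ∧
    Impl (opCode m = 4) (X' (argCode m)) ∧
    Impl (opCode m = 5) (X (rightCode m) ∨ (X (leftCode m) ∧ X' m)) ∧
    Impl (opCode m = 6) (X (rightCode m) ∧ (X (leftCode m) ∨ X' m)) ∧
    Impl (opCode m = 7) (X (argCode m) ∨ X' m))

/-- The local condition on the set `Y` of formulas that are claimed to fail, and the set `D` of
prompt formulas whose failure has been claimed before the last marked position; `q` says whether
the next position is marked. -/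
def NegStep (W Y D Y' D' : ℕ → Prop) (q : Prop) (m : ℕ) : Prop :=
  Impl (D m) (Y (argCode m) ∧ (q ∨ D' m)) ∧
  Impl (Y m)
    (Impl (opCode m = 0) (¬ W (argCode m)) ∧
    Impl (opCode m = 1) (W (argCode m)) ∧
    Impl (opCode m = 2) (Y (leftCode m) ∨ Y (rightCode m)) ∧
    Impl (opCode m = 3) (Y (leftCode m) ∧ Y (rightCode m)) ∧
    Impl (opCode m = 4) (Y' (argCode m)) ∧
    Impl (opCode m = 5) (Y (rightCode m) ∧ (Y (leftCode m) ∨ Y' m)) ∧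
    Impl (opCode m = 6) (Y (rightCode m) ∨ (Y (leftCode m) ∧ Y' m)) ∧
    Impl (opCode m = 7) (Y (argCode m) ∧ ((q ∧ D' m) ∨ (¬ q ∧ Y' m))))

/-- The prompt formula `m` is not pending. -/
def PosBounded (X : ℕ → Prop) (m : ℕ) : Prop :=
  Impl (X m) (Impl (opCode m = 7) (X (argCode m)))

/-- The until or prompt formula `m` is not pending. -/
def PosFair (X : ℕ → Prop) (m : ℕ) : Prop :=
  PosBounded X m ∧ Impl (X m) (Impl (opCode m = 5) (X (rightCode m)))

/-- The failure of the release formula `m` is not pending. -/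
def NegFair (Y : ℕ → Prop) (m : ℕ) : Prop :=
  Impl (Y m) (Impl (opCode m = 6) (Y (rightCode m)))

theorem release_iff {w : Word} {k : ℕ} {φ ψ : PromptLTL} {i : ℕ} :
    (PromptLTL.release φ ψ).HoldsAt w k i ↔
      ψ.HoldsAt w k i ∧ (φ.HoldsAt w k i ∨ (PromptLTL.release φ ψ).HoldsAt w k (i + 1)) := by
  simp only [PromptLTL.HoldsAt]
  constructor
  · intro h
    refine ⟨(h i le_rfl).resolve_right (by rintro ⟨m, h1, h2, -⟩; omega), ?_⟩
    by_cases hφ : φ.HoldsAt w k i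
    · exact .inl hφ
    · refine .inr fun j hj => (h j (by omega)).imp_right ?_
      rintro ⟨m, h1, h2, h3⟩
      refine ⟨m, ?_, h2, h3⟩
      rcases h1.lt_or_eq with h1 | rfl
      · exact h1
      · exact absurd h3 hφ
  · rintro ⟨h1, h2⟩ j hj
    rcases hj.lt_or_eq with hj | rfl
    · rcases h2 with h2 | h2
      · exact .inr ⟨i, le_rfl, hj, h2⟩
      · refine (h2 j hj).imp_right ?_
        rintro ⟨m, h1, h2, h3⟩
        exact ⟨m, by omega, h2, h3⟩
    · exact .inl h1

theorem untl_iff {w : Word} {k : ℕ} {φ ψ : PromptLTL} {i : ℕ} :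
    (PromptLTL.untl φ ψ).HoldsAt w k i ↔
      ψ.HoldsAt w k i ∨ (φ.HoldsAt w k i ∧ (PromptLTL.untl φ ψ).HoldsAt w k (i + 1)) := by
  simp only [PromptLTL.HoldsAt]
  constructor
  · rintro ⟨j, hj, h1, h2⟩
    rcases hj.lt_or_eq with hj | rfl
    · exact .inr ⟨h2 i le_rfl hj, j, hj, h1, fun m h3 h4 => h2 m (by omega) h4⟩
    · exact .inl h1
  · rintro (h | ⟨h, j, hj, h1, h2⟩)
    · exact ⟨i, le_rfl, h, fun m h1 h2 => by omega⟩
    · refine ⟨j, by omega, h1, fun m h3 h4 => ?_⟩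
      rcases h3.lt_or_eq with h3 | rfl
      · exact h2 m h3 h4
      · exact h

section Tableau

variable {w : Word} {W : ℕ → ℕ → Prop} {B : ℕ}

/-- Soundness of the positive tableau. A false until formula, once claimed, would be claimed and
undischarged forever, against fairness; a false prompt formula would be so for `K` steps, against
the recurrence bound. Release needs neither condition. -/
theorem holdsAt_of_posStep {X : ℕ → ℕ → Prop} {K : ℕ} (hW : ∀ i (a : Atom), W i a.code ↔ a ∈ w i)
    (hstep : ∀ i, ∀ m < B, PosStep (W i) (X i) (X (i + 1)) m)
    (hfair : ∀ m < B, ∀ n, ∃ i, n ≤ i ∧ PosFair (X i) m)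
    (hbound : ∀ m < B, ∀ n, ∃ i, n ≤ i ∧ i ≤ n + K ∧ PosBounded (X i) m)
    (φ : PromptLTL) (hφ : φ.code < B) (i : ℕ) (h : X i φ.code) : φ.HoldsAt w K i := by
  have hs := fun i h => hstep i _ hφ h
  induction φ generalizing i with
  | atom a =>
    have := (hs i h).1
    simpa [Impl, PromptLTL.code, hW, PromptLTL.HoldsAt] using this
  | natom a =>
    have := (hs i h).2.1
    simpa [Impl, PromptLTL.code, hW, PromptLTL.HoldsAt] using this
  | and φ ψ ihφ ihψ =>
    have h1 := (hs i h).2.2.1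
    simp only [Impl, PromptLTL.code, opCode_pair, leftCode_pair, rightCode_pair,
      forall_const] at h1
    have h2 : φ.code < B := ((Nat.left_le_pair _ _).trans (Nat.right_le_pair _ _)).trans_lt hφ
    have h3 : ψ.code < B := ((Nat.right_le_pair _ _).trans (Nat.right_le_pair _ _)).trans_lt hφ
    exact ⟨ihφ h2 i h1.1 fun i => hstep i _ h2, ihψ h3 i h1.2 fun i => hstep i _ h3⟩
  | or φ ψ ihφ ihψ =>
    have h1 := (hs i h).2.2.2.1
    simp only [Impl, PromptLTL.code, opCode_pair, leftCode_pair, rightCode_pair,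
      forall_const] at h1
    have h2 : φ.code < B := ((Nat.left_le_pair _ _).trans (Nat.right_le_pair _ _)).trans_lt hφ
    have h3 : ψ.code < B := ((Nat.right_le_pair _ _).trans (Nat.right_le_pair _ _)).trans_lt hφ
    exact h1.imp (fun h1 => ihφ h2 i h1 fun i => hstep i _ h2)
      fun h1 => ihψ h3 i h1 fun i => hstep i _ h3
  | next φ ih =>
    have h1 := (hs i h).2.2.2.2.1
    simp only [Impl, PromptLTL.code, opCode_pair, argCode_pair, forall_const] at h1
    have h2 : φ.code < B := (Nat.right_le_pair _ _).trans_lt hφ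
    exact ih h2 (i + 1) h1 fun i => hstep i _ h2
  | untl φ ψ ihφ ihψ =>
    have h1 := fun i h => (hs i h).2.2.2.2.2.1
    obtain ⟨j, hij, hj⟩ := hfair _ hφ i
    have hj := hj.2
    simp only [Impl, PromptLTL.code, opCode_pair, leftCode_pair, rightCode_pair,
      forall_const] at h1 hj h
    have h2 : φ.code < B := ((Nat.left_le_pair _ _).trans (Nat.right_le_pair _ _)).trans_lt hφ
    have h3 : ψ.code < B := ((Nat.right_le_pair _ _).trans (Nat.right_le_pair _ _)).trans_lt hφ
    have ihψ := fun i h => ihψ h3 i h fun i => hstep i _ h3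
    have ihφ := fun i h => ihφ h2 i h fun i => hstep i _ h2
    by_contra hno
    have key : ∀ k, i ≤ k → X k (Nat.pair 5 (Nat.pair φ.code ψ.code)) ∧
        ¬ (PromptLTL.untl φ ψ).HoldsAt w K k := by
      intro k hk
      induction k, hk using Nat.le_induction with
      | base => exact ⟨h, hno⟩
      | succ k hk ih =>
        obtain ⟨h4, h5⟩ := ih
        rcases h1 k h4 with h6 | ⟨h6, h7⟩
        · exact absurd (untl_iff.2 (.inl (ihψ k h6))) h5
        · exact ⟨h7, fun h8 => h5 (untl_iff.2 (.inr ⟨ihφ k h6, h8⟩))⟩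
    obtain ⟨h4, h5⟩ := key j hij
    exact h5 (untl_iff.2 (.inl (ihψ _ (hj h4))))
  | release φ ψ ihφ ihψ =>
    have h1 := fun i h => (hs i h).2.2.2.2.2.2.1
    simp only [Impl, PromptLTL.code, opCode_pair, leftCode_pair, rightCode_pair,
      forall_const] at h1 h
    have h2 : φ.code < B := ((Nat.left_le_pair _ _).trans (Nat.right_le_pair _ _)).trans_lt hφ
    have h3 : ψ.code < B := ((Nat.right_le_pair _ _).trans (Nat.right_le_pair _ _)).trans_lt hφ
    have ihψ := fun i h => ihψ h3 i h fun i => hstep i _ h3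
    have ihφ := fun i h => ihφ h2 i h fun i => hstep i _ h2
    intro j hij
    by_contra! hno
    have key : X j (Nat.pair 6 (Nat.pair φ.code ψ.code)) := by
      have : ∀ k, i ≤ k → k ≤ j → X k (Nat.pair 6 (Nat.pair φ.code ψ.code)) := by
        intro k hk
        induction k, hk using Nat.le_induction with
        | base => intro _; exact h
        | succ k hk ih =>
          intro hkj
          exact (h1 k (ih (by omega))).2.resolve_left fun h4 =>
            hno.2 k hk (by omega) (ihφ k h4)
      exact this j hij le_rfl
    exact hno.1 (ihψ j (h1 j key).1)
  | promptF φ ih =>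
    have h1 := fun i h => (hs i h).2.2.2.2.2.2.2
    obtain ⟨j, hij, hjK, hj⟩ := hbound _ hφ i
    simp only [Impl, PosBounded, PromptLTL.code, opCode_pair, argCode_pair,
      forall_const] at h1 hj h
    have h2 : φ.code < B := (Nat.right_le_pair _ _).trans_lt hφ
    have ih := fun i h => ih h2 i h fun i => hstep i _ h2
    by_contra hno
    simp only [PromptLTL.HoldsAt, not_exists, not_and] at hno
    -- If the argument fails throughout, the claim is handed on up to `j`, where `PosBounded` forces
    -- the argument to be claimed.
    have key : ∀ k, i ≤ k → k ≤ j → X k (Nat.pair 7 φ.code) := by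
      intro k hk
      induction k, hk using Nat.le_induction with
      | base => intro _; exact h
      | succ k hk ihk =>
        intro hkj
        exact (h1 k (ihk (by omega))).resolve_left fun h4 =>
          hno k hk (by omega) (ih k h4)
    exact hno j hij hjK (ih j (hj (key j hij le_rfl)))

/-- The codes of the formulas that hold at a position. -/
def trueCodes (w : Word) (k i m : ℕ) : Prop := ∃ χ : PromptLTL, χ.code = m ∧ χ.HoldsAt w k i

theorem trueCodes_posStep (hW : ∀ i (a : Atom), W i a.code ↔ a ∈ w i) (k i m : ℕ) :
    PosStep (W i) (trueCodes w k i) (trueCodes w k (i + 1)) m := by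
  rintro ⟨χ, rfl, h⟩
  cases χ with
  | atom a => simpa [Impl, PromptLTL.code, hW, PromptLTL.HoldsAt] using h
  | natom a => simpa [Impl, PromptLTL.code, hW, PromptLTL.HoldsAt] using h
  | and φ ψ =>
    simp only [Impl, PromptLTL.code, opCode_pair, leftCode_pair, rightCode_pair]
    simp only [Nat.reduceEqDiff, false_implies, true_and, and_true, forall_const]
    exact ⟨⟨φ, rfl, h.1⟩, ⟨ψ, rfl, h.2⟩⟩
  | or φ ψ =>
    simp only [Impl, PromptLTL.code, opCode_pair, leftCode_pair, rightCode_pair]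
    simp only [Nat.reduceEqDiff, false_implies, true_and, and_true, forall_const]
    exact h.imp (fun h => ⟨φ, rfl, h⟩) fun h => ⟨ψ, rfl, h⟩
  | next φ =>
    simp only [Impl, PromptLTL.code, opCode_pair, argCode_pair]
    simp only [Nat.reduceEqDiff, false_implies, true_and, and_true, forall_const]
    exact ⟨φ, rfl, h⟩
  | untl φ ψ =>
    simp only [Impl, PromptLTL.code, opCode_pair, leftCode_pair, rightCode_pair]
    simp only [Nat.reduceEqDiff, false_implies, true_and, and_true, forall_const]
    exact (untl_iff.1 h).imp (fun h => ⟨ψ, rfl, h⟩) fun h => ⟨⟨φ, rfl, h.1⟩, ⟨_, rfl, h.2⟩⟩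
  | release φ ψ =>
    simp only [Impl, PromptLTL.code, opCode_pair, leftCode_pair, rightCode_pair]
    simp only [Nat.reduceEqDiff, false_implies, true_and, and_true, forall_const]
    have h := release_iff.1 h
    exact ⟨⟨ψ, rfl, h.1⟩, h.2.imp (fun h => ⟨φ, rfl, h⟩) fun h => ⟨_, rfl, h⟩⟩
  | promptF φ =>
    simp only [Impl, PromptLTL.code, opCode_pair, argCode_pair]
    simp only [Nat.reduceEqDiff, false_implies, true_and, forall_const]
    by_cases h0 : φ.HoldsAt w k i
    · exact .inl ⟨φ, rfl, h0⟩
    · obtain ⟨j, h1, h2, h3⟩ := h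
      -- The bound need not shrink: a later witness within `k` of `i` is within `k` of `i + 1`.
      refine .inr ⟨.promptF φ, rfl, j, ?_, by omega, h3⟩
      rcases h1.lt_or_eq with h1 | rfl
      · exact h1
      · exact absurd h3 h0

theorem trueCodes_posBounded (k m n : ℕ) :
    ∃ i, n ≤ i ∧ i ≤ n + k ∧ PosBounded (trueCodes w k i) m := by
  by_cases h : trueCodes w k n m
  · obtain ⟨χ, rfl, h⟩ := h
    by_cases h7 : opCode χ.code = 7
    · cases χ with
      | promptF φ =>
        obtain ⟨j, h1, h2, h3⟩ := h
        refine ⟨j, h1, h2, fun _ _ => ?_⟩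
        simp only [PromptLTL.code, argCode_pair]
        exact ⟨φ, rfl, h3⟩
      | _ => simp [PromptLTL.code] at h7
    · exact ⟨n, le_rfl, by omega, fun _ h8 => absurd h8 h7⟩
  · exact ⟨n, le_rfl, by omega, fun h1 => absurd h1 h⟩

theorem trueCodes_posFair (k m n : ℕ) : ∃ i, n ≤ i ∧ PosFair (trueCodes w k i) m := by
  by_cases h5 : opCode m = 5
  · by_cases h : trueCodes w k n m
    · obtain ⟨χ, rfl, h⟩ := h
      cases χ with
      | untl φ ψ =>
        obtain ⟨j, h1, h2, -⟩ := h
        refine ⟨j, h1, fun _ h7 => ?_, fun _ _ => ?_⟩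
        · simp [PromptLTL.code] at h7
        · simp only [PromptLTL.code, rightCode_pair]
          exact ⟨ψ, rfl, h2⟩
      | _ => simp [PromptLTL.code] at h5
    · exact ⟨n, le_rfl, fun h1 => absurd h1 h, fun h1 => absurd h1 h⟩
  · obtain ⟨i, h1, -, h2⟩ := trueCodes_posBounded (w := w) k m n
    exact ⟨i, h1, h2, fun _ h => absurd h h5⟩

/-- Soundness of the negative tableau, dual to the positive one. A prompt failure stays in `Y` up to
the first mark and then in `D` up to the second; the argument fails all along, and the two marks
alone are `L` apart. -/
theorem not_holdsAt_of_negStep {Y D : ℕ → ℕ → Prop} {Q : ℕ → Prop} {L : ℕ}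
    (hW : ∀ i (a : Atom), W i a.code ↔ a ∈ w i)
    (hstep : ∀ i, ∀ m < B, NegStep (W i) (Y i) (D i) (Y (i + 1)) (D (i + 1)) (Q (i + 1)) m)
    (hfair : ∀ m < B, ∀ n, ∃ i, n ≤ i ∧ NegFair (Y i) m)
    (hgap : ∀ i j, i < j → Q i → Q j → i + L ≤ j)
    (φ : PromptLTL) (hφ : φ.code < B) (i : ℕ) (h : Y i φ.code) : ¬ φ.HoldsAt w L i := by
  have hs := fun i h => (hstep i _ hφ).2 h
  have hd := fun i h => (hstep i _ hφ).1 h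
  induction φ generalizing i with
  | atom a =>
    have := (hs i h).1
    simpa [Impl, PromptLTL.code, hW, PromptLTL.HoldsAt] using this
  | natom a =>
    have := (hs i h).2.1
    simpa [Impl, PromptLTL.code, hW, PromptLTL.HoldsAt] using this
  | and φ ψ ihφ ihψ =>
    have h1 := (hs i h).2.2.1
    simp only [Impl, PromptLTL.code, opCode_pair, leftCode_pair, rightCode_pair,
      forall_const] at h1
    have h2 : φ.code < B := ((Nat.left_le_pair _ _).trans (Nat.right_le_pair _ _)).trans_lt hφ
    have h3 : ψ.code < B := ((Nat.right_le_pair _ _).trans (Nat.right_le_pair _ _)).trans_lt hφ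
    rintro ⟨h4, h5⟩
    rcases h1 with h1 | h1
    · exact ihφ h2 i h1 (fun i => (hstep i _ h2).2) (fun i => (hstep i _ h2).1) h4
    · exact ihψ h3 i h1 (fun i => (hstep i _ h3).2) (fun i => (hstep i _ h3).1) h5
  | or φ ψ ihφ ihψ =>
    have h1 := (hs i h).2.2.2.1
    simp only [Impl, PromptLTL.code, opCode_pair, leftCode_pair, rightCode_pair,
      forall_const] at h1
    have h2 : φ.code < B := ((Nat.left_le_pair _ _).trans (Nat.right_le_pair _ _)).trans_lt hφ
    have h3 : ψ.code < B := ((Nat.right_le_pair _ _).trans (Nat.right_le_pair _ _)).trans_lt hφ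
    rintro (h4 | h4)
    · exact ihφ h2 i h1.1 (fun i => (hstep i _ h2).2) (fun i => (hstep i _ h2).1) h4
    · exact ihψ h3 i h1.2 (fun i => (hstep i _ h3).2) (fun i => (hstep i _ h3).1) h4
  | next φ ih =>
    have h1 := (hs i h).2.2.2.2.1
    simp only [Impl, PromptLTL.code, opCode_pair, argCode_pair, forall_const] at h1
    have h2 : φ.code < B := (Nat.right_le_pair _ _).trans_lt hφ
    exact ih h2 (i + 1) h1 (fun i => (hstep i _ h2).2) (fun i => (hstep i _ h2).1)
  | untl φ ψ ihφ ihψ =>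
    have h1 := fun i h => (hs i h).2.2.2.2.2.1
    simp only [Impl, PromptLTL.code, opCode_pair, leftCode_pair, rightCode_pair,
      forall_const] at h1 h
    have h2 : φ.code < B := ((Nat.left_le_pair _ _).trans (Nat.right_le_pair _ _)).trans_lt hφ
    have h3 : ψ.code < B := ((Nat.right_le_pair _ _).trans (Nat.right_le_pair _ _)).trans_lt hφ
    have ihψ := fun i h => ihψ h3 i h (fun i => (hstep i _ h3).2) (fun i => (hstep i _ h3).1)
    have ihφ := fun i h => ihφ h2 i h (fun i => (hstep i _ h2).2) (fun i => (hstep i _ h2).1)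
    rintro ⟨j, hij, h4, h5⟩
    have key : ∀ k, i ≤ k → k ≤ j → Y k (Nat.pair 5 (Nat.pair φ.code ψ.code)) := by
      intro k hk
      induction k, hk using Nat.le_induction with
      | base => intro _; exact h
      | succ k hk ih =>
        intro hkj
        exact (h1 k (ih (by omega))).2.resolve_left fun h6 =>
          ihφ k h6 (h5 k hk (by omega))
    exact ihψ j (h1 j (key j hij le_rfl)).1 h4
  | release φ ψ ihφ ihψ =>
    have h1 := fun i h => (hs i h).2.2.2.2.2.2.1
    obtain ⟨j, hij, hj⟩ := hfair _ hφ i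
    simp only [Impl, NegFair, PromptLTL.code, opCode_pair, leftCode_pair, rightCode_pair,
      forall_const] at h1 h hj
    have h2 : φ.code < B := ((Nat.left_le_pair _ _).trans (Nat.right_le_pair _ _)).trans_lt hφ
    have h3 : ψ.code < B := ((Nat.right_le_pair _ _).trans (Nat.right_le_pair _ _)).trans_lt hφ
    have ihψ := fun i h => ihψ h3 i h (fun i => (hstep i _ h3).2) (fun i => (hstep i _ h3).1)
    have ihφ := fun i h => ihφ h2 i h (fun i => (hstep i _ h2).2) (fun i => (hstep i _ h2).1)
    intro hno
    have key : ∀ k, i ≤ k → Y k (Nat.pair 6 (Nat.pair φ.code ψ.code)) ∧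
        (PromptLTL.release φ ψ).HoldsAt w L k := by
      intro k hk
      induction k, hk using Nat.le_induction with
      | base => exact ⟨h, hno⟩
      | succ k hk ih =>
        obtain ⟨h4, h5⟩ := ih
        have h5 := release_iff.1 h5
        rcases h1 k h4 with h6 | ⟨h6, h7⟩
        · exact absurd h5.1 (ihψ k h6)
        · exact ⟨h7, h5.2.resolve_left (ihφ k h6)⟩
    obtain ⟨h4, h5⟩ := key j hij
    exact ihψ _ (hj h4) (release_iff.1 h5).1
  | promptF φ ih =>
    have h1 := fun i h => (hs i h).2.2.2.2.2.2.2
    simp only [Impl, PromptLTL.code, opCode_pair, argCode_pair, forall_const] at h1 h hd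
    have h2 : φ.code < B := (Nat.right_le_pair _ _).trans_lt hφ
    have ih := fun i h => ih h2 i h (fun i => (hstep i _ h2).2) (fun i => (hstep i _ h2).1)
    rintro ⟨j, hij, hjL, h3⟩
    -- The three cases: no mark since `i`, exactly one phase of `D` entered at a mark `q`, or the
    -- window of length `L` already left.
    have key : ∀ k, i ≤ k →
        (Y k (Nat.pair 7 φ.code)) ∨
        (D k (Nat.pair 7 φ.code) ∧ ∃ q, i < q ∧ q ≤ k ∧ Q q) ∨ i + L < k := by
      intro k hk
      induction k, hk using Nat.le_induction with
      | base => exact .inl h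
      | succ k hk ih =>
        rcases ih with h4 | ⟨h4, q, h5, h6, h7⟩ | h4
        · rcases (h1 k h4).2 with h5 | h5
          · exact .inr (.inl ⟨h5.2, k + 1, by omega, le_rfl, h5.1⟩)
          · exact .inl h5.2
        · rcases (hd k h4).2 with h8 | h8
          · have := hgap q (k + 1) (by omega) h7 h8
            exact .inr (.inr (by omega))
          · exact .inr (.inl ⟨h8, q, h5, by omega, h7⟩)
        · exact .inr (.inr (by omega))
    rcases key j hij with h4 | h4 | h4
    · exact ih j (h1 j h4).1 h3
    · exact ih j (hd j h4.1).1 h3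
    · omega

/-- The codes of the formulas that fail at a position, and of the prompt formulas whose argument
fails up to the second multiple of `L` after the position. -/
def falseCodes (w : Word) (l L i m : ℕ) : Prop :=
  ∃ χ : PromptLTL, χ.code = m ∧ (¬ χ.HoldsAt w l i ∨
    ∃ φ, χ = .promptF φ ∧ ∀ j, i ≤ j → j < (i / L + 2) * L → ¬ φ.HoldsAt w l j)

/-- The codes of the prompt formulas whose argument fails up to the next multiple of `L`. -/
def pendingCodes (w : Word) (l L i m : ℕ) : Prop :=
  ∃ φ : PromptLTL, (PromptLTL.promptF φ).code = m ∧
    ∀ j, i ≤ j → j < (i / L + 1) * L → ¬ φ.HoldsAt w l j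

/-- The second multiple of `L` after `i` is at most `i + 2 * L`, so failure with bound `l` reaches
that far. The fixed endpoint is what can be handed to the next position, where failure with the full
bound `l` may be lost. -/
theorem falseCodes_promptF {l L i : ℕ} (hl : 2 * L ≤ l) {m : ℕ}
    (h : falseCodes w l L i m) (h7 : opCode m = 7) :
    ∃ φ : PromptLTL, (PromptLTL.promptF φ).code = m ∧
      ∀ j, i ≤ j → j < (i / L + 2) * L → ¬ φ.HoldsAt w l j := by
  obtain ⟨χ, rfl, h⟩ := h
  rcases h with h | ⟨φ, rfl, h⟩
  · cases χ with
    | promptF φ =>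
      simp only [PromptLTL.HoldsAt, not_exists, not_and] at h
      refine ⟨φ, rfl, fun j h1 h2 => h j h1 ?_⟩
      have := Nat.div_mul_le_self i L
      rw [Nat.add_mul] at h2
      omega
    | _ => simp [PromptLTL.code] at h7
  · exact ⟨φ, rfl, h⟩

/-- With marks at the positive multiples of `L`, the quotient `i / L` grows exactly on entering a
mark. There "up to the second multiple" turns into "up to the next multiple", which is the passage
from `Y` to `D`. -/
theorem falseCodes_negStep (hW : ∀ i (a : Atom), W i a.code ↔ a ∈ w i) {l L : ℕ} (hL : 0 < L)
    (hl : 2 * L ≤ l) (i m : ℕ) :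
    NegStep (W i) (falseCodes w l L i) (pendingCodes w l L i) (falseCodes w l L (i + 1))
      (pendingCodes w l L (i + 1)) (0 < i + 1 ∧ L ∣ i + 1) m := by
  have hi : i < (i / L + 1) * L := by
    have := Nat.lt_div_mul_add hL (a := i)
    rw [Nat.add_mul]; omega
  refine ⟨?_, fun h => ?_⟩
  · rintro ⟨φ, rfl, h⟩
    simp only [PromptLTL.code, argCode_pair]
    refine ⟨⟨φ, rfl, .inl (h i le_rfl hi)⟩, ?_⟩
    by_cases hq : L ∣ i + 1
    · exact .inl ⟨by omega, hq⟩
    · refine .inr ⟨φ, rfl, fun j h1 h2 => h j (by omega) ?_⟩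
      rwa [Nat.succ_div, if_neg hq] at h2
  · have h7 : opCode m = 7 → falseCodes w l L i (argCode m) ∧
        (((0 < i + 1 ∧ L ∣ i + 1) ∧ pendingCodes w l L (i + 1) m) ∨
          (¬ (0 < i + 1 ∧ L ∣ i + 1) ∧ falseCodes w l L (i + 1) m)) := by
      intro h7
      obtain ⟨φ, rfl, h'⟩ := falseCodes_promptF hl h h7
      simp only [PromptLTL.code, argCode_pair]
      have hi2 : (i / L + 1) * L ≤ (i / L + 2) * L := Nat.mul_le_mul_right _ (by omega)
      refine ⟨⟨φ, rfl, .inl (h' i le_rfl (by omega))⟩, ?_⟩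
      by_cases hq : L ∣ i + 1
      · refine .inl ⟨⟨by omega, hq⟩, φ, rfl, fun j h1 h2 => h' j (by omega) ?_⟩
        rwa [Nat.succ_div, if_pos hq] at h2
      · refine .inr ⟨fun h => hq h.2, _, rfl, .inr ⟨φ, rfl, fun j h1 h2 => h' j (by omega) ?_⟩⟩
        rwa [Nat.succ_div, if_neg hq] at h2
    obtain ⟨χ, rfl, h⟩ := h
    cases χ with
    | promptF φ =>
      simp only [Impl]
      refine ⟨?_, ?_, ?_, ?_, ?_, ?_, ?_, h7⟩ <;> intro h <;> simp [PromptLTL.code] at h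
    | atom a =>
      have h := h.resolve_right (by simp)
      simpa [Impl, PromptLTL.code, hW, PromptLTL.HoldsAt] using h
    | natom a =>
      have h := h.resolve_right (by simp)
      simpa [Impl, PromptLTL.code, hW, PromptLTL.HoldsAt] using h
    | and φ ψ =>
      have h := h.resolve_right (by simp)
      simp only [Impl, PromptLTL.code, opCode_pair, leftCode_pair, rightCode_pair]
      simp only [Nat.reduceEqDiff, false_implies, true_and, and_true, forall_const]
      exact (not_and_or.1 h).imp (fun h => ⟨φ, rfl, .inl h⟩) fun h => ⟨ψ, rfl, .inl h⟩
    | or φ ψ =>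
      have h := h.resolve_right (by simp)
      simp only [Impl, PromptLTL.code, opCode_pair, leftCode_pair, rightCode_pair]
      simp only [Nat.reduceEqDiff, false_implies, true_and, and_true, forall_const]
      exact ⟨⟨φ, rfl, .inl fun h' => h (.inl h')⟩, ⟨ψ, rfl, .inl fun h' => h (.inr h')⟩⟩
    | next φ =>
      have h := h.resolve_right (by simp)
      simp only [Impl, PromptLTL.code, opCode_pair, argCode_pair]
      simp only [Nat.reduceEqDiff, false_implies, true_and, and_true, forall_const]
      exact ⟨φ, rfl, .inl h⟩
    | untl φ ψ =>
      have h := h.resolve_right (by simp)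
      simp only [Impl, PromptLTL.code, opCode_pair, leftCode_pair, rightCode_pair]
      simp only [Nat.reduceEqDiff, false_implies, true_and, and_true, forall_const]
      rw [untl_iff, not_or, not_and_or] at h
      exact ⟨⟨ψ, rfl, .inl h.1⟩, h.2.imp (fun h => ⟨φ, rfl, .inl h⟩) fun h => ⟨_, rfl, .inl h⟩⟩
    | release φ ψ =>
      have h := h.resolve_right (by simp)
      simp only [Impl, PromptLTL.code, opCode_pair, leftCode_pair, rightCode_pair]
      simp only [Nat.reduceEqDiff, false_implies, true_and, and_true, forall_const]
      rw [release_iff, not_and_or, not_or] at h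
      exact h.imp (fun h => ⟨ψ, rfl, .inl h⟩) fun h => ⟨⟨φ, rfl, .inl h.1⟩, ⟨_, rfl, .inl h.2⟩⟩

theorem falseCodes_negFair (l L m n : ℕ) : ∃ i, n ≤ i ∧ NegFair (falseCodes w l L i) m := by
  by_cases h6 : opCode m = 6
  · by_cases h : falseCodes w l L n m
    · obtain ⟨χ, rfl, h⟩ := h
      cases χ with
      | release φ ψ =>
        have h := h.resolve_right (by simp)
        simp only [PromptLTL.HoldsAt, not_forall, not_or] at h
        obtain ⟨j, h1, h2, -⟩ := h
        refine ⟨j, h1, fun _ _ => ?_⟩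
        simp only [PromptLTL.code, rightCode_pair]
        exact ⟨ψ, rfl, .inl h2⟩
      | _ => simp [PromptLTL.code] at h6
    · exact ⟨n, le_rfl, fun h1 => absurd h1 h⟩
  · exact ⟨n, le_rfl, fun _ h => absurd h h6⟩

end Tableau

/-! ### Instances and families as numbers -/

namespace Instance

def assumption (x : ℕ) : ℕ := x.unpair.1.unpair.1
def guarantee (x : ℕ) : ℕ := x.unpair.1.unpair.2
def envOut (x : ℕ) : ℕ := x.unpair.2.unpair.1.unpair.1.unpair.2
def procs (x : ℕ) : ℕ := natListLen x.unpair.2.unpair.1.unpair.2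
def inp (x p : ℕ) : ℕ := (natListGet x.unpair.2.unpair.1.unpair.2 p).unpair.1
def out (x p : ℕ) : ℕ := (natListGet x.unpair.2.unpair.1.unpair.2 p).unpair.2
def size (x p : ℕ) : ℕ := natListGet x.unpair.2.unpair.2 p

/-- A bound for the codes of atoms and formulas. -/
def codeBound (x : ℕ) : ℕ := 2 * x + 2

/-- A bound for the codes of valuations. -/
def valBound (x : ℕ) : ℕ := 2 ^ codeBound x

/-- `j` is the code of an input of process `p`. -/
def IsInp (x p j : ℕ) : Prop := (j % 2 = 0 ∧ Bit (inp x p) (j / 2)) ∨ j = 2 * p + 1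

/-- `j` is the code of an output of the environment. -/
def IsEnvOut (x j : ℕ) : Prop :=
  (j % 2 = 0 ∧ Bit (envOut x) (j / 2)) ∨ (j % 2 = 1 ∧ j / 2 < procs x)

/-- `j` is the code of an output of a system process. -/
def IsSysOut (x j : ℕ) : Prop := j % 2 = 0 ∧ BEx (procs x) fun p => Bit (out x p) (j / 2)

/-- `u` is the code of an input valuation of process `p`. -/
def IsVal (x p u : ℕ) : Prop := BAll (codeBound x) fun j => Impl (Bit u j) (IsInp x p j)

/-! The complete diagram of a family of transition systems is coded as a set `t` of numbers. -/

def initIdx (p s : ℕ) : ℕ := Nat.pair 0 (Nat.pair p s)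
def stepIdx (p s u s' : ℕ) : ℕ := Nat.pair 1 (Nat.pair p (Nat.pair s (Nat.pair u s')))
def labelIdx (o s : ℕ) : ℕ := Nat.pair 2 (Nat.pair o s)

/-- The set `t` describes a family of transition systems. -/
def IsFamily (x t : ℕ) : Prop :=
  BAll (procs x) fun p =>
    (BEx (size x p) fun s => BAll (size x p) fun s' => (Bit t (initIdx p s') ↔ s' = s)) ∧
    BAll (size x p) fun s => BAll (valBound x) fun u => Impl (IsVal x p u)
      (BEx (size x p) fun s' => BAll (size x p) fun s'' => (Bit t (stepIdx p s u s'') ↔ s'' = s'))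

/-- The states of the processes that are not scheduled do not change. -/
def IsFrozen (x t : ℕ) : Prop :=
  BAll (procs x) fun p => BEx (2 ^ size x p) fun R =>
    (BAll (size x p) fun s => Impl (Bit t (initIdx p s)) (Bit R s)) ∧
    BAll (size x p) fun s => BAll (valBound x) fun u => BAll (size x p) fun s' =>
      Impl (Bit R s ∧ IsVal x p u ∧ Bit t (stepIdx p s u s'))
        (Bit R s' ∧ (Bit u (2 * p + 1) ∨ s' = s))

/-! ### The tableau graph

Its vertices are coded as sets. -/

def vertexBound (x : ℕ) : ℕ := 2 ^ Nat.pair 6 (Nat.pair (codeBound x) (codeBound x))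

/-- The atom with code `j` holds at the vertex `v`. -/
def Letter (x v j : ℕ) : Prop := j < codeBound x ∧ Bit v (Nat.pair 0 j)
/-- Process `p` is in state `s` at the vertex `v`. -/
def InState (v p s : ℕ) : Prop := Bit v (Nat.pair 1 (Nat.pair p s))
/-- The formula with code `m` is claimed to hold. -/
def Pos (v m : ℕ) : Prop := Bit v (Nat.pair 2 m)
/-- The formula with code `m` is claimed to fail. -/
def Neg (v m : ℕ) : Prop := Bit v (Nat.pair 3 m)
/-- The prompt formula with code `m` has been claimed to fail before the last marked vertex. -/
def Pending (v m : ℕ) : Prop := Bit v (Nat.pair 4 m)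
def Marked (v : ℕ) : Prop := Bit v (Nat.pair 5 0)

/-- The output with code `j` belongs to the label of the current states. -/
def InLabel (x t v j : ℕ) : Prop :=
  BEx (procs x) fun p => Bit (out x p) (j / 2) ∧
    BEx (size x p) fun s => InState v p s ∧ Bit t (labelIdx (j / 2) s)

/-- `v` carries a letter that is consistent with its states. -/
def LetterOK (x t v : ℕ) : Prop :=
  BAll (codeBound x) fun j => Impl (Letter x v j) (IsEnvOut x j ∨ IsSysOut x j) ∧
    Impl (IsSysOut x j) (Letter x v j ↔ InLabel x t v j)

/-- The states at `v'` are the successors of those at `v`. -/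
def StateStep (x t v v' : ℕ) : Prop :=
  BAll (procs x) fun p => BAll (size x p) fun s => Impl (InState v p s)
    (BAll (valBound x) fun u =>
      Impl (BAll (codeBound x) fun j => (Bit u j ↔ IsInp x p j ∧ Letter x v j))
        (BAll (size x p) fun s' => (InState v' p s' ↔ Bit t (stepIdx p s u s'))))

def TableauStep (x v v' : ℕ) : Prop :=
  BAll (codeBound x) fun m => PosStep (Letter x v) (Pos v) (Pos v') m ∧
    NegStep (Letter x v) (Neg v) (Pending v) (Neg v') (Pending v') (Marked v') m

def Edge (x t v v' : ℕ) : Prop :=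
  (v < vertexBound x ∧ v' < vertexBound x) ∧ LetterOK x t v ∧ StateStep x t v v' ∧
    TableauStep x v v'

def IsInitial (x t v : ℕ) : Prop :=
  (BAll (procs x) fun p => BAll (size x p) fun s => (InState v p s ↔ Bit t (initIdx p s))) ∧
    Pos v (assumption x) ∧ Neg v (guarantee x) ∧ ¬ Marked v

def Bounded (m v : ℕ) : Prop := PosBounded (Pos v) m

def Fair (j v : ℕ) : Prop :=
  (j % 2 = 0 ∧ PosFair (Pos v) (j / 2)) ∨ (j % 2 = 1 ∧ NegFair (Neg v) (j / 2))

/-- The tableau graph for the negation of the assume-guarantee specification. -/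
def graph (x t : ℕ) : PromptGraph where
  N := vertexBound x
  h := codeBound x
  J := 2 * codeBound x
  E := Edge x t
  I := IsInitial x t
  Q := Marked
  H := Bounded
  F := Fair
  lt_of_E h := h.1
  not_Q_of_I h := h.2.2.2
  h_pos := by simp [codeBound]
  H_of_F m hm := ⟨2 * m, by omega, fun v h => by
    rcases h with ⟨-, h⟩ | ⟨h, -⟩
    · rw [Nat.mul_div_cancel_left _ (by norm_num)] at h
      exact h.1
    · omega⟩

/-! Reachability in the counter graph, whose vertices are coded as pairs. -/

def counterBound (x : ℕ) : ℕ := vertexBound x * codeBound x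

/-- The summand `1` is there because the counter may equal `counterBound x`. -/
def nodeBound (x : ℕ) : ℕ := Nat.pair (vertexBound x) (counterBound x + 1)

def NodeStep (x t a b : ℕ) : Prop :=
  Edge x t a.unpair.1 b.unpair.1 ∧
    ((Marked b.unpair.1 ∧ a.unpair.2 = counterBound x ∧ b.unpair.2 = 0) ∨
    (¬ Marked b.unpair.1 ∧ (b.unpair.2 = a.unpair.2 ∨ (a.unpair.2 < counterBound x ∧
      b.unpair.2 = a.unpair.2 + 1 ∧ Bounded (a.unpair.2 % codeBound x) b.unpair.1))))

/-- Membership in every coded set that contains `a` and is closed under steps: reachability as a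
bounded quantifier. -/
def Reach (x t a b : ℕ) : Prop :=
  BAll (2 ^ nodeBound x) fun S => Impl
    (Bit S a ∧ BAll (nodeBound x) fun c => BAll (nodeBound x) fun d =>
      Impl (Bit S c ∧ NodeStep x t c d) (Bit S d)) (Bit S b)

def Accepts (x t : ℕ) : Prop :=
  BEx (vertexBound x) fun v => IsInitial x t v ∧ BEx (nodeBound x) fun a =>
    Reach x t (Nat.pair v (counterBound x)) a ∧
    (BEx (nodeBound x) fun b => NodeStep x t a b ∧ Reach x t b a) ∧
    BAll (2 * codeBound x) fun j => BEx (nodeBound x) fun b =>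
      Fair j b.unpair.1 ∧ Reach x t a b ∧ Reach x t b a

/-- `t` describes implementations whose product satisfies the specification. -/
def IsSolution (x t : ℕ) : Prop := IsFamily x t ∧ IsFrozen x t ∧ ¬ Accepts x t

section Primrec

variable {α : Type*} [Primcodable α] {f g h k l : α → ℕ}

@[fun_prop] theorem fun_assumption (hf : Primrec f) : Primrec fun a => assumption (f a) := by
  unfold assumption; fun_prop
@[fun_prop] theorem fun_guarantee (hf : Primrec f) : Primrec fun a => guarantee (f a) := by
  unfold guarantee; fun_prop
@[fun_prop] theorem fun_envOut (hf : Primrec f) : Primrec fun a => envOut (f a) := by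
  unfold envOut; fun_prop
@[fun_prop] theorem fun_procs (hf : Primrec f) : Primrec fun a => procs (f a) := by
  unfold procs; fun_prop
@[fun_prop] theorem fun_inp (hf : Primrec f) (hg : Primrec g) :
    Primrec fun a => inp (f a) (g a) := by unfold inp; fun_prop
@[fun_prop] theorem fun_out (hf : Primrec f) (hg : Primrec g) :
    Primrec fun a => out (f a) (g a) := by unfold out; fun_prop
@[fun_prop] theorem fun_size (hf : Primrec f) (hg : Primrec g) :
    Primrec fun a => size (f a) (g a) := by unfold size; fun_prop
@[fun_prop] theorem fun_codeBound (hf : Primrec f) : Primrec fun a => codeBound (f a) := by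
  unfold codeBound; fun_prop
@[fun_prop] theorem fun_valBound (hf : Primrec f) : Primrec fun a => valBound (f a) := by
  unfold valBound; fun_prop
@[fun_prop] theorem fun_vertexBound (hf : Primrec f) : Primrec fun a => vertexBound (f a) := by
  unfold vertexBound; fun_prop
@[fun_prop] theorem fun_counterBound (hf : Primrec f) :
    Primrec fun a => counterBound (f a) := by unfold counterBound; fun_prop
@[fun_prop] theorem fun_nodeBound (hf : Primrec f) : Primrec fun a => nodeBound (f a) := by
  unfold nodeBound; fun_prop
@[fun_prop] theorem fun_initIdx (hf : Primrec f) (hg : Primrec g) :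
    Primrec fun a => initIdx (f a) (g a) := by unfold initIdx; fun_prop
@[fun_prop] theorem fun_stepIdx (hf : Primrec f) (hg : Primrec g) (hh : Primrec h)
    (hk : Primrec k) : Primrec fun a => stepIdx (f a) (g a) (h a) (k a) := by
  unfold stepIdx; fun_prop
@[fun_prop] theorem fun_labelIdx (hf : Primrec f) (hg : Primrec g) :
    Primrec fun a => labelIdx (f a) (g a) := by unfold labelIdx; fun_prop
@[fun_prop] theorem fun_isInp (hf : Primrec f) (hg : Primrec g) (hh : Primrec h) :
    PrimrecPred fun a => IsInp (f a) (g a) (h a) := by unfold IsInp; fun_prop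
@[fun_prop] theorem fun_isEnvOut (hf : Primrec f) (hg : Primrec g) :
    PrimrecPred fun a => IsEnvOut (f a) (g a) := by unfold IsEnvOut; fun_prop
@[fun_prop] theorem fun_isSysOut (hf : Primrec f) (hg : Primrec g) :
    PrimrecPred fun a => IsSysOut (f a) (g a) := by unfold IsSysOut; fun_prop
@[fun_prop] theorem fun_isVal (hf : Primrec f) (hg : Primrec g) (hh : Primrec h) :
    PrimrecPred fun a => IsVal (f a) (g a) (h a) := by unfold IsVal; fun_prop
@[fun_prop] theorem fun_isFamily (hf : Primrec f) (hg : Primrec g) :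
    PrimrecPred fun a => IsFamily (f a) (g a) := by unfold IsFamily; fun_prop
@[fun_prop] theorem fun_isFrozen (hf : Primrec f) (hg : Primrec g) :
    PrimrecPred fun a => IsFrozen (f a) (g a) := by unfold IsFrozen; fun_prop
@[fun_prop] theorem fun_letter (hf : Primrec f) (hg : Primrec g) (hh : Primrec h) :
    PrimrecPred fun a => Letter (f a) (g a) (h a) := by unfold Letter; fun_prop
@[fun_prop] theorem fun_inState (hf : Primrec f) (hg : Primrec g) (hh : Primrec h) :
    PrimrecPred fun a => InState (f a) (g a) (h a) := by unfold InState; fun_prop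
@[fun_prop] theorem fun_pos (hf : Primrec f) (hg : Primrec g) :
    PrimrecPred fun a => Pos (f a) (g a) := by unfold Pos; fun_prop
@[fun_prop] theorem fun_neg (hf : Primrec f) (hg : Primrec g) :
    PrimrecPred fun a => Neg (f a) (g a) := by unfold Neg; fun_prop
@[fun_prop] theorem fun_pending (hf : Primrec f) (hg : Primrec g) :
    PrimrecPred fun a => Pending (f a) (g a) := by unfold Pending; fun_prop
@[fun_prop] theorem fun_marked (hf : Primrec f) : PrimrecPred fun a => Marked (f a) := by
  unfold Marked; fun_prop
@[fun_prop] theorem fun_inLabel (hf : Primrec f) (hg : Primrec g) (hh : Primrec h)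
    (hk : Primrec k) : PrimrecPred fun a => InLabel (f a) (g a) (h a) (k a) := by
  unfold InLabel; fun_prop
@[fun_prop] theorem fun_letterOK (hf : Primrec f) (hg : Primrec g) (hh : Primrec h) :
    PrimrecPred fun a => LetterOK (f a) (g a) (h a) := by unfold LetterOK; fun_prop
@[fun_prop] theorem fun_stateStep (hf : Primrec f) (hg : Primrec g) (hh : Primrec h)
    (hk : Primrec k) : PrimrecPred fun a => StateStep (f a) (g a) (h a) (k a) := by
  unfold StateStep; fun_prop
@[fun_prop] theorem fun_tableauStep (hf : Primrec f) (hg : Primrec g) (hh : Primrec h) :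
    PrimrecPred fun a => TableauStep (f a) (g a) (h a) := by
  unfold TableauStep PosStep NegStep; fun_prop
@[fun_prop] theorem fun_edge (hf : Primrec f) (hg : Primrec g) (hh : Primrec h)
    (hk : Primrec k) : PrimrecPred fun a => Edge (f a) (g a) (h a) (k a) := by
  unfold Edge; fun_prop
@[fun_prop] theorem fun_isInitial (hf : Primrec f) (hg : Primrec g) (hh : Primrec h) :
    PrimrecPred fun a => IsInitial (f a) (g a) (h a) := by unfold IsInitial; fun_prop
@[fun_prop] theorem fun_bounded (hf : Primrec f) (hg : Primrec g) :
    PrimrecPred fun a => Bounded (f a) (g a) := by unfold Bounded PosBounded; fun_prop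
@[fun_prop] theorem fun_fair (hf : Primrec f) (hg : Primrec g) :
    PrimrecPred fun a => Fair (f a) (g a) := by
  unfold Fair PosFair NegFair PosBounded; fun_prop
@[fun_prop] theorem fun_nodeStep (hf : Primrec f) (hg : Primrec g) (hh : Primrec h)
    (hk : Primrec k) : PrimrecPred fun a => NodeStep (f a) (g a) (h a) (k a) := by
  unfold NodeStep; fun_prop
@[fun_prop] theorem fun_reach (hf : Primrec f) (hg : Primrec g) (hh : Primrec h)
    (hk : Primrec k) : PrimrecPred fun a => Reach (f a) (g a) (h a) (k a) := by
  unfold Reach; fun_prop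
@[fun_prop] theorem fun_accepts (hf : Primrec f) (hg : Primrec g) :
    PrimrecPred fun a => Accepts (f a) (g a) := by unfold Accepts; fun_prop
@[fun_prop] theorem fun_isSolution (hf : Primrec f) (hg : Primrec g) :
    PrimrecPred fun a => IsSolution (f a) (g a) := by unfold IsSolution; fun_prop

end Primrec

/-! ### Correctness of the reachability test -/

theorem nodeStep_iff {x t a b : ℕ} :
    NodeStep x t a b ↔ (graph x t).CounterStep a.unpair b.unpair := Iff.rfl

theorem NodeStep.counter_le {x t a b : ℕ} (h : NodeStep x t a b)
    (ha : a.unpair.2 ≤ counterBound x) : b.unpair.2 ≤ counterBound x :=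
  (nodeStep_iff.1 h).le_bound ha

theorem pair_lt_pair {a b c d : ℕ} (h1 : a < c) (h2 : b < d) : Nat.pair a b < Nat.pair c d :=
  (Nat.pair_lt_pair_left b h1).trans (Nat.pair_lt_pair_right c h2)

theorem lt_nodeBound {x a : ℕ} (h1 : a.unpair.1 < vertexBound x)
    (h2 : a.unpair.2 ≤ counterBound x) : a < nodeBound x := by
  rw [← Nat.pair_unpair a]
  exact pair_lt_pair h1 (Nat.lt_succ_of_le h2)

/-- For one direction, the coded set of reachable nodes is itself closed; for the other, steps never
leave the range below `nodeBound x`, so closedness applies along the walk. -/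
theorem reach_iff {x t a b : ℕ} (ha1 : a.unpair.1 < vertexBound x)
    (ha2 : a.unpair.2 ≤ counterBound x) :
    Reach x t a b ↔ Relation.ReflTransGen (NodeStep x t) a b := by
  constructor
  · intro h
    obtain ⟨S, hS, hS'⟩ := exists_bitset (nodeBound x)
      fun c => Relation.ReflTransGen (NodeStep x t) a c
    refine ((hS' b).1 (h S hS ⟨(hS' a).2 ⟨lt_nodeBound ha1 ha2, .refl⟩, ?_⟩)).2
    rintro c hc d hd ⟨h1, h2⟩
    exact (hS' d).2 ⟨hd, ((hS' c).1 h1).2.tail h2⟩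
  · rintro h S hS ⟨h1, h2⟩
    have : Bit S b ∧ b.unpair.1 < vertexBound x ∧ b.unpair.2 ≤ counterBound x := by
      induction h with
      | refl => exact ⟨h1, ha1, ha2⟩
      | @tail c d _ hcd ih =>
        obtain ⟨h3, h4, h5⟩ := ih
        have h6 := hcd.1.1.2
        have h7 := hcd.counter_le h5
        exact ⟨h2 c (lt_nodeBound h4 h5) d (lt_nodeBound h6 h7) ⟨h3, hcd⟩, h6, h7⟩
    exact this.1

theorem reflTransGen_nodeStep_iff {x t : ℕ} {a b : ℕ × ℕ} :
    Relation.ReflTransGen (NodeStep x t) (Nat.pair a.1 a.2) (Nat.pair b.1 b.2) ↔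
      Relation.ReflTransGen (graph x t).CounterStep a b := by
  constructor
  · intro h
    have h := h.lift (p := (graph x t).CounterStep) Nat.unpair fun _ _ h => h
    simpa [Function.onFun] using h
  · intro h
    refine h.lift (fun u : ℕ × ℕ => Nat.pair u.1 u.2) fun u v h => ?_
    rw [Function.onFun, nodeStep_iff, Nat.unpair_pair, Nat.unpair_pair]
    exact h

theorem reach_pair_iff {x t : ℕ} {a b : ℕ × ℕ} (ha1 : a.1 < vertexBound x)
    (ha2 : a.2 ≤ counterBound x) :
    Reach x t (Nat.pair a.1 a.2) (Nat.pair b.1 b.2) ↔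
      Relation.ReflTransGen (graph x t).CounterStep a b := by
  rw [reach_iff (by simpa using ha1) (by simpa using ha2), reflTransGen_nodeStep_iff]

theorem reflTransGen_lt {x t : ℕ} {a b : ℕ × ℕ}
    (h : Relation.ReflTransGen (graph x t).CounterStep a b) (ha1 : a.1 < vertexBound x)
    (ha2 : a.2 ≤ counterBound x) : b.1 < vertexBound x ∧ b.2 ≤ counterBound x := by
  induction h with
  | refl => exact ⟨ha1, ha2⟩
  | tail _ h ih => exact ⟨h.1.1.2, h.le_bound ih.2⟩

theorem accepts_iff {x t : ℕ} : Accepts x t ↔ (graph x t).Accepting := by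
  constructor
  · rintro ⟨v, hv, hI, a, -, h1, ⟨b, -, h2, h3⟩, h4⟩
    have h1 := (reach_pair_iff (a := (v, counterBound x)) (b := a.unpair) hv le_rfl).1
      (by simpa using h1)
    obtain ⟨ha1, ha2⟩ := reflTransGen_lt h1 hv le_rfl
    have hb1 := h2.1.1.2
    have hb2 := h2.counter_le ha2
    refine ⟨v, a.unpair, hI, h1, ?_, fun j hj => ?_⟩
    · refine .head' h2 ((reach_pair_iff hb1 hb2).1 ?_)
      simpa using h3
    · obtain ⟨c, -, h5, h6, h7⟩ := h4 j hj
      have h6 := (reach_pair_iff (a := a.unpair) (b := c.unpair) ha1 ha2).1 (by simpa using h6)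
      obtain ⟨hc1, hc2⟩ := reflTransGen_lt h6 ha1 ha2
      exact ⟨c.unpair, h5, h6, (reach_pair_iff hc1 hc2).1 (by simpa using h7)⟩
  · rintro ⟨v, a, hI, h1, h2, h3⟩
    -- `Accepting` does not bound `v`; the bound comes from an edge leaving `v`, which exists even
    -- if the access walk is empty, by the cycle.
    have hv : v < vertexBound x := by
      rcases Relation.ReflTransGen.cases_head h1 with h | ⟨c, h, -⟩
      · obtain ⟨b, hab, -⟩ := Relation.TransGen.head'_iff.1 h2
        rw [← h] at hab
        exact hab.1.1.1
      · exact h.1.1.1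
    have hlt := reflTransGen_lt h1 hv le_rfl
    have hnode : ∀ b : ℕ × ℕ, b.1 < vertexBound x → b.2 ≤ counterBound x →
        Nat.pair b.1 b.2 < nodeBound x := fun b hb1 hb2 => pair_lt_pair hb1 (Nat.lt_succ_of_le hb2)
    refine ⟨v, hv, hI, Nat.pair a.1 a.2, hnode a hlt.1 hlt.2,
      (reach_pair_iff (a := (v, counterBound x)) hv le_rfl).2 h1, ?_, fun j hj => ?_⟩
    · obtain ⟨b, hab, hba⟩ := Relation.TransGen.head'_iff.1 h2
      have hb1 := hab.1.1.2
      have hb2 := hab.le_bound hlt.2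
      refine ⟨Nat.pair b.1 b.2, hnode b hb1 hb2, ?_, (reach_pair_iff hb1 hb2).2 hba⟩
      rw [nodeStep_iff, Nat.unpair_pair, Nat.unpair_pair]
      exact hab
    · obtain ⟨b, h4, h5, h6⟩ := h3 j hj
      obtain ⟨hb1, hb2⟩ := reflTransGen_lt h5 hlt.1 hlt.2
      exact ⟨Nat.pair b.1 b.2, hnode b hb1 hb2, by rw [Nat.unpair_pair]; exact h4,
        (reach_pair_iff hlt.1 hlt.2).2 h5, (reach_pair_iff hb1 hb2).2 h6⟩

end Instance

/-! ### Codes of atoms and valuations -/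

def Atom.ofCode (j : ℕ) : Atom := if j % 2 = 0 then .var (j / 2) else .sched (j / 2)

@[simp] theorem Atom.code_ofCode (j : ℕ) : (Atom.ofCode j).code = j := by
  unfold Atom.ofCode
  split_ifs <;> simp only [Atom.code] <;> omega

theorem Atom.code_injective : Function.Injective Atom.code := by
  intro a b h
  cases a <;> cases b <;> simp only [Atom.code] at h
  · congr 1; omega
  · omega
  · omega
  · congr 1; omega

theorem PropVal.bit_code {I : Finset Atom} (υ : PropVal I) (a : Atom) :
    Bit υ.code a.code ↔ a ∈ υ.1 := by
  simp [PropVal.code, bit_setCode, Atom.code_injective.eq_iff]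

namespace Instance

theorem procs_le (x : ℕ) : procs x ≤ x :=
  (natListLen_le _).trans ((Nat.unpair_right_le _).trans ((Nat.unpair_left_le _).trans
    (Nat.unpair_right_le _)))

theorem natListGet_le (n i : ℕ) : natListGet n i ≤ n := by
  by_cases h : i < natListLen n
  · exact (natListGet_lt h).le
  · rw [natListGet, List.getD_eq_default _ _ (by simpa [natListLen] using h)]
    exact Nat.zero_le _

theorem size_le (x p : ℕ) : size x p ≤ x :=
  (natListGet_le _ _).trans ((Nat.unpair_right_le _).trans (Nat.unpair_right_le _))

theorem inp_le (x p : ℕ) : inp x p ≤ x :=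
  (Nat.unpair_left_le _).trans ((natListGet_le _ _).trans ((Nat.unpair_right_le _).trans
    ((Nat.unpair_left_le _).trans (Nat.unpair_right_le _))))

theorem out_le (x p : ℕ) : out x p ≤ x :=
  (Nat.unpair_right_le _).trans ((natListGet_le _ _).trans ((Nat.unpair_right_le _).trans
    ((Nat.unpair_left_le _).trans (Nat.unpair_right_le _))))

theorem envOut_le (x : ℕ) : envOut x ≤ x :=
  (Nat.unpair_right_le _).trans ((Nat.unpair_left_le _).trans
    ((Nat.unpair_left_le _).trans (Nat.unpair_right_le _)))

/-- An element of a coded set is smaller than the code, and process numbers are below `x`; doubling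
for the atom codes leads to the bound `2 * x + 2`. -/
theorem IsInp.lt {x p j : ℕ} (h : IsInp x p j) (hp : p < procs x) : j < codeBound x := by
  have := procs_le x
  unfold codeBound
  rcases h with ⟨-, h⟩ | h
  · have := h.lt_self
    have := inp_le x p
    omega
  · omega

theorem IsEnvOut.lt {x j : ℕ} (h : IsEnvOut x j) : j < codeBound x := by
  have := procs_le x
  unfold codeBound
  rcases h with ⟨-, h⟩ | h
  · have := h.lt_self
    have := envOut_le x
    omega
  · omega

theorem IsSysOut.lt {x j : ℕ} (h : IsSysOut x j) : j < codeBound x := by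
  obtain ⟨-, p, -, h⟩ := h
  have := h.lt_self
  have := out_le x p
  unfold codeBound
  omega

variable {φ ψ : PromptLTL} {A : Architecture} {b : Fin A.n → ℕ}

theorem assumption_instanceCode : assumption (instanceCode φ ψ A b) = φ.code := by
  simp [assumption, instanceCode]

theorem guarantee_instanceCode : guarantee (instanceCode φ ψ A b) = ψ.code := by
  simp [guarantee, instanceCode]

theorem procs_instanceCode : procs (instanceCode φ ψ A b) = A.n := by
  simp only [procs, instanceCode, Architecture.code, Nat.unpair_pair]
  exact natListLen_ofFn _

theorem size_instanceCode (p : Fin A.n) : size (instanceCode φ ψ A b) p = b p := by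
  simp only [size, instanceCode, Nat.unpair_pair]
  exact natListGet_ofFn _ _

theorem bit_inp_instanceCode (p : Fin A.n) (a : ℕ) :
    Bit (inp (instanceCode φ ψ A b) p) a ↔ a ∈ A.inp (some p) := by
  have : inp (instanceCode φ ψ A b) p = setCode (A.inp (some p)) := by
    simp only [inp, instanceCode, Architecture.code, Nat.unpair_pair]
    rw [natListGet_ofFn]
    simp [Architecture.processCode]
  rw [this, bit_setCode]

theorem bit_out_instanceCode (p : Fin A.n) (a : ℕ) :
    Bit (out (instanceCode φ ψ A b) p) a ↔ a ∈ A.out (some p) := by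
  have : out (instanceCode φ ψ A b) p = setCode (A.out (some p)) := by
    simp only [out, instanceCode, Architecture.code, Nat.unpair_pair]
    rw [natListGet_ofFn]
    simp [Architecture.processCode]
  rw [this, bit_setCode]

theorem bit_envOut_instanceCode (a : ℕ) :
    Bit (envOut (instanceCode φ ψ A b)) a ↔ a ∈ A.out none := by
  have : envOut (instanceCode φ ψ A b) = setCode (A.out none) := by
    simp [envOut, instanceCode, Architecture.code, Architecture.processCode]
  rw [this, bit_setCode]

theorem assumption_lt : φ.code < codeBound (instanceCode φ ψ A b) := by
  have := (Nat.unpair_left_le (instanceCode φ ψ A b).unpair.1).trans (Nat.unpair_left_le _)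
  have h : assumption (instanceCode φ ψ A b) ≤ instanceCode φ ψ A b := this
  rw [assumption_instanceCode] at h
  unfold codeBound
  omega

theorem guarantee_lt : ψ.code < codeBound (instanceCode φ ψ A b) := by
  have := (Nat.unpair_right_le (instanceCode φ ψ A b).unpair.1).trans (Nat.unpair_left_le _)
  have h : guarantee (instanceCode φ ψ A b) ≤ instanceCode φ ψ A b := this
  rw [guarantee_instanceCode] at h
  unfold codeBound
  omega

theorem isInp_instanceCode (p : Fin A.n) (a : Atom) :
    IsInp (instanceCode φ ψ A b) p a.code ↔ a ∈ A.asyncInp p := by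
  cases a with
  | var a =>
    simp only [IsInp, Atom.code, bit_inp_instanceCode, Architecture.asyncInp]
    rw [Nat.mul_div_cancel_left _ (by norm_num)]
    simp
    omega
  | sched q =>
    simp only [IsInp, Atom.code, bit_inp_instanceCode, Architecture.asyncInp]
    simp

theorem isEnvOut_instanceCode (a : Atom) :
    IsEnvOut (instanceCode φ ψ A b) a.code ↔ a ∈ A.asyncEnvOut := by
  cases a with
  | var a =>
    simp only [IsEnvOut, Atom.code, bit_envOut_instanceCode, Architecture.asyncEnvOut]
    rw [Nat.mul_div_cancel_left _ (by norm_num)]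
    simp
  | sched q =>
    simp only [IsEnvOut, Atom.code, Architecture.asyncEnvOut, procs_instanceCode]
    have h : (2 * q + 1) / 2 = q := by omega
    have h' : (2 * q + 1) % 2 = 1 := by omega
    simp only [h, h', one_ne_zero, false_and, true_and, false_or, Finset.mem_union,
      Finset.mem_image]
    constructor
    · intro hq
      exact .inr ⟨⟨q, hq⟩, Finset.mem_univ _, rfl⟩
    · rintro (⟨_, _, h⟩ | ⟨⟨p, hp⟩, _, h⟩)
      · cases h
      · cases h; exact hp

theorem isSysOut_instanceCode (a : Atom) :
    IsSysOut (instanceCode φ ψ A b) a.code ↔ a ∈ A.sysOut := by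
  cases a with
  | var a =>
    simp only [IsSysOut, Atom.code, procs_instanceCode, Architecture.sysOut, BEx]
    rw [Nat.mul_div_cancel_left _ (by norm_num)]
    simp only [Nat.mul_mod_right, true_and, Finset.mem_biUnion, Finset.mem_univ]
    constructor
    · rintro ⟨p, hp, h⟩
      exact ⟨⟨p, hp⟩, Finset.mem_image_of_mem _ ((bit_out_instanceCode ⟨p, hp⟩ a).1 h)⟩
    · rintro ⟨p, h⟩
      refine ⟨p, p.2, (bit_out_instanceCode p a).2 ?_⟩
      simpa [Architecture.asyncOut] using h
  | sched q =>
    simp [IsSysOut, Atom.code, Architecture.sysOut, Architecture.asyncOut]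

theorem isVal_code (p : Fin A.n) (υ : PropVal (A.asyncInp p)) :
    υ.code < valBound (instanceCode φ ψ A b) ∧ IsVal (instanceCode φ ψ A b) p υ.code := by
  have key : ∀ j, Bit υ.code j → IsInp (instanceCode φ ψ A b) p j := by
    intro j hj
    rw [← Atom.code_ofCode j] at hj ⊢
    exact (isInp_instanceCode p _).2 (υ.2 ((υ.bit_code _).1 hj))
  refine ⟨setCode_lt fun j hj => ?_, fun j _ => key j⟩
  exact (key j ((bit_setCode _ j).2 hj)).lt (by rw [procs_instanceCode]; exact p.2)

theorem exists_propVal {p : Fin A.n} {u : ℕ} (hu : u < valBound (instanceCode φ ψ A b))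
    (h : IsVal (instanceCode φ ψ A b) p u) : ∃ υ : PropVal (A.asyncInp p), υ.code = u := by
  classical
  refine ⟨⟨(A.asyncInp p).filter fun a => Bit u a.code, Finset.filter_subset _ _⟩,
    bit_ext fun j => ?_⟩
  rw [← Atom.code_ofCode j, PropVal.bit_code]
  simp only [Finset.mem_filter, and_iff_right_iff_imp]
  intro hj
  rw [← isInp_instanceCode (φ := φ) (ψ := ψ) (b := b)]
  exact h _ (hj.lt_of_lt hu) hj

/-! ### Diagrams of families -/

/-- The set `t` codes the transition systems of the family `T`. -/
def IsDiagram (T : A.Family b) (t : ℕ) : Prop :=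
  ∀ p : Fin A.n,
    (∀ s : Fin (b p), Bit t (initIdx p s) ↔ s = (T p).init) ∧
    (∀ (s : Fin (b p)) (υ : PropVal (A.asyncInp p)) (s' : Fin (b p)),
      Bit t (stepIdx p s υ.code s') ↔ s' = (T p).step s υ) ∧
    ∀ (s : Fin (b p)), ∀ o ∈ A.out (some p),
      (Bit t (labelIdx o s) ↔ Atom.var o ∈ ((T p).label s).1)

theorem IsDiagram.isFamily {T : A.Family b} {t : ℕ} (h : IsDiagram T t) :
    IsFamily (instanceCode φ ψ A b) t := by
  intro p hp
  rw [procs_instanceCode] at hp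
  lift p to Fin A.n using hp
  rw [size_instanceCode]
  obtain ⟨h1, h2, -⟩ := h p
  constructor
  · refine ⟨(T p).init, Fin.is_lt _, fun s' hs' => ?_⟩
    exact (h1 ⟨s', hs'⟩).trans Fin.ext_iff
  · intro s hs u hu hval
    obtain ⟨υ, rfl⟩ := exists_propVal hu hval
    refine ⟨(T p).step ⟨s, hs⟩ υ, Fin.is_lt _, fun s' hs' => ?_⟩
    exact (h2 ⟨s, hs⟩ υ ⟨s', hs'⟩).trans Fin.ext_iff

/-- `IsFamily` makes the initial states and transitions functional. Labels need no condition, as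
every choice of label bits is a labeling. -/
theorem exists_isDiagram {t : ℕ} (h : IsFamily (instanceCode φ ψ A b) t) :
    ∃ T : A.Family b, IsDiagram T t := by
  classical
  have h1 : ∀ p : Fin A.n, ∃ s : Fin (b p), ∀ s' : Fin (b p),
      Bit t (initIdx p s') ↔ s' = s := by
    intro p
    obtain ⟨s, hs, h⟩ := (h p (by rw [procs_instanceCode]; exact p.2)).1
    rw [size_instanceCode] at hs h
    exact ⟨⟨s, hs⟩, fun s' => (h s' s'.2).trans
      (Fin.ext_iff (a := s') (b := ⟨s, hs⟩)).symm⟩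
  have h2 : ∀ (p : Fin A.n) (s : Fin (b p)) (υ : PropVal (A.asyncInp p)), ∃ s' : Fin (b p),
      ∀ s'' : Fin (b p), Bit t (stepIdx p s υ.code s'') ↔ s'' = s' := by
    intro p s υ
    have hυ := isVal_code (φ := φ) (ψ := ψ) (b := b) p υ
    obtain ⟨s', hs', h⟩ := (h p (by rw [procs_instanceCode]; exact p.2)).2 s
      (by rw [size_instanceCode]; exact s.2) υ.code hυ.1 hυ.2
    rw [size_instanceCode] at hs' h
    exact ⟨⟨s', hs'⟩, fun s'' => (h s'' s''.2).trans
      (Fin.ext_iff (a := s'') (b := ⟨s', hs'⟩)).symm⟩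
  choose init hinit using h1
  choose step hstep using h2
  refine ⟨fun p => ⟨init p, step p, fun s => ⟨(A.asyncOut p).filter fun a =>
    ∃ o, a = Atom.var o ∧ Bit t (labelIdx o s), Finset.filter_subset _ _⟩⟩, fun p =>
    ⟨hinit p, hstep p, fun s o ho => ?_⟩⟩
  simp [Architecture.asyncOut, ho]

end Instance

/-! ### Runs of the distributed product -/

namespace TransitionSystem

variable {I O : Finset Atom} {S : Type} (T : TransitionSystem I O S)

theorem reach_append_singleton (v : List (PropVal I)) (υ : PropVal I) :
    T.reach (v ++ [υ]) = T.step (T.reach v) υ := by simp [reach]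

/-- The state that is reached before position `n` of the word `w`. -/
def stateAt (w : Word) (n : ℕ) : S :=
  T.reach ((List.range n).map fun m => PropVal.restrict I (w m))

theorem stateAt_succ (w : Word) (n : ℕ) :
    T.stateAt w (n + 1) = T.step (T.stateAt w n) (PropVal.restrict I (w n)) := by
  rw [stateAt, List.range_succ, List.map_append, List.map_singleton, reach_append_singleton]
  rfl

end TransitionSystem

namespace Instance

variable {φ ψ : PromptLTL} {A : Architecture} {b : Fin A.n → ℕ} {T : A.Family b} {t : ℕ}

/-- The letter `σ` at position `n` of a word is allowed for a path of the product with current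
state `s`. -/
def LetterAllowed (T : A.Family b) (s : ∀ p, Fin (b p)) (σ : Finset Atom) : Prop :=
  σ ⊆ A.asyncEnvOut ∪ A.sysOut ∧ σ ∩ A.sysOut = ((A.product T).label s).1

theorem isPath_iff (w : Word) :
    (A.product T).IsPath w ↔ ∀ n, LetterAllowed T ((A.product T).stateAt w n) (w n) := by
  simp only [TransitionSystem.IsPath, LetterAllowed, Subtype.ext_iff]
  rfl

/-- An allowed letter is the union of its environment part and the label of the state, so in the
product each process reads just its inputs from the letter. -/
theorem product_step {s : ∀ p, Fin (b p)} {σ : Finset Atom} (h : LetterAllowed T s σ)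
    (p : Fin A.n) : (A.product T).step s (PropVal.restrict A.asyncEnvOut σ) p =
      (T p).step (s p) (PropVal.restrict (A.asyncInp p) σ) := by
  have : σ ∩ A.asyncEnvOut ∪ ((A.product T).label s).1 = σ := by
    rw [← h.2, ← Finset.inter_union_distrib_left, Finset.inter_eq_left.2 h.1]
  change (T p).step (s p) (PropVal.restrict _ (σ ∩ A.asyncEnvOut ∪
    ((A.product T).label s).1)) = _
  rw [this]

theorem mem_product_label {s : ∀ p, Fin (b p)} {a : Atom} :
    a ∈ ((A.product T).label s).1 ↔ ∃ p, a ∈ ((T p).label (s p)).1 := by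
  change a ∈ Finset.univ.biUnion (fun p => ((T p).label (s p)).1) ↔ _
  simp

/-- The vertex `v` carries the letter `σ`. -/
def HasLetter (x v : ℕ) (σ : Finset Atom) : Prop := ∀ a : Atom, Letter x v a.code ↔ a ∈ σ

/-- The vertex `v` carries the state `s`. -/
def HasState {b : Fin A.n → ℕ} (v : ℕ) (s : ∀ p, Fin (b p)) : Prop :=
  ∀ (p : Fin A.n) (r : Fin (b p)), InState v p r ↔ r = s p

theorem inLabel_iff (hT : IsDiagram T t) {v : ℕ} {s : ∀ p, Fin (b p)} (hs : HasState v s)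
    (o : ℕ) : InLabel (instanceCode φ ψ A b) t v (2 * o) ↔
      Atom.var o ∈ ((A.product T).label s).1 := by
  rw [mem_product_label]
  simp only [InLabel, BEx, procs_instanceCode]
  rw [Nat.mul_div_cancel_left _ (by norm_num)]
  constructor
  · rintro ⟨p, hp, h1, r, hr, h2, h3⟩
    lift p to Fin A.n using hp
    rw [size_instanceCode] at hr
    lift r to Fin (b p) using hr
    rw [bit_out_instanceCode] at h1
    rw [hs] at h2
    rw [(hT p).2.2 r o h1, h2] at h3
    exact ⟨p, h3⟩
  · rintro ⟨p, h⟩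
    have ho : o ∈ A.out (some p) := by
      simpa [Architecture.asyncOut] using ((T p).label (s p)).2 h
    refine ⟨p, p.2, (bit_out_instanceCode p o).2 ho, s p, ?_, (hs p _).2 rfl,
      ((hT p).2.2 _ o ho).2 h⟩
    rw [size_instanceCode]
    exact (s p).2

theorem letterOK_iff (hT : IsDiagram T t) {v : ℕ} {s : ∀ p, Fin (b p)} {σ : Finset Atom}
    (hσ : HasLetter (instanceCode φ ψ A b) v σ) (hs : HasState v s) :
    LetterOK (instanceCode φ ψ A b) t v ↔ LetterAllowed T s σ := by
  have hlab : ∀ a ∈ A.sysOut,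
      InLabel (instanceCode φ ψ A b) t v a.code ↔ a ∈ ((A.product T).label s).1 := by
    intro a ha
    cases a with
    | var o => exact inLabel_iff hT hs o
    | sched q => simp [Architecture.sysOut, Architecture.asyncOut] at ha
  constructor
  · intro h
    refine ⟨fun a ha => ?_, Finset.ext fun a => ?_⟩
    · have h1 := (hσ a).2 ha
      have h2 := (h _ h1.1).1 h1
      rw [isEnvOut_instanceCode, isSysOut_instanceCode] at h2
      exact Finset.mem_union.2 h2
    · rw [Finset.mem_inter]
      constructor
      · rintro ⟨h1, h2⟩
        have h3 := (hσ a).2 h1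
        rw [← hlab a h2]
        exact ((h _ h3.1).2 ((isSysOut_instanceCode a).2 h2)).1 h3
      · intro h1
        have h2 := ((A.product T).label s).2 h1
        refine ⟨?_, h2⟩
        have h3 := (isSysOut_instanceCode (φ := φ) (ψ := ψ) (b := b) a).2 h2
        rw [← hσ a]
        exact ((h _ h3.lt).2 h3).2 ((hlab a h2).2 h1)
  · rintro ⟨h1, h2⟩ j hj
    rw [← Atom.code_ofCode j]
    rw [Impl, Impl, isEnvOut_instanceCode, isSysOut_instanceCode, hσ]
    refine ⟨fun h => Finset.mem_union.1 (h1 h), fun h => ?_⟩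
    rw [hlab _ h, ← h2, Finset.mem_inter, and_iff_left h]

theorem stateStep_iff (hT : IsDiagram T t) {v v' : ℕ} {s : ∀ p, Fin (b p)} {σ : Finset Atom}
    (hσ : HasLetter (instanceCode φ ψ A b) v σ) (hs : HasState v s) :
    StateStep (instanceCode φ ψ A b) t v v' ↔
      HasState v' fun p => (T p).step (s p) (PropVal.restrict (A.asyncInp p) σ) := by
  have hcode : ∀ (p : Fin A.n) (a : Atom),
      Bit (PropVal.restrict (A.asyncInp p) σ).code a.code ↔
        IsInp (instanceCode φ ψ A b) p a.code ∧ Letter (instanceCode φ ψ A b) v a.code := by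
    intro p a
    rw [PropVal.bit_code, isInp_instanceCode, hσ]
    simp [PropVal.restrict, and_comm]
  constructor
  · intro h p r
    have h1 := h p (by rw [procs_instanceCode]; exact p.2) (s p)
      (by rw [size_instanceCode]; exact (s p).2) ((hs p _).2 rfl) _ (isVal_code p _).1
      (fun j _ => by rw [← Atom.code_ofCode j]; exact hcode p _) r
      (by rw [size_instanceCode]; exact r.2)
    exact h1.trans ((hT p).2.1 (s p) _ r)
  · intro h p hp r hr hin u hu hcode' r' hr'
    rw [procs_instanceCode] at hp
    lift p to Fin A.n using hp
    rw [size_instanceCode] at hr hr'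
    lift r to Fin (b p) using hr
    lift r' to Fin (b p) using hr'
    rw [hs] at hin
    -- The test inspects only bits below `codeBound`; both numbers are below `valBound`, so they
    -- have no other bits.
    have hu' : u = (PropVal.restrict (A.asyncInp p) σ).code := by
      refine bit_ext fun j => ?_
      rw [← Atom.code_ofCode j]
      by_cases hj : j < codeBound (instanceCode φ ψ A b)
      · rw [hcode]
        have := hcode' j hj
        rwa [← Atom.code_ofCode j] at this
      · rw [Atom.code_ofCode]
        exact iff_of_false (fun h => hj (h.lt_of_lt hu))
          fun h => hj (h.lt_of_lt (isVal_code p _).1)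
    rw [hu', hin]
    exact (h p r').trans ((hT p).2.1 (s p) _ r').symm

/-! ### Correctness of the frozenness test -/

/-- Frozenness concerns reachable states only. `IsFrozen` asks for a set `R` that contains the
initial state, is closed under steps and has frozen states; any such `R` contains the reachable
states, and the set of reachable states is one. -/
theorem isFrozen_iff (hT : IsDiagram T t) :
    IsFrozen (instanceCode φ ψ A b) t ↔ ∀ p, (T p).FrozenWithout (Atom.sched p) := by
  have hsched : ∀ (p : Fin A.n) (υ : PropVal (A.asyncInp p)),
      Bit υ.code (2 * p + 1) ↔ Atom.sched p ∈ υ.1 := fun p υ => υ.bit_code (Atom.sched p)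
  constructor
  · intro h p
    obtain ⟨R, -, h1, h2⟩ := h p (by rw [procs_instanceCode]; exact p.2)
    rw [size_instanceCode] at h1 h2
    have hstep : ∀ (s : Fin (b p)) (υ : PropVal (A.asyncInp p)), Bit R s →
        Bit R ((T p).step s υ) ∧ (Atom.sched p ∈ υ.1 ∨ (T p).step s υ = s) := by
      intro s υ hs
      have hυ := isVal_code (φ := φ) (ψ := ψ) (b := b) p υ
      have := h2 s s.2 υ.code hυ.1 _ ((T p).step s υ).2
        ⟨hs, hυ.2, ((hT p).2.1 s υ _).2 rfl⟩
      rwa [hsched, ← Fin.ext_iff] at this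
    have hreach : ∀ v, Bit R ((T p).reach v) := by
      intro v
      induction v using List.reverseRecOn with
      | nil => exact h1 _ (Fin.is_lt _) (((hT p).1 _).2 rfl)
      | append_singleton v υ ih =>
        rw [TransitionSystem.reach_append_singleton]
        exact (hstep _ υ ih).1
    intro v υ hυ
    rw [TransitionSystem.reach_append_singleton]
    exact (hstep _ υ (hreach v)).2.resolve_left hυ
  · intro h p hp
    rw [procs_instanceCode] at hp
    lift p to Fin A.n using hp
    rw [size_instanceCode]
    obtain ⟨R, hR, hR'⟩ := exists_bitset (b p) fun r => ∃ v, ((T p).reach v : ℕ) = r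
    refine ⟨R, hR, fun r hr hi => ?_, fun r hr u hu r' hr' => ?_⟩
    · lift r to Fin (b p) using hr
      rw [(hT p).1] at hi
      exact (hR' r).2 ⟨r.2, [], by rw [hi]; rfl⟩
    · rintro ⟨h1, h2, h3⟩
      lift r to Fin (b p) using hr
      lift r' to Fin (b p) using hr'
      obtain ⟨υ, rfl⟩ := exists_propVal hu h2
      rw [(hT p).2.1] at h3
      obtain ⟨-, v, hv⟩ := (hR' r).1 h1
      have hv : (T p).reach v = r := Fin.ext hv
      have hv' : (T p).reach (v ++ [υ]) = r' := by
        rw [TransitionSystem.reach_append_singleton, hv, h3]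
      refine ⟨(hR' r').2 ⟨r'.2, _, by rw [hv']⟩, ?_⟩
      rw [hsched]
      by_cases hυ : Atom.sched p ∈ υ.1
      · exact .inl hυ
      · refine .inr ?_
        rw [← hv', h p v υ hυ, hv]

/-! ### Correctness of the emptiness test -/

/-- The components are kept apart by the tags `0` to `5`, and their entries are below `codeBound x`,
so all bits fit below the exponent in `vertexBound`. -/
theorem exists_vertex (x : ℕ) (W X Y D : ℕ → Prop) (S : ℕ → ℕ → Prop) (q : Prop) :
    ∃ v < vertexBound x, (∀ j < codeBound x, Letter x v j ↔ W j) ∧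
      (∀ p < codeBound x, ∀ s < codeBound x, InState v p s ↔ S p s) ∧
      (∀ m < codeBound x, Pos v m ↔ X m) ∧ (∀ m < codeBound x, Neg v m ↔ Y m) ∧
      (∀ m < codeBound x, Pending v m ↔ D m) ∧ (Marked v ↔ q) := by
  obtain ⟨v, hv, h⟩ := exists_bitset (Nat.pair 6 (Nat.pair (codeBound x) (codeBound x))) fun i =>
    (i.unpair.1 = 0 ∧ W i.unpair.2) ∨
    (i.unpair.1 = 1 ∧ S i.unpair.2.unpair.1 i.unpair.2.unpair.2) ∨
    (i.unpair.1 = 2 ∧ X i.unpair.2) ∨ (i.unpair.1 = 3 ∧ Y i.unpair.2) ∨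
    (i.unpair.1 = 4 ∧ D i.unpair.2) ∨ (i.unpair.1 = 5 ∧ q)
  have hlt : ∀ c < 6, ∀ j < codeBound x,
      Nat.pair c j < Nat.pair 6 (Nat.pair (codeBound x) (codeBound x)) := fun c hc j hj =>
    pair_lt_pair hc (hj.trans_le (Nat.left_le_pair _ _))
  refine ⟨v, hv, fun j hj => ?_, fun p hp s hs => ?_, fun m hm => ?_, fun m hm => ?_,
    fun m hm => ?_, ?_⟩
  · simp [Letter, h, hj, hlt]
  · simp [InState, h, pair_lt_pair (show 1 < 6 by norm_num) (pair_lt_pair hp hs)]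
  · simp [Pos, h, hm, hlt]
  · simp [Neg, h, hm, hlt]
  · simp [Pending, h, hm, hlt]
  · simp [Marked, h, hlt 5 (by norm_num) 0 (by simp [codeBound])]

end Instance

/-! ### Locality of the tableau conditions -/

theorem argCode_le (m : ℕ) : argCode m ≤ m := Nat.unpair_right_le m
theorem leftCode_le (m : ℕ) : leftCode m ≤ m :=
  (Nat.unpair_left_le _).trans (Nat.unpair_right_le m)
theorem rightCode_le (m : ℕ) : rightCode m ≤ m :=
  (Nat.unpair_right_le _).trans (Nat.unpair_right_le m)

section Congr

variable {B m : ℕ} {W V X X' Z Z' D D' P P' : ℕ → Prop} {q r : Prop}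

/-- Operands have codes no larger than the formula, so the condition sees only the part of the sets
below `B`, which is the part a vertex is guaranteed to store. -/
theorem posStep_congr (hm : m < B) (hW : ∀ j < B, W j ↔ V j) (hX : ∀ j < B, X j ↔ Z j)
    (hX' : ∀ j < B, X' j ↔ Z' j) : PosStep W X X' m ↔ PosStep V Z Z' m := by
  have ha := (argCode_le m).trans_lt hm
  have hl := (leftCode_le m).trans_lt hm
  have hr := (rightCode_le m).trans_lt hm
  simp only [PosStep, hW _ ha, hX _ ha, hX _ hl, hX _ hr, hX _ hm, hX' _ ha, hX' _ hm]

theorem negStep_congr (hm : m < B) (hW : ∀ j < B, W j ↔ V j) (hX : ∀ j < B, X j ↔ Z j)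
    (hX' : ∀ j < B, X' j ↔ Z' j) (hD : ∀ j < B, D j ↔ P j) (hD' : ∀ j < B, D' j ↔ P' j)
    (hq : q ↔ r) : NegStep W X D X' D' q m ↔ NegStep V Z P Z' P' r m := by
  have ha := (argCode_le m).trans_lt hm
  have hl := (leftCode_le m).trans_lt hm
  have hr := (rightCode_le m).trans_lt hm
  simp only [NegStep, hW _ ha, hX _ ha, hX _ hl, hX _ hr, hX _ hm, hX' _ ha, hX' _ hm, hD _ hm,
    hD' _ hm, hq]

theorem posBounded_congr (hm : m < B) (hX : ∀ j < B, X j ↔ Z j) :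
    PosBounded X m ↔ PosBounded Z m := by
  simp only [PosBounded, hX _ hm, hX _ ((argCode_le m).trans_lt hm)]

theorem posFair_congr (hm : m < B) (hX : ∀ j < B, X j ↔ Z j) : PosFair X m ↔ PosFair Z m := by
  simp only [PosFair, posBounded_congr hm hX, hX _ hm, hX _ ((rightCode_le m).trans_lt hm)]

theorem negFair_congr (hm : m < B) (hX : ∀ j < B, X j ↔ Z j) : NegFair X m ↔ NegFair Z m := by
  simp only [NegFair, hX _ hm, hX _ ((rightCode_le m).trans_lt hm)]

end Congr

/-! ### Paths of the tableau graph and words of the product -/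

namespace Instance

variable {φ ψ : PromptLTL} {A : Architecture} {b : Fin A.n → ℕ} {T : A.Family b} {t : ℕ}

theorem fair_two_mul (m v : ℕ) : Fair (2 * m) v ↔ PosFair (Pos v) m := by simp [Fair]

theorem fair_two_mul_add_one (m v : ℕ) : Fair (2 * m + 1) v ↔ NegFair (Neg v) m := by
  have h : (2 * m + 1) % 2 = 1 := by omega
  have h' : (2 * m + 1) / 2 = m := by omega
  simp [Fair, h, h']

/-- The letters along the path form the word. By induction the stored states are those of the
product, and soundness of the two tableaux, with the same `K` and `L`, gives the truth values. -/
theorem exists_word_of_isPath (hT : IsDiagram T t) {π : ℕ → ℕ} {K L : ℕ}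
    (hπ : (graph (instanceCode φ ψ A b) t).IsPath π K L) :
    ∃ w, (A.product T).IsPath w ∧ φ.Holds w K ∧ ¬ ψ.Holds w L := by
  classical
  set x := instanceCode φ ψ A b with hx
  set w : Word := fun i => (A.asyncEnvOut ∪ A.sysOut).filter fun a => Letter x (π i) a.code with hw
  have hσ : ∀ i, HasLetter x (π i) (w i) := by
    intro i a
    simp only [hw, Finset.mem_filter, iff_and_self]
    intro h
    have := ((hπ.edge i).2.1 _ h.1).1 h
    rw [isEnvOut_instanceCode, isSysOut_instanceCode] at this
    exact Finset.mem_union.2 this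
  have hstate : ∀ i, HasState (π i) ((A.product T).stateAt w i) := by
    intro i
    induction i with
    | zero =>
      intro p s
      have h := hπ.init.1 p (by rw [procs_instanceCode]; exact p.2) s
        (by rw [size_instanceCode]; exact s.2)
      exact h.trans ((hT p).1 s)
    | succ i ih =>
      have h1 := (letterOK_iff hT (hσ i) ih).1 (hπ.edge i).2.1
      have h2 := (stateStep_iff hT (hσ i) ih).1 (hπ.edge i).2.2.1
      rw [TransitionSystem.stateAt_succ]
      intro p s
      rw [product_step h1]
      exact h2 p s
  refine ⟨w, (isPath_iff w).2 fun i => (letterOK_iff hT (hσ i) (hstate i)).1 (hπ.edge i).2.1,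
    ?_, ?_⟩
  · refine holdsAt_of_posStep (W := fun i => Letter x (π i)) (X := fun i => Pos (π i)) hσ
      (fun i m hm => ((hπ.edge i).2.2.2 m hm).1) (fun m hm n => ?_) hπ.bounded φ assumption_lt 0 ?_
    · obtain ⟨i, h1, h2⟩ := hπ.fair (2 * m) (Nat.mul_lt_mul_of_pos_left hm (by norm_num)) n
      exact ⟨i, h1, (fair_two_mul _ _).1 h2⟩
    · have := hπ.init.2.1
      rwa [hx, assumption_instanceCode] at this
  · refine not_holdsAt_of_negStep (W := fun i => Letter x (π i)) (Y := fun i => Neg (π i))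
      (D := fun i => Pending (π i)) (Q := fun i => Marked (π i)) hσ
      (fun i m hm => ((hπ.edge i).2.2.2 m hm).2) (fun m hm n => ?_) hπ.gap ψ guarantee_lt 0 ?_
    · obtain ⟨i, h1, h2⟩ := hπ.fair (2 * m + 1) (show 2 * m + 1 < 2 * codeBound x by
        have : m < codeBound x := hm
        omega) n
      exact ⟨i, h1, (fair_two_mul_add_one _ _).1 h2⟩
    · have := hπ.init.2.2.1
      rwa [hx, guarantee_instanceCode] at this

/-- Each vertex records the actual truth at its position, with marks at the positive multiples of `L
+ 1`. This period is positive even for `L = 0`, and the bound in `hψ` is twice the period, as the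
negative tableau requires. -/
theorem exists_isPath_of_word (hT : IsDiagram T t) {w : Word} (hw : (A.product T).IsPath w)
    {k L : ℕ} (hφ : φ.Holds w k) (hψ : ¬ ψ.Holds w (2 * (L + 1))) :
    ∃ π, (graph (instanceCode φ ψ A b) t).IsPath π k L := by
  set x := instanceCode φ ψ A b with hx
  set l := 2 * (L + 1) with hl
  have hw' := (isPath_iff w).1 hw
  have hpx : ∀ p : Fin A.n, (p : ℕ) < codeBound x := by
    intro p
    have h1 := procs_le x
    have h2 : procs x = A.n := procs_instanceCode
    have := p.2
    unfold codeBound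
    omega
  have hsx : ∀ (p : Fin A.n) (s : Fin (b p)), (s : ℕ) < codeBound x := by
    intro p s
    have h1 := size_le x p
    have h2 : size x p = b p := size_instanceCode p
    have := s.2
    unfold codeBound
    omega
  choose π hN hL hS hX hY hD hQ using fun i => exists_vertex x (fun j => ∃ a ∈ w i, a.code = j)
    (trueCodes w k i) (falseCodes w l (L + 1) i) (pendingCodes w l (L + 1) i)
    (fun p s => ∃ q : Fin A.n, (q : ℕ) = p ∧ ((A.product T).stateAt w i q : ℕ) = s)
    (0 < i ∧ L + 1 ∣ i)
  have hσ : ∀ i, HasLetter x (π i) (w i) := by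
    intro i a
    constructor
    · intro h
      obtain ⟨a', h1, h2⟩ := (hL i _ h.1).1 h
      rwa [← Atom.code_injective h2]
    · intro h
      have hlt : a.code < codeBound x := by
        rcases Finset.mem_union.1 ((hw' i).1 h) with h1 | h1
        · exact ((isEnvOut_instanceCode a).2 h1).lt
        · exact ((isSysOut_instanceCode a).2 h1).lt
      exact (hL i _ hlt).2 ⟨a, h, rfl⟩
  have hstate : ∀ i, HasState (π i) ((A.product T).stateAt w i) := by
    intro i p s
    rw [hS i p (hpx p) s (hsx p s)]
    constructor
    · rintro ⟨q, h1, h2⟩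
      obtain rfl := Fin.ext h1
      exact Fin.ext h2.symm
    · rintro rfl
      exact ⟨p, rfl, rfl⟩
  have hW : ∀ i (a : Atom), Letter x (π i) a.code ↔ a ∈ w i := fun i a => hσ i a
  refine ⟨π, ⟨?_, ?_, ?_, ?_⟩, fun i => ⟨⟨hN i, hN (i + 1)⟩, ?_, ?_, fun m hm => ⟨?_, ?_⟩⟩, ?_,
    fun m hm n => ?_, fun i j hij hi hj => ?_⟩
  · intro p hp s hs
    have hp' : p < A.n := by rwa [procs_instanceCode] at hp
    lift p to Fin A.n using hp'
    have hs' : s < b p := by rwa [size_instanceCode] at hs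
    lift s to Fin (b p) using hs'
    exact (hstate 0 p s).trans ((hT p).1 s).symm
  · rw [hx, assumption_instanceCode]
    exact (hX 0 _ assumption_lt).2 ⟨φ, rfl, hφ⟩
  · rw [hx, guarantee_instanceCode]
    exact (hY 0 _ guarantee_lt).2 ⟨ψ, rfl, .inl hψ⟩
  · exact fun h => absurd ((hQ 0).1 h).1 (lt_irrefl 0)
  · exact (letterOK_iff hT (hσ i) (hstate i)).2 (hw' i)
  · refine (stateStep_iff hT (hσ i) (hstate i)).2 fun p s => ?_
    rw [hstate (i + 1) p s, TransitionSystem.stateAt_succ, product_step (hw' i)]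
  · exact (posStep_congr hm (fun _ _ => Iff.rfl) (hX i) (hX (i + 1))).2
      (trueCodes_posStep hW k i m)
  · exact (negStep_congr hm (fun _ _ => Iff.rfl) (hY i) (hY (i + 1)) (hD i) (hD (i + 1))
      (hQ (i + 1))).2 (falseCodes_negStep hW (Nat.succ_pos L) le_rfl i m)
  · intro j hj n
    have hj : j < 2 * codeBound x := hj
    rcases Nat.even_or_odd' j with ⟨m, rfl | rfl⟩
    · obtain ⟨i, h1, h2⟩ := trueCodes_posFair (w := w) k m n
      exact ⟨i, h1, (fair_two_mul _ _).2 ((posFair_congr (by omega) (hX i)).2 h2)⟩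
    · obtain ⟨i, h1, h2⟩ := falseCodes_negFair (w := w) l (L + 1) m n
      exact ⟨i, h1, (fair_two_mul_add_one _ _).2 ((negFair_congr (by omega) (hY i)).2 h2)⟩
  · obtain ⟨i, h1, h2, h3⟩ := trueCodes_posBounded (w := w) k m n
    exact ⟨i, h1, h2, (posBounded_congr hm (hX i)).2 h3⟩
  · obtain ⟨-, c, rfl⟩ := (hQ i).1 hi
    obtain ⟨-, d, rfl⟩ := (hQ j).1 hj
    have hcd : c + 1 ≤ d := by
      by_contra! h
      exact absurd (Nat.mul_le_mul_left (L + 1) (show d ≤ c by omega)) (by omega)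
    have := Nat.mul_le_mul_left (L + 1) hcd
    rw [Nat.mul_add] at this
    omega

/-- Passing from `L` to `2 * (L + 1)` is harmless because `L` is universally quantified on both
sides, whereas the bound on the assumption is preserved exactly. -/
theorem accepts_iff_not_satisfies (hT : IsDiagram T t) :
    Accepts (instanceCode φ ψ A b) t ↔ ¬ (A.product T).Satisfies φ ψ := by
  rw [accepts_iff, PromptGraph.accepting_iff]
  constructor
  · rintro ⟨K, hK⟩ hsat
    obtain ⟨l, hl⟩ := hsat K
    obtain ⟨π, hπ⟩ := hK l
    obtain ⟨w, h1, h2, h3⟩ := exists_word_of_isPath hT hπ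
    exact h3 (hl w h1 h2)
  · intro h
    simp only [TransitionSystem.Satisfies, not_forall, not_exists] at h
    obtain ⟨k, hk⟩ := h
    refine ⟨k, fun L => ?_⟩
    obtain ⟨w, h1, h2, h3⟩ := hk (2 * (L + 1))
    exact exists_isPath_of_word hT h1 h2 h3

theorem isSolution_iff (hT : IsDiagram T t) :
    IsSolution (instanceCode φ ψ A b) t ↔ A.Realizes T φ ψ := by
  rw [IsSolution, isFrozen_iff hT, accepts_iff_not_satisfies hT, not_not, Architecture.Realizes,
    and_iff_right hT.isFamily]

end Instance

open FirstOrder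

/-! ### Models of constraint systems -/

theorem model_constraint_iff {C : ConstraintSystem} {M : Type} [constraintLanguage.Structure M] :
    M ⊨ constraintTheory ∪ {C.1} ↔ M ⊨ constraintTheory ∧ M ⊨ C.1 := by
  rw [Language.Theory.model_union_iff, Language.Theory.model_singleton_iff]

theorem ConstraintSystem.satisfiable_of_model (C : ConstraintSystem) (M : Type) [Nonempty M]
    [PartialOrder M] [constraintLanguage.Structure M] [constraintLanguage.OrderedStructure M]
    (h : M ⊨ C.1) : Nonempty C.Solution :=
  haveI : M ⊨ constraintTheory ∪ {C.1} :=
    model_constraint_iff.2 ⟨Language.model_partialOrder, h⟩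
  ⟨.of _ M⟩

/-! Function and relation symbols of a given arity, and their numbers. -/

def fnSymbol (k f : ℕ) : constraintLanguage.Functions k := f
def relSymbol (k R : ℕ) : constraintLanguage.Relations k := R
def fnIndex {k : ℕ} (f : constraintLanguage.Functions k) : ℕ := f
def relIndex {k : ℕ} (R : constraintLanguage.Relations k) : ℕ := R

@[simp] theorem fnIndex_fnSymbol (k f : ℕ) : fnIndex (fnSymbol k f) = f := rfl
@[simp] theorem relIndex_relSymbol (k R : ℕ) : relIndex (relSymbol k R) = R := rfl

theorem termCode_func {n k : ℕ} (f : constraintLanguage.Functions k)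
    (ts : Fin k → constraintLanguage.Term (Empty ⊕ Fin n)) :
    termCode (.func f ts) = Nat.pair 1 (Nat.pair (fnIndex f)
      (Encodable.encode (List.ofFn fun i => termCode (ts i)))) := rfl

theorem formulaCode_equal {n : ℕ} (s s' : constraintLanguage.Term (Empty ⊕ Fin n)) :
    formulaCode (.equal s s') = Nat.pair 1 (Nat.pair (termCode s) (termCode s')) := rfl

theorem formulaCode_rel {n k : ℕ} (R : constraintLanguage.Relations k)
    (ts : Fin k → constraintLanguage.Term (Empty ⊕ Fin n)) :
    formulaCode (.rel R ts) = Nat.pair 2 (Nat.pair (relIndex R)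
      (Encodable.encode (List.ofFn fun i => termCode (ts i)))) := rfl

theorem formulaCode_imp {n : ℕ} (σ τ : constraintLanguage.BoundedFormula Empty n) :
    formulaCode (σ.imp τ) = Nat.pair 3 (Nat.pair (formulaCode σ) (formulaCode τ)) := rfl

theorem funMap_congr {M : Type} [constraintLanguage.Structure M] {n n' : ℕ} (h : n = n') (f : ℕ)
    {x : Fin n → M} {x' : Fin n' → M}
    (hx : ∀ i (h1 : i < n) (h2 : i < n'), x ⟨i, h1⟩ = x' ⟨i, h2⟩) :
    Language.Structure.funMap (fnSymbol n f) x =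
      Language.Structure.funMap (fnSymbol n' f) x' := by
  subst h
  rw [show x = x' from funext fun i => hx i i.2 i.2]

theorem relMap_congr {M : Type} [constraintLanguage.Structure M] {n n' : ℕ} (h : n = n') (R : ℕ)
    {x : Fin n → M} {x' : Fin n' → M}
    (hx : ∀ i (h1 : i < n) (h2 : i < n'), x ⟨i, h1⟩ = x' ⟨i, h2⟩) :
    Language.Structure.RelMap (relSymbol n R) x ↔
      Language.Structure.RelMap (relSymbol n' R) x' := by
  subst h
  rw [show x = x' from funext fun i => hx i i.2 i.2]

/-! ### Certificates for satisfiability -/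

namespace Certificate

/-- The bits of a certificate `S`: the order of the closed terms, the true formulas, the terms and
the formulas. -/
def Le (S i j : ℕ) : Prop := Bit S (Nat.pair 0 (Nat.pair i j))
def Tr (S m : ℕ) : Prop := Bit S (Nat.pair 1 m)
def Tm (S m : ℕ) : Prop := Bit S (Nat.pair 2 m)
def Fm (S m : ℕ) : Prop := Bit S (Nat.pair 3 m)

def Same (S i j : ℕ) : Prop := Le S i j ∧ Le S j i

def ArgsSame (S k l : ℕ) : Prop :=
  natListLen k = natListLen l ∧
    BAll (natListLen k) fun i => Same S (natListGet k i) (natListGet l i)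

def ArgsTm (S k : ℕ) : Prop := BAll (natListLen k) fun i => Tm S (natListGet k i)

def IsOrder (c S : ℕ) : Prop :=
  BAll (c + 1) fun i => Le S i i ∧ BAll (c + 1) fun j => BAll (c + 1) fun k =>
    Impl (Le S i j ∧ Le S j k) (Le S i k)

/-- This makes a number marked by `Fm` the code of an actual quantifier-free sentence; other numbers
must be rejected by the decision procedure. -/
def WellFormed (c S : ℕ) : Prop :=
  BAll (c + 1) fun m => Impl (Tm S m) (opCode m = 1 ∧ ArgsTm S (rightCode m)) ∧
    Impl (Fm S m) (m = 0 ∨ (opCode m = 1 ∧ Tm S (leftCode m) ∧ Tm S (rightCode m)) ∨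
      (opCode m = 2 ∧ ArgsTm S (rightCode m)) ∨
      (opCode m = 3 ∧ Fm S (leftCode m) ∧ Fm S (rightCode m)))

/-- Operator `1` is shared by function terms and equations. Every such number is treated as a term
here, whereas `TruthOK` reads it as an equation only if its two parts are marked as terms. -/
def Congruent (c S : ℕ) : Prop :=
  BAll (c + 1) fun m => BAll (c + 1) fun m' =>
    Impl (opCode m = opCode m' ∧ leftCode m = leftCode m' ∧
      ArgsSame S (rightCode m) (rightCode m'))
    (Impl (opCode m = 1) (Same S m m') ∧ Impl (opCode m = 2) (Impl (Tr S m) (Tr S m')))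

def TruthOK (c S : ℕ) : Prop :=
  BAll (c + 1) fun m => Impl (opCode m = 0) (¬ Tr S m) ∧
    Impl (opCode m = 1 ∧ Tm S (leftCode m) ∧ Tm S (rightCode m))
      (Tr S m ↔ Same S (leftCode m) (rightCode m)) ∧
    Impl (opCode m = 2 ∧ leftCode m = 0 ∧ natListLen (rightCode m) = 2)
      (Tr S m ↔ Le S (natListGet (rightCode m) 0) (natListGet (rightCode m) 1)) ∧
    Impl (opCode m = 3) (Tr S m ↔ Impl (Tr S (leftCode m)) (Tr S (rightCode m)))

def IsCertificate (c S : ℕ) : Prop :=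
  IsOrder c S ∧ WellFormed c S ∧ Congruent c S ∧ TruthOK c S ∧ Fm S c ∧ Tr S c

/-- There is a certificate for the satisfiability of the constraint system with code `c`. -/
def Exists (c : ℕ) : Prop :=
  BEx (2 ^ Nat.pair 4 (Nat.pair (c + 1) (c + 1))) fun S => IsCertificate c S

section Primrec

variable {α : Type*} [Primcodable α] {f g h : α → ℕ}

@[fun_prop] theorem fun_le (hf : Primrec f) (hg : Primrec g) (hh : Primrec h) :
    PrimrecPred fun a => Le (f a) (g a) (h a) := by unfold Le; fun_prop
@[fun_prop] theorem fun_tr (hf : Primrec f) (hg : Primrec g) :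
    PrimrecPred fun a => Tr (f a) (g a) := by unfold Tr; fun_prop
@[fun_prop] theorem fun_tm (hf : Primrec f) (hg : Primrec g) :
    PrimrecPred fun a => Tm (f a) (g a) := by unfold Tm; fun_prop
@[fun_prop] theorem fun_fm (hf : Primrec f) (hg : Primrec g) :
    PrimrecPred fun a => Fm (f a) (g a) := by unfold Fm; fun_prop
@[fun_prop] theorem fun_same (hf : Primrec f) (hg : Primrec g) (hh : Primrec h) :
    PrimrecPred fun a => Same (f a) (g a) (h a) := by unfold Same; fun_prop
@[fun_prop] theorem fun_argsSame (hf : Primrec f) (hg : Primrec g) (hh : Primrec h) :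
    PrimrecPred fun a => ArgsSame (f a) (g a) (h a) := by unfold ArgsSame; fun_prop
@[fun_prop] theorem fun_argsTm (hf : Primrec f) (hg : Primrec g) :
    PrimrecPred fun a => ArgsTm (f a) (g a) := by unfold ArgsTm; fun_prop
@[fun_prop] theorem fun_isOrder (hf : Primrec f) (hg : Primrec g) :
    PrimrecPred fun a => IsOrder (f a) (g a) := by unfold IsOrder; fun_prop
@[fun_prop] theorem fun_wellFormed (hf : Primrec f) (hg : Primrec g) :
    PrimrecPred fun a => WellFormed (f a) (g a) := by unfold WellFormed; fun_prop
@[fun_prop] theorem fun_congruent (hf : Primrec f) (hg : Primrec g) :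
    PrimrecPred fun a => Congruent (f a) (g a) := by unfold Congruent; fun_prop
@[fun_prop] theorem fun_truthOK (hf : Primrec f) (hg : Primrec g) :
    PrimrecPred fun a => TruthOK (f a) (g a) := by unfold TruthOK; fun_prop
@[fun_prop] theorem fun_isCertificate (hf : Primrec f) (hg : Primrec g) :
    PrimrecPred fun a => IsCertificate (f a) (g a) := by unfold IsCertificate; fun_prop

theorem exists_primrecPred : PrimrecPred Exists := by
  unfold Exists; fun_prop

end Primrec

/-! ### From certificates to models -/

theorem argCode_lt {m : ℕ} (h : opCode m ≠ 0) : argCode m < m := by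
  conv_rhs => rw [← Nat.pair_unpair m]
  exact (Nat.right_le_pair 0 _).trans_lt (Nat.pair_lt_pair_left _ (Nat.pos_of_ne_zero h))

theorem leftCode_lt {m : ℕ} (h : opCode m ≠ 0) : leftCode m < m :=
  (Nat.unpair_left_le _).trans_lt (argCode_lt h)

theorem rightCode_lt {m : ℕ} (h : opCode m ≠ 0) : rightCode m < m :=
  (Nat.unpair_right_le _).trans_lt (argCode_lt h)

theorem pair_opCode (m : ℕ) : Nat.pair (opCode m) (Nat.pair (leftCode m) (rightCode m)) = m := by
  simp [opCode, leftCode, rightCode]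

section Model

variable {c S : ℕ}

theorem exists_term (h : WellFormed c S) (m : ℕ) (hm : m < c + 1) (hT : Tm S m) :
    ∃ s : constraintLanguage.Term (Empty ⊕ Fin 0), termCode s = m := by
  induction m using Nat.strong_induction_on with
  | _ m ih =>
    obtain ⟨h1, h2⟩ := (h m hm).1 hT
    have hlt : ∀ i : Fin (natListLen (rightCode m)), natListGet (rightCode m) i < m := fun i =>
      (natListGet_lt i.2).trans (rightCode_lt (by omega))
    choose ts hts using fun i : Fin (natListLen (rightCode m)) =>
      ih _ (hlt i) ((hlt i).trans hm) (h2 i i.2)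
    refine ⟨.func (fnSymbol _ (leftCode m)) ts, ?_⟩
    rw [termCode_func, encode_ofFn_eq _ rfl hts, ← h1, fnIndex_fnSymbol]
    exact pair_opCode m

theorem exists_formula (h : WellFormed c S) (m : ℕ) (hm : m < c + 1) (hF : Fm S m) :
    ∃ σ : constraintLanguage.Sentence, σ.IsQF ∧ formulaCode σ = m := by
  induction m using Nat.strong_induction_on with
  | _ m ih =>
    rcases (h m hm).2 hF with rfl | ⟨h1, h2, h3⟩ | ⟨h1, h2⟩ | ⟨h1, h2, h3⟩
    · exact ⟨⊥, .falsum, rfl⟩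
    · have hl := leftCode_lt (m := m) (by omega)
      have hr := rightCode_lt (m := m) (by omega)
      obtain ⟨s, hs⟩ := exists_term h _ (hl.trans hm) h2
      obtain ⟨s', hs'⟩ := exists_term h _ (hr.trans hm) h3
      refine ⟨.equal s s', .of_isAtomic (.equal s s'), ?_⟩
      rw [formulaCode_equal, hs, hs', ← h1]
      exact pair_opCode m
    · have hlt : ∀ i : Fin (natListLen (rightCode m)), natListGet (rightCode m) i < m := fun i =>
        (natListGet_lt i.2).trans (rightCode_lt (by omega))
      choose ts hts using fun i : Fin (natListLen (rightCode m)) =>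
        exists_term h _ ((hlt i).trans hm) (h2 i i.2)
      refine ⟨.rel (relSymbol _ (leftCode m)) ts, .of_isAtomic (.rel _ _), ?_⟩
      rw [formulaCode_rel, encode_ofFn_eq _ rfl hts, ← h1, relIndex_relSymbol]
      exact pair_opCode m
    · have hl := leftCode_lt (m := m) (by omega)
      have hr := rightCode_lt (m := m) (by omega)
      obtain ⟨σ, hσ, hσ'⟩ := ih _ hl (hl.trans hm) h2
      obtain ⟨τ, hτ, hτ'⟩ := ih _ hr (hr.trans hm) h3
      refine ⟨.imp σ τ, .imp hσ hτ, ?_⟩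
      rw [formulaCode_imp, hσ', hτ', ← h1]
      exact pair_opCode m

/-- The numbers up to `c`, with the preorder that the certificate gives. -/
def Node (_ : IsOrder c S) : Type := {i : ℕ // i < c + 1}

instance (h : IsOrder c S) : Preorder (Node h) where
  le i j := Le S i.1 j.1
  le_refl i := (h i.1 i.2).1
  le_trans i j k h1 h2 := (h i.1 i.2).2 j.1 j.2 k.1 k.2 ⟨h1, h2⟩

/-- The universe of the model: the numbers up to `c`, up to equivalence. -/
def Univ (h : IsOrder c S) : Type := Antisymmetrization (Node h) (· ≤ ·)

instance (h : IsOrder c S) : PartialOrder (Univ h) :=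
  inferInstanceAs (PartialOrder (Antisymmetrization (Node h) (· ≤ ·)))

/-- The element of the model with code `i`. -/
def elt (h : IsOrder c S) (i : ℕ) : Univ h :=
  toAntisymmetrization (α := Node h) (· ≤ ·) ⟨i % (c + 1), Nat.mod_lt _ (Nat.succ_pos c)⟩

instance (h : IsOrder c S) : Nonempty (Univ h) := ⟨elt h 0⟩

theorem elt_le_iff (h : IsOrder c S) {i j : ℕ} (hi : i < c + 1) (hj : j < c + 1) :
    elt h i ≤ elt h j ↔ Le S i j := by
  have h1 : elt h i ≤ elt h j ↔ Le S (i % (c + 1)) (j % (c + 1)) :=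
    toAntisymmetrization_le_toAntisymmetrization_iff
  rw [h1, Nat.mod_eq_of_lt hi, Nat.mod_eq_of_lt hj]

theorem elt_eq_iff (h : IsOrder c S) {i j : ℕ} (hi : i < c + 1) (hj : j < c + 1) :
    elt h i = elt h j ↔ Same S i j := by
  rw [le_antisymm_iff, elt_le_iff h hi hj, elt_le_iff h hj hi, Same]

open Classical in
-- A symbol is interpreted through any code up to `c` whose arguments represent the given tuple;
-- congruence makes the choice immaterial. Tuples without such a code get the default value `elt h
-- 0`, respectively falsity, and the symbol for `≤` gets the quotient order.
noncomputable instance structureOf (h : IsOrder c S) : constraintLanguage.Structure (Univ h) where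
  funMap {k} f x :=
    if hex : ∃ m < c + 1, opCode m = 1 ∧ leftCode m = fnIndex f ∧
      natListLen (rightCode m) = k ∧ ∀ i : Fin k, elt h (natListGet (rightCode m) i) = x i
    then elt h hex.choose else elt h 0
  RelMap {k} R x :=
    if hk : k = 2 ∧ relIndex R = 0 then x ⟨0, by omega⟩ ≤ x ⟨1, by omega⟩
    else ∃ m < c + 1, opCode m = 2 ∧ leftCode m = relIndex R ∧
      natListLen (rightCode m) = k ∧ (∀ i : Fin k, elt h (natListGet (rightCode m) i) = x i) ∧
      Tr S m

instance (h : IsOrder c S) : constraintLanguage.OrderedStructure (Univ h) where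
  relMap_leSymb x := by
    exact Eq.to_iff (dif_pos (⟨rfl, rfl⟩ : 2 = 2 ∧ relIndex (Language.leSymb (L := constraintLanguage)) = 0))

theorem argsSame_of_elt_eq (h : IsOrder c S) {m m' : ℕ} (hm : m < c + 1) (hm' : m' < c + 1)
    (hop : opCode m ≠ 0) (hop' : opCode m' ≠ 0)
    (hlen : natListLen (rightCode m) = natListLen (rightCode m'))
    (hx : ∀ i < natListLen (rightCode m), elt h (natListGet (rightCode m) i) =
      elt h (natListGet (rightCode m') i)) : ArgsSame S (rightCode m) (rightCode m') := by
  refine ⟨hlen, fun i hi => (elt_eq_iff h ?_ ?_).1 (hx i hi)⟩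
  · exact (natListGet_lt hi).trans ((rightCode_lt hop).trans hm)
  · exact (natListGet_lt (hlen ▸ hi)).trans ((rightCode_lt hop').trans hm')

/-- The code of the term is one candidate for the choice in `structureOf`, and congruence identifies
it with the candidate that was chosen. -/
theorem realize_term_eq (h : IsOrder c S) (hcong : Congruent c S)
    (s : constraintLanguage.Term (Empty ⊕ Fin 0)) (v : Empty ⊕ Fin 0 → Univ h)
    (hs : termCode s < c + 1) : s.realize v = elt h (termCode s) := by
  induction s with
  | var a =>
    rcases a with a | a
    · exact a.elim
    · exact a.elim0
  | @func k f ts ih =>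
    have hlen : natListLen (Encodable.encode (List.ofFn fun i => termCode (ts i))) = k :=
      natListLen_ofFn _
    have hget : ∀ i : Fin k, natListGet (Encodable.encode
        (List.ofFn fun i => termCode (ts i))) i = termCode (ts i) := natListGet_ofFn _
    rw [Language.Term.realize_func]
    rw [termCode_func] at hs ⊢
    set m := Nat.pair 1 (Nat.pair (fnIndex f)
      (Encodable.encode (List.ofFn fun i => termCode (ts i)))) with hm
    have hop : opCode m = 1 := opCode_pair _ _
    have hleft : leftCode m = fnIndex f := leftCode_pair _ _ _
    have hright : rightCode m = Encodable.encode (List.ofFn fun i => termCode (ts i)) :=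
      rightCode_pair _ _ _
    have hargs : ∀ i : Fin k, elt h (natListGet (rightCode m) i) = (ts i).realize v := by
      intro i
      have hlt : natListGet (rightCode m) i < m :=
        (natListGet_lt (by rw [hright, hlen]; exact i.2)).trans (rightCode_lt (by omega))
      rw [hright, hget] at hlt
      rw [ih i (hlt.trans hs), hright, hget]
    have hex : ∃ m < c + 1, opCode m = 1 ∧ leftCode m = fnIndex f ∧
        natListLen (rightCode m) = k ∧ ∀ i : Fin k, elt h (natListGet (rightCode m) i) =
          (ts i).realize v := ⟨m, hs, hop, hleft, by rw [hright, hlen], hargs⟩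
    refine (dif_pos hex).trans ?_
    obtain ⟨h1, h2, h3, h4, h5⟩ := hex.choose_spec
    rw [elt_eq_iff h h1 hs]
    refine (hcong _ h1 _ hs ⟨h2.trans hop.symm, h3.trans hleft.symm,
      argsSame_of_elt_eq h h1 hs (by omega) (by omega) ?_ fun i hi => ?_⟩).1 h2
    · rw [h4, hright, hlen]
    · rw [h4] at hi
      exact (h5 ⟨i, hi⟩).trans (hargs ⟨i, hi⟩).symm

theorem realize_formula_iff (h : IsOrder c S) (hcong : Congruent c S) (htr : TruthOK c S)
    (hwf : WellFormed c S) {σ : constraintLanguage.Sentence} (hσ : σ.IsQF)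
    (v : Empty → Univ h) (xs : Fin 0 → Univ h) (hlt : formulaCode σ < c + 1)
    (hF : Fm S (formulaCode σ)) :
    Language.BoundedFormula.Realize σ v xs ↔ Tr S (formulaCode σ) := by
  induction hσ with
  | falsum => exact iff_of_false (fun h => h) ((htr _ hlt).1 (opCode_pair 0 0))
  | of_isAtomic ha =>
    cases ha with
    | equal s s' =>
      change formulaCode (.equal s s') < c + 1 at hlt
      change Fm S (formulaCode (.equal s s')) at hF
      change _ ↔ Tr S (formulaCode (.equal s s'))
      rw [formulaCode_equal] at hlt hF ⊢
      set m := Nat.pair 1 (Nat.pair (termCode s) (termCode s')) with hm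
      have hop : opCode m = 1 := opCode_pair _ _
      have hl : leftCode m = termCode s := leftCode_pair _ _ _
      have hr : rightCode m = termCode s' := rightCode_pair _ _ _
      have h1 : Tm S (leftCode m) ∧ Tm S (rightCode m) := by
        rcases (hwf m hlt).2 hF with h0 | ⟨-, h1⟩ | ⟨h1, -⟩ | ⟨h1, -⟩
        · rw [h0] at hop; simp [opCode] at hop
        · exact h1
        · omega
        · omega
      have hl' := (leftCode_lt (m := m) (by omega)).trans hlt
      have hr' := (rightCode_lt (m := m) (by omega)).trans hlt
      have h2 := (htr m hlt).2.1 ⟨hop, h1⟩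
      rw [hl] at hl' h2
      rw [hr] at hr' h2
      rw [h2, Language.BoundedFormula.realize_bdEqual, realize_term_eq h hcong _ _ hl',
        realize_term_eq h hcong _ _ hr', elt_eq_iff h hl' hr']
    | @rel k R ts =>
      change formulaCode (.rel R ts) < c + 1 at hlt
      change _ ↔ Tr S (formulaCode (.rel R ts))
      rw [formulaCode_rel] at hlt ⊢
      have hlen : natListLen (Encodable.encode (List.ofFn fun i => termCode (ts i))) = k :=
        natListLen_ofFn _
      have hget : ∀ i : Fin k, natListGet (Encodable.encode
          (List.ofFn fun i => termCode (ts i))) i = termCode (ts i) := natListGet_ofFn _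
      set m := Nat.pair 2 (Nat.pair (relIndex R)
        (Encodable.encode (List.ofFn fun i => termCode (ts i)))) with hm
      have hop : opCode m = 2 := opCode_pair _ _
      have hleft : leftCode m = relIndex R := leftCode_pair _ _ _
      have hright : rightCode m = Encodable.encode (List.ofFn fun i => termCode (ts i)) :=
        rightCode_pair _ _ _
      have hltk : ∀ i < k, natListGet (rightCode m) i < c + 1 := fun i hi =>
        (natListGet_lt (by rw [hright, hlen]; exact hi)).trans
          ((rightCode_lt (by omega)).trans hlt)
      have hargs : ∀ i : Fin k, elt h (natListGet (rightCode m) i) =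
          (ts i).realize (Sum.elim v xs) := by
        intro i
        have := hltk i i.2
        rw [hright, hget] at this
        rw [realize_term_eq h hcong _ _ this, hright, hget]
      rw [Language.BoundedFormula.realize_rel]
      by_cases hk : k = 2 ∧ relIndex R = 0
      · refine (Eq.to_iff (dif_pos hk)).trans ?_
        obtain ⟨rfl, hR⟩ := hk
        rw [(htr m hlt).2.2.1 ⟨hop, hleft.trans hR, by rw [hright, hlen]⟩,
          ← elt_le_iff h (hltk 0 (by norm_num)) (hltk 1 (by norm_num))]
        exact (congrArg₂ (· ≤ ·) (hargs 0) (hargs 1)).symm.to_iff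
      · refine (Eq.to_iff (dif_neg hk)).trans ?_
        constructor
        · rintro ⟨m', h1, h2, h3, h4, h5, h6⟩
          refine (hcong m' h1 m hlt ⟨h2.trans hop.symm, h3.trans hleft.symm,
            argsSame_of_elt_eq h h1 hlt (by omega) (by omega) ?_ fun i hi => ?_⟩).2 h2 h6
          · rw [h4, hright, hlen]
          · rw [h4] at hi
            exact (h5 ⟨i, hi⟩).trans (hargs ⟨i, hi⟩).symm
        · intro h1
          exact ⟨m, hlt, hop, hleft, by rw [hright, hlen], hargs, h1⟩
  | @imp σ τ hσ hτ ihσ ihτ =>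
    rw [formulaCode_imp] at hlt hF ⊢
    set m := Nat.pair 3 (Nat.pair (formulaCode σ) (formulaCode τ)) with hm
    have hop : opCode m = 3 := opCode_pair _ _
    have hl : leftCode m = formulaCode σ := leftCode_pair _ _ _
    have hr : rightCode m = formulaCode τ := rightCode_pair _ _ _
    have h1 : Fm S (leftCode m) ∧ Fm S (rightCode m) := by
      rcases (hwf m hlt).2 hF with h0 | ⟨h1, -⟩ | ⟨h1, -⟩ | ⟨-, h1⟩
      · rw [h0] at hop; simp [opCode] at hop
      · omega
      · omega
      · exact h1
    have hl' := (leftCode_lt (m := m) (by omega)).trans hlt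
    have hr' := (rightCode_lt (m := m) (by omega)).trans hlt
    have h2 := (htr m hlt).2.2.2 hop
    rw [hl] at hl' h2 h1
    rw [hr] at hr' h2 h1
    rw [h2, Language.BoundedFormula.realize_imp]
    exact imp_congr (ihσ hl' h1.1) (ihτ hr' h1.2)

theorem exists_satisfiable (h : IsCertificate c S) :
    ∃ C : ConstraintSystem, C.code = c ∧ C.Satisfiable := by
  obtain ⟨h1, h2, h3, h4, h5, h6⟩ := h
  obtain ⟨σ, hσ, hc⟩ := exists_formula h2 c (Nat.lt_succ_self c) h5
  refine ⟨⟨σ, hσ⟩, hc, ConstraintSystem.satisfiable_of_model _ (Univ h1) ?_⟩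
  have := realize_formula_iff h1 h3 h4 h2 hσ default default (by omega) (by rwa [hc])
  rw [hc] at this
  exact this.2 h6

end Model

end Certificate

/-! ### From models to certificates -/

theorem relMap_le_iff (M : Type) [constraintLanguage.Structure M] [PartialOrder M]
    [constraintLanguage.OrderedStructure M] (x y : M) :
    Language.Structure.RelMap (relSymbol 2 0) ![x, y] ↔ x ≤ y :=
  Language.relMap_leSymb (L := constraintLanguage) ![x, y]

namespace Certificate

section Eval

variable (M : Type) [constraintLanguage.Structure M] [Nonempty M]

open Classical in
/-- The value of the closed term with code `m`. -/
noncomputable def evalCode (m : ℕ) : M :=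
  if _h : opCode m = 1 then
    Language.Structure.funMap (fnSymbol (natListLen (rightCode m)) (leftCode m))
      fun i => evalCode (natListGet (rightCode m) i)
  else Classical.arbitrary M
termination_by m
decreasing_by exact (natListGet_lt i.2).trans (rightCode_lt (by omega))

/-- The value of the relational atom with code `m`. -/
def RelCode (m : ℕ) : Prop :=
  Language.Structure.RelMap (relSymbol (natListLen (rightCode m)) (leftCode m))
    fun i => evalCode M (natListGet (rightCode m) i)

/-- The truth value of the quantifier-free sentence with code `m`. -/
def HoldsCode (m : ℕ) : Prop :=
  (opCode m = 1 ∧ evalCode M (leftCode m) = evalCode M (rightCode m)) ∨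
  (opCode m = 2 ∧ RelCode M m) ∨
  ∃ _ : opCode m = 3, (HoldsCode (leftCode m) → HoldsCode (rightCode m))
termination_by m
decreasing_by
  · exact leftCode_lt (by omega)
  · exact rightCode_lt (by omega)

theorem evalCode_eq {m : ℕ} (h : opCode m = 1) :
    evalCode M m = Language.Structure.funMap (fnSymbol (natListLen (rightCode m)) (leftCode m))
      fun i => evalCode M (natListGet (rightCode m) i) := by
  rw [evalCode, dif_pos h]

theorem not_holdsCode {m : ℕ} (h : opCode m = 0) : ¬ HoldsCode M m := by
  rw [HoldsCode]; simp [h]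

theorem holdsCode_equal {m : ℕ} (h : opCode m = 1) :
    HoldsCode M m ↔ evalCode M (leftCode m) = evalCode M (rightCode m) := by
  rw [HoldsCode]; simp [h]

theorem holdsCode_rel {m : ℕ} (h : opCode m = 2) : HoldsCode M m ↔ RelCode M m := by
  rw [HoldsCode]; simp [h]

theorem holdsCode_imp {m : ℕ} (h : opCode m = 3) :
    HoldsCode M m ↔ (HoldsCode M (leftCode m) → HoldsCode M (rightCode m)) := by
  rw [HoldsCode]; simp [h]

theorem evalCode_termCode (s : constraintLanguage.Term (Empty ⊕ Fin 0))
    (v : Empty ⊕ Fin 0 → M) : evalCode M (termCode s) = s.realize v := by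
  induction s with
  | var a =>
    rcases a with a | a
    · exact a.elim
    · exact a.elim0
  | @func k f ts ih =>
    rw [termCode_func, evalCode_eq M (opCode_pair _ _), Language.Term.realize_func,
      leftCode_pair, rightCode_pair]
    refine funMap_congr (natListLen_ofFn _) _ fun i _ h2 => ?_
    rw [← ih]
    exact congrArg _ (natListGet_ofFn (fun i => termCode (ts i)) ⟨i, h2⟩)

theorem holdsCode_formulaCode {σ : constraintLanguage.Sentence} (hσ : σ.IsQF)
    (v : Empty → M) (xs : Fin 0 → M) :
    HoldsCode M (formulaCode σ) ↔ Language.BoundedFormula.Realize σ v xs := by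
  induction hσ with
  | falsum => exact iff_of_false (not_holdsCode M (opCode_pair 0 0)) fun h => h
  | of_isAtomic ha =>
    cases ha with
    | equal s s' =>
      refine (holdsCode_equal M (m := formulaCode (.equal s s')) (opCode_pair _ _)).trans ?_
      rw [formulaCode_equal, leftCode_pair, rightCode_pair,
        Language.BoundedFormula.realize_bdEqual, evalCode_termCode, evalCode_termCode]
    | @rel k R ts =>
      refine (holdsCode_rel M (m := formulaCode (.rel R ts)) (opCode_pair _ _)).trans ?_
      rw [formulaCode_rel, RelCode, leftCode_pair, rightCode_pair,
        Language.BoundedFormula.realize_rel]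
      refine relMap_congr (natListLen_ofFn _) _ fun i _ h2 => ?_
      rw [← evalCode_termCode M (ts ⟨i, h2⟩)]
      exact congrArg _ (natListGet_ofFn (fun i => termCode (ts i)) ⟨i, h2⟩)
  | imp hσ hτ ihσ ihτ =>
    refine (holdsCode_imp M (opCode_pair _ _)).trans ?_
    rw [leftCode_pair, rightCode_pair, ihσ, ihτ]
    rfl

end Eval

theorem natListGet_termCode_ofFn {k : ℕ} (ts : Fin k → constraintLanguage.Term (Empty ⊕ Fin 0))
    {i : ℕ} (hi : i < natListLen (Encodable.encode (List.ofFn fun i => termCode (ts i)))) :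
    ∃ s : constraintLanguage.Term (Empty ⊕ Fin 0),
      termCode s = natListGet (Encodable.encode (List.ofFn fun i => termCode (ts i))) i := by
  rw [natListLen_ofFn] at hi
  exact ⟨ts ⟨i, hi⟩, (natListGet_ofFn (fun i => termCode (ts i)) ⟨i, hi⟩).symm⟩

/-- The certificate records the order of values and the truth values in `M`. Since `evalCode` and
`HoldsCode` are defined for all numbers, the closure conditions also hold at numbers that code
nothing. -/
theorem exists_of_model (C : ConstraintSystem) (M : Type) [Nonempty M] [PartialOrder M]
    [constraintLanguage.Structure M] [constraintLanguage.OrderedStructure M] (h : M ⊨ C.1) :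
    Exists C.code := by
  set c := C.code with hc
  obtain ⟨S, hS, hbit⟩ := exists_bitset (Nat.pair 4 (Nat.pair (c + 1) (c + 1))) fun j =>
    (j.unpair.1 = 0 ∧ evalCode M j.unpair.2.unpair.1 ≤ evalCode M j.unpair.2.unpair.2) ∨
    (j.unpair.1 = 1 ∧ HoldsCode M j.unpair.2) ∨
    (j.unpair.1 = 2 ∧ ∃ s : constraintLanguage.Term (Empty ⊕ Fin 0), termCode s = j.unpair.2) ∨
    (j.unpair.1 = 3 ∧ ∃ σ : constraintLanguage.Sentence, σ.IsQF ∧ formulaCode σ = j.unpair.2)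
  have hbound : ∀ i < 4, ∀ m < c + 1,
      Nat.pair i m < Nat.pair 4 (Nat.pair (c + 1) (c + 1)) := fun i hi m hm =>
    Instance.pair_lt_pair hi (hm.trans_le (Nat.left_le_pair _ _))
  have hLe : ∀ i < c + 1, ∀ j < c + 1, (Le S i j ↔ evalCode M i ≤ evalCode M j) := by
    intro i hi j hj
    have := Instance.pair_lt_pair (a := 0) (c := 4) (by norm_num)
      (Instance.pair_lt_pair hi hj)
    simp [Le, hbit, this]
  have hTr : ∀ m < c + 1, (Tr S m ↔ HoldsCode M m) := by
    intro m hm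
    simp [Tr, hbit, hbound 1 (by norm_num) m hm]
  have hTm : ∀ m < c + 1, (Tm S m ↔
      ∃ s : constraintLanguage.Term (Empty ⊕ Fin 0), termCode s = m) := by
    intro m hm
    simp [Tm, hbit, hbound 2 (by norm_num) m hm]
  have hFm : ∀ m < c + 1, (Fm S m ↔
      ∃ σ : constraintLanguage.Sentence, σ.IsQF ∧ formulaCode σ = m) := by
    intro m hm
    simp [Fm, hbit, hbound 3 (by norm_num) m hm]
  have hSame : ∀ i < c + 1, ∀ j < c + 1, (Same S i j ↔ evalCode M i = evalCode M j) := by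
    intro i hi j hj
    rw [Same, hLe i hi j hj, hLe j hj i hi, ← le_antisymm_iff]
  have hArg : ∀ m < c + 1, opCode m ≠ 0 → ∀ i < natListLen (rightCode m),
      natListGet (rightCode m) i < c + 1 := fun m hm h0 i hi =>
    (natListGet_lt hi).trans ((rightCode_lt h0).trans hm)
  have hArgsTm : ∀ m < c + 1, opCode m ≠ 0 → ∀ {k : ℕ}
      (ts : Fin k → constraintLanguage.Term (Empty ⊕ Fin 0)),
      rightCode m = Encodable.encode (List.ofFn fun i => termCode (ts i)) →
      ArgsTm S (rightCode m) := by
    intro m hm h0 k ts hts i hi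
    rw [hTm _ (hArg m hm h0 i hi)]
    rw [hts] at hi ⊢
    exact natListGet_termCode_ofFn ts hi
  have hl : ∀ m < c + 1, opCode m ≠ 0 → leftCode m < c + 1 :=
    fun m hm h0 => (leftCode_lt h0).trans hm
  have hr : ∀ m < c + 1, opCode m ≠ 0 → rightCode m < c + 1 :=
    fun m hm h0 => (rightCode_lt h0).trans hm
  refine ⟨S, hS, ?_, ?_, ?_, ?_, ?_, ?_⟩
  · intro i hi
    refine ⟨(hLe i hi i hi).2 le_rfl, fun j hj k hk hjk => ?_⟩
    rw [hLe i hi j hj, hLe j hj k hk] at hjk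
    exact (hLe i hi k hk).2 (hjk.1.trans hjk.2)
  · intro m hm
    constructor
    · intro h1
      obtain ⟨s, rfl⟩ := (hTm m hm).1 h1
      rcases s with (a | a) | ⟨f, ts⟩
      · exact a.elim
      · exact a.elim0
      · have hop : opCode (termCode (.func f ts)) = 1 := opCode_pair _ _
        exact ⟨hop, hArgsTm _ hm (by omega) ts (rightCode_pair _ _ _)⟩
    · intro h1
      obtain ⟨σ, hσ, rfl⟩ := (hFm m hm).1 h1
      cases hσ with
      | falsum => exact .inl rfl
      | of_isAtomic ha =>
        cases ha with
        | equal s s' =>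
          have hop : opCode (formulaCode (.equal s s')) = 1 := opCode_pair _ _
          refine .inr (.inl ⟨hop, ?_, ?_⟩)
          · exact (hTm _ (hl _ hm (by rw [Language.Term.bdEqual, hop]; simp))).2
              ⟨s, (leftCode_pair _ _ _).symm⟩
          · exact (hTm _ (hr _ hm (by rw [Language.Term.bdEqual, hop]; simp))).2
              ⟨s', (rightCode_pair _ _ _).symm⟩
        | rel R ts =>
          have hop : opCode (formulaCode (.rel R ts)) = 2 := opCode_pair _ _
          exact .inr (.inr (.inl ⟨hop, hArgsTm _ hm (by rw [Language.Relations.boundedFormula, hop]; simp) ts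
            (rightCode_pair _ _ _)⟩))
      | @imp σ τ hσ hτ =>
        have hop : opCode (formulaCode (σ.imp τ)) = 3 := opCode_pair _ _
        refine .inr (.inr (.inr ⟨hop, ?_, ?_⟩))
        · exact (hFm _ (hl _ hm (by omega))).2 ⟨σ, hσ, (leftCode_pair _ _ _).symm⟩
        · exact (hFm _ (hr _ hm (by omega))).2 ⟨τ, hτ, (rightCode_pair _ _ _).symm⟩
  · rintro m hm m' hm' ⟨h1, h2, h3, h4⟩
    have hargs : opCode m ≠ 0 → ∀ i (_ : i < natListLen (rightCode m))
        (_ : i < natListLen (rightCode m')), evalCode M (natListGet (rightCode m) i) =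
          evalCode M (natListGet (rightCode m') i) := fun h0 i hi hi' =>
      (hSame _ (hArg m hm h0 i hi) _ (hArg m' hm' (h1 ▸ h0) i hi')).1 (h4 i hi)
    constructor
    · intro h0
      rw [hSame m hm m' hm', evalCode_eq M h0, evalCode_eq M (h1 ▸ h0), h2]
      exact funMap_congr h3 _ (hargs (by omega))
    · intro h0 h5
      rw [hTr m hm, holdsCode_rel M h0, RelCode] at h5
      rw [hTr m' hm', holdsCode_rel M (h1 ▸ h0), RelCode, ← h2]
      exact (relMap_congr h3 _ (hargs (by omega))).1 h5
  · intro m hm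
    refine ⟨fun h0 => ?_, fun ⟨h1, _⟩ => ?_, fun ⟨h1, h2, h3⟩ => ?_, fun h1 => ?_⟩
    · rw [hTr m hm]
      exact not_holdsCode M h0
    · rw [hTr m hm, holdsCode_equal M h1, hSame _ (hl m hm (by omega)) _ (hr m hm (by omega))]
    · rw [hTr m hm, holdsCode_rel M h1, RelCode, h2,
        hLe _ (hArg m hm (by omega) 0 (by omega)) _ (hArg m hm (by omega) 1 (by omega)),
        ← relMap_le_iff]
      refine relMap_congr h3 _ fun i _ hi => ?_
      interval_cases i <;> rfl
    · rw [hTr m hm, holdsCode_imp M h1, hTr _ (hl m hm (by omega)), hTr _ (hr m hm (by omega))]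
      rfl
  · exact (hFm c (Nat.lt_succ_self c)).2 ⟨C.1, C.2, rfl⟩
  · exact (hTr c (Nat.lt_succ_self c)).2 ((holdsCode_formulaCode M C.2 default default).2 h)

end Certificate

/-- Satisfiability of constraint systems is decidable. -/
theorem satisfiable_computablePred :
    ComputablePred fun c : ℕ => ∃ C : ConstraintSystem, C.code = c ∧ C.Satisfiable := by
  refine (Certificate.exists_primrecPred.of_eq fun c => ?_).computablePred
  constructor
  · rintro ⟨S, -, hS⟩
    exact Certificate.exists_satisfiable hS
  · rintro ⟨C, rfl, ⟨M⟩⟩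
    obtain ⟨hT, hC⟩ := model_constraint_iff.1 M.is_model
    have : M ⊨ constraintLanguage.partialOrderTheory := hT
    -- The order of a solution is given only by the theory; here it becomes an instance for which
    -- the relation symbol is `≤`.
    let _ : PartialOrder M := constraintLanguage.partialOrderOfModels M
    have : constraintLanguage.OrderedStructure M :=
      ⟨fun x => by rw [← FinVec.etaExpand_eq x]; rfl⟩
    exact Certificate.exists_of_model C M hC

/-! ### The constraint system of an instance -/

namespace Instance

/-- The constant symbol with number `f`, as a term. -/
def constTerm (f : ℕ) : constraintLanguage.Term (Empty ⊕ Fin 0) := .func (fnSymbol 0 f) ![]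

/-- The term for the number `m`. -/
def numTerm (m : ℕ) : constraintLanguage.Term (Empty ⊕ Fin 0) := constTerm (2 * m)

/-- The atomic constraint with index `i`. -/
def atomConstraint (i : ℕ) : constraintLanguage.Sentence :=
  if i.unpair.1 = 0 then
    .equal (constTerm (2 * i.unpair.2.unpair.1 + 1)) (numTerm i.unpair.2.unpair.2)
  else if i.unpair.1 = 1 then
    .equal (.func (fnSymbol 2 i.unpair.2.unpair.1) ![numTerm i.unpair.2.unpair.2.unpair.1,
      numTerm i.unpair.2.unpair.2.unpair.2.unpair.1])
      (numTerm i.unpair.2.unpair.2.unpair.2.unpair.2)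
  else .rel (relSymbol 1 i.unpair.2.unpair.1) ![numTerm i.unpair.2.unpair.2]

open Classical in
/-- The literal at index `i` in the diagram `t`. -/
noncomputable def literal (t i : ℕ) : constraintLanguage.Sentence :=
  if Bit t i then atomConstraint i else (atomConstraint i).imp ⊥

/-- One of the first `n` literals of the diagram `t` fails. -/
noncomputable def refutation (t : ℕ) : ℕ → constraintLanguage.Sentence
  | 0 => ⊥
  | n + 1 => (literal t n).imp (refutation t n)

/-- A bound on the indices of the atomic constraints. -/
def indexBound (x : ℕ) : ℕ :=
  Nat.pair 3 (Nat.pair (valBound x) (Nat.pair (valBound x) (Nat.pair (valBound x) (valBound x))))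

open Classical in
/-- Some diagram `t < n` that solves the instance `x` holds. -/
noncomputable def disjunction (x : ℕ) : ℕ → constraintLanguage.Sentence
  | 0 => ⊥
  | n + 1 => if IsSolution x n then (refutation n (indexBound x)).imp (disjunction x n)
      else disjunction x n

theorem isQF_atomConstraint (i : ℕ) : (atomConstraint i).IsQF := by
  unfold atomConstraint
  split_ifs
  · exact .of_isAtomic (.equal _ _)
  · exact .of_isAtomic (.equal _ _)
  · exact .of_isAtomic (.rel _ _)

theorem isQF_literal (t i : ℕ) : (literal t i).IsQF := by
  unfold literal
  split_ifs
  · exact isQF_atomConstraint i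
  · exact .imp (isQF_atomConstraint i) .falsum

theorem isQF_refutation (t n : ℕ) : (refutation t n).IsQF := by
  induction n with
  | zero => exact .falsum
  | succ n ih => exact .imp (isQF_literal t n) ih

theorem isQF_disjunction (x n : ℕ) : (disjunction x n).IsQF := by
  induction n with
  | zero => exact .falsum
  | succ n ih =>
    unfold disjunction
    split_ifs
    · exact .imp (isQF_refutation _ _) ih
    · exact ih

/-- The constraint system of the instance `x`. -/
noncomputable def constraints (x : ℕ) : ConstraintSystem :=
  ⟨disjunction x (2 ^ indexBound x), isQF_disjunction _ _⟩

/-! The code of the constraint system is primitive recursive in the instance. -/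

def constCode (f : ℕ) : ℕ := Nat.pair 1 (Nat.pair f 0)

/-- The nested pairs with successors are the encodings of the one- and two-element argument lists;
the empty list has code `0`. -/
def atomCode (i : ℕ) : ℕ :=
  if i.unpair.1 = 0 then
    Nat.pair 1 (Nat.pair (constCode (2 * i.unpair.2.unpair.1 + 1))
      (constCode (2 * i.unpair.2.unpair.2)))
  else if i.unpair.1 = 1 then
    Nat.pair 1 (Nat.pair (Nat.pair 1 (Nat.pair i.unpair.2.unpair.1
      (Nat.pair (constCode (2 * i.unpair.2.unpair.2.unpair.1))
        (Nat.pair (constCode (2 * i.unpair.2.unpair.2.unpair.2.unpair.1)) 0 + 1) + 1)))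
      (constCode (2 * i.unpair.2.unpair.2.unpair.2.unpair.2)))
  else Nat.pair 2 (Nat.pair i.unpair.2.unpair.1
    (Nat.pair (constCode (2 * i.unpair.2.unpair.2)) 0 + 1))

open Classical in
noncomputable def literalCode (t i : ℕ) : ℕ :=
  if Bit t i then atomCode i else Nat.pair 3 (Nat.pair (atomCode i) 0)

noncomputable def refutationCode (t n : ℕ) : ℕ :=
  n.rec 0 fun i c => Nat.pair 3 (Nat.pair (literalCode t i) c)

open Classical in
noncomputable def disjunctionCode (x n : ℕ) : ℕ :=
  n.rec 0 fun t c =>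
    if IsSolution x t then Nat.pair 3 (Nat.pair (refutationCode t (indexBound x)) c) else c

theorem termCode_constTerm (f : ℕ) : termCode (constTerm f) = constCode f := by
  rw [constTerm, termCode_func]; simp [constCode]

theorem formulaCode_atomConstraint (i : ℕ) : formulaCode (atomConstraint i) = atomCode i := by
  unfold atomConstraint atomCode
  split_ifs
  · rw [formulaCode_equal, numTerm, termCode_constTerm, termCode_constTerm]
  · rw [formulaCode_equal, termCode_func]
    simp [numTerm, termCode_constTerm]
  · rw [formulaCode_rel]
    simp [numTerm, termCode_constTerm]

theorem formulaCode_literal (t i : ℕ) : formulaCode (literal t i) = literalCode t i := by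
  unfold literal literalCode
  split_ifs
  · exact formulaCode_atomConstraint i
  · rw [formulaCode_imp, formulaCode_atomConstraint]; rfl

theorem formulaCode_refutation (t n : ℕ) :
    formulaCode (refutation t n) = refutationCode t n := by
  induction n with
  | zero => rfl
  | succ n ih => rw [refutation, formulaCode_imp, formulaCode_literal, ih]; rfl

open Classical in
theorem formulaCode_disjunction (x n : ℕ) :
    formulaCode (disjunction x n) = disjunctionCode x n := by
  induction n with
  | zero => rfl
  | succ n ih =>
    have h : disjunctionCode x (n + 1) = if IsSolution x n then
      Nat.pair 3 (Nat.pair (refutationCode n (indexBound x)) (disjunctionCode x n))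
      else disjunctionCode x n := rfl
    rw [h, disjunction]
    split_ifs
    · rw [formulaCode_imp, formulaCode_refutation, ih]
    · exact ih

section Primrec

variable {α : Type*} [Primcodable α] {f g : α → ℕ}

@[fun_prop] theorem fun_constCode (hf : Primrec f) : Primrec fun a => constCode (f a) := by
  unfold constCode; fun_prop

@[fun_prop] theorem fun_indexBound (hf : Primrec f) : Primrec fun a => indexBound (f a) := by
  unfold indexBound; fun_prop

@[fun_prop] theorem fun_atomCode (hf : Primrec f) : Primrec fun a => atomCode (f a) :=
  Primrec.ite (by fun_prop) (by fun_prop) (Primrec.ite (by fun_prop) (by fun_prop) (by fun_prop))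

open Classical in
@[fun_prop] theorem fun_literalCode (hf : Primrec f) (hg : Primrec g) :
    Primrec fun a => literalCode (f a) (g a) :=
  Primrec.ite (by fun_prop) (by fun_prop) (by fun_prop)

@[fun_prop] theorem fun_refutationCode (hf : Primrec f) (hg : Primrec g) :
    Primrec fun a => refutationCode (f a) (g a) :=
  Primrec.nat_rec' (h := fun a p => Nat.pair 3 (Nat.pair (literalCode (f a) p.1) p.2)) hg
    (Primrec.const 0) (by unfold Primrec₂; fun_prop)

open Classical in
@[fun_prop] theorem fun_disjunctionCode (hf : Primrec f) (hg : Primrec g) :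
    Primrec fun a => disjunctionCode (f a) (g a) :=
  Primrec.nat_rec' (h := fun a p => if IsSolution (f a) p.1 then
    Nat.pair 3 (Nat.pair (refutationCode p.1 (indexBound (f a))) p.2) else p.2) hg
    (Primrec.const 0) (Primrec.ite (by fun_prop) (by fun_prop) (by fun_prop))

theorem primrec_code_constraints : Primrec fun x => (constraints x).code := by
  refine Primrec.of_eq (f := fun x => disjunctionCode x (2 ^ indexBound x)) (by fun_prop)
    fun x => ?_
  exact (formulaCode_disjunction _ _).symm

end Primrec

/-! The meaning of the constraint system. -/

section Semantics

variable (M : Type) [constraintLanguage.Structure M]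

theorem realize_numTerm (m : ℕ) (v : Empty ⊕ Fin 0 → M) :
    (numTerm m).realize v = numeral M m := by
  rw [numTerm, constTerm, Language.Term.realize_func]
  exact funMap_congr rfl _ fun i h => absurd h (Nat.not_lt_zero i)

theorem model_atomConstraint_init (p s : ℕ) :
    M ⊨ atomConstraint (initIdx p s) ↔ initSymbol M p = numeral M s := by
  have h : atomConstraint (initIdx p s) = .equal (constTerm (2 * p + 1)) (numTerm s) := by
    simp [atomConstraint, initIdx]
  rw [h]
  refine (Language.BoundedFormula.realize_bdEqual _ _).trans ?_
  rw [realize_numTerm, constTerm, Language.Term.realize_func]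
  refine Eq.congr (funMap_congr rfl _ fun i h => absurd h (Nat.not_lt_zero i)) rfl

theorem model_atomConstraint_step (p s u s' : ℕ) :
    M ⊨ atomConstraint (stepIdx p s u s') ↔
      stepSymbol M p (numeral M s) (numeral M u) = numeral M s' := by
  have h : atomConstraint (stepIdx p s u s') =
      .equal (.func (fnSymbol 2 p) ![numTerm s, numTerm u]) (numTerm s') := by
    simp [atomConstraint, stepIdx]
  rw [h]
  refine (Language.BoundedFormula.realize_bdEqual _ _).trans ?_
  rw [realize_numTerm, Language.Term.realize_func]
  refine Eq.congr (funMap_congr rfl _ fun i h1 _ => ?_) rfl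
  interval_cases i <;> exact realize_numTerm M _ _

theorem model_atomConstraint_label (o s : ℕ) :
    M ⊨ atomConstraint (labelIdx o s) ↔ labelSymbol M o (numeral M s) := by
  have h : atomConstraint (labelIdx o s) = .rel (relSymbol 1 o) ![numTerm s] := by
    simp [atomConstraint, labelIdx]
  rw [h]
  refine Language.BoundedFormula.realize_rel.trans ?_
  refine relMap_congr rfl _ fun i h1 _ => ?_
  interval_cases i
  exact realize_numTerm M _ _

/-- The true atomic constraints are those in the set `t`, up to the index `n`. -/
def Agrees (t n : ℕ) : Prop := ∀ i < n, Bit t i ↔ M ⊨ atomConstraint i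

theorem model_imp (σ τ : constraintLanguage.Sentence) : M ⊨ σ.imp τ ↔ (M ⊨ σ → M ⊨ τ) :=
  Language.BoundedFormula.realize_imp

theorem not_model_bot : ¬ M ⊨ (⊥ : constraintLanguage.Sentence) := fun h => h

theorem model_literal (t i : ℕ) :
    M ⊨ literal t i ↔ (Bit t i ↔ M ⊨ atomConstraint i) := by
  unfold literal
  split_ifs with h
  · simp [h]
  · rw [model_imp]
    simp [h]

theorem model_refutation (t n : ℕ) : M ⊨ refutation t n ↔ ¬ Agrees M t n := by
  induction n with
  | zero => exact iff_of_false (not_model_bot M) fun h => h fun i hi => absurd hi (Nat.not_lt_zero i)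
  | succ n ih =>
    rw [refutation, model_imp, ih, model_literal, Agrees, Agrees, Nat.forall_lt_succ_right]
    tauto

/-- The sentences are built from `⊥` and implication alone: refuting the description of a diagram
implies the disjunction of the remaining ones. -/
theorem model_disjunction (x n : ℕ) :
    M ⊨ disjunction x n ↔ ∃ t < n, IsSolution x t ∧ Agrees M t (indexBound x) := by
  induction n with
  | zero => exact iff_of_false (not_model_bot M) fun ⟨t, ht, _⟩ => Nat.not_lt_zero t ht
  | succ n ih =>
    rw [disjunction, Nat.exists_lt_succ_right, ← ih]
    split_ifs with h
    · rw [model_imp, model_refutation, and_iff_right h, or_comm, or_iff_not_imp_left]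
    · rw [or_iff_left fun h' => h h'.1]

theorem model_constraints (x : ℕ) : M ⊨ (constraints x).1 ↔
    ∃ t < 2 ^ indexBound x, IsSolution x t ∧ Agrees M t (indexBound x) :=
  model_disjunction M x _

end Semantics

attribute [irreducible] constraints

/-! ### Structures that represent families -/

section Represents

variable {φ ψ : PromptLTL} {A : Architecture} {b : Fin A.n → ℕ}

theorem lt_valBound {x m : ℕ} (h : m ≤ x) : m < valBound x :=
  (show m < codeBound x by unfold codeBound; omega).trans Nat.lt_two_pow_self

theorem procs_lt_valBound (p : Fin A.n) : (p : ℕ) < valBound (instanceCode φ ψ A b) :=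
  lt_valBound <| p.2.le.trans <| by
    rw [← procs_instanceCode (φ := φ) (ψ := ψ) (A := A) (b := b)]; exact procs_le _

theorem state_lt_valBound {p : Fin A.n} (s : Fin (b p)) :
    (s : ℕ) < valBound (instanceCode φ ψ A b) :=
  lt_valBound <| s.2.le.trans <| by
    rw [← size_instanceCode (φ := φ) (ψ := ψ) (A := A) (b := b)]; exact size_le _ _

theorem initIdx_lt {p : Fin A.n} (s : Fin (b p)) :
    initIdx p s < indexBound (instanceCode φ ψ A b) :=
  pair_lt_pair (by norm_num) (pair_lt_pair (procs_lt_valBound p)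
    ((state_lt_valBound s).trans_le (Nat.left_le_pair _ _)))

theorem stepIdx_lt {p : Fin A.n} (s : Fin (b p)) (υ : PropVal (A.asyncInp p)) (s' : Fin (b p)) :
    stepIdx p s υ.code s' < indexBound (instanceCode φ ψ A b) :=
  pair_lt_pair (by norm_num) (pair_lt_pair (procs_lt_valBound p) (pair_lt_pair
    (state_lt_valBound s) (pair_lt_pair (isVal_code p υ).1 (state_lt_valBound s'))))

theorem labelIdx_lt {p : Fin A.n} (s : Fin (b p)) {o : ℕ} (ho : o ∈ A.out (some p)) :
    labelIdx o s < indexBound (instanceCode φ ψ A b) :=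
  pair_lt_pair (by norm_num) (pair_lt_pair (lt_valBound (((bit_out_instanceCode p o).2
    ho).lt_self.le.trans (out_le _ p))) ((state_lt_valBound s).trans_le (Nat.left_le_pair _ _)))

variable (M : Type) [constraintLanguage.Structure M]

theorem IsDiagram.represents {T : A.Family b} {t : ℕ} (h : IsDiagram T t)
    (hM : Agrees M t (indexBound (instanceCode φ ψ A b))) : Represents M T := by
  intro p
  obtain ⟨h1, h2, h3⟩ := h p
  refine ⟨?_, fun s υ => ?_, fun s o ho => ?_⟩
  · rw [← model_atomConstraint_init, ← hM _ (initIdx_lt _), h1]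
  · rw [← model_atomConstraint_step, ← hM _ (stepIdx_lt _ _ _), h2]
  · rw [← model_atomConstraint_label, ← hM _ (labelIdx_lt s ho), h3 s o ho]

/-- The numerals of a solution are not assumed to be distinct. Uniqueness of states comes from `t`
instead: a value named by a state of `T'` sets the corresponding bit of `t`, and `T` allows only one
such bit. -/
theorem IsDiagram.of_represents {T T' : A.Family b} {t : ℕ} (h : IsDiagram T t)
    (hM : Agrees M t (indexBound (instanceCode φ ψ A b))) (hT' : Represents M T') :
    IsDiagram T' t := by
  intro p
  obtain ⟨h1, h2, h3⟩ := h p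
  obtain ⟨h1', h2', h3'⟩ := hT' p
  refine ⟨fun s => ?_, fun s υ s' => ?_, fun s o ho => ?_⟩
  · rw [← model_atomConstraint_init, ← hM _ (initIdx_lt _), h1] at h1'
    rw [h1, h1']
  · have := h2' s υ
    rw [← model_atomConstraint_step, ← hM _ (stepIdx_lt _ _ _), h2] at this
    rw [h2, this]
  · rw [hM _ (labelIdx_lt s ho), model_atomConstraint_label, h3' s o ho]

theorem isDiagram_of_represents {T : A.Family b} {t : ℕ}
    (hinj : Function.Injective (numeral M))
    (hM : Agrees M t (indexBound (instanceCode φ ψ A b))) (hT : Represents M T) :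
    IsDiagram T t := by
  intro p
  obtain ⟨h1, h2, h3⟩ := hT p
  refine ⟨fun s => ?_, fun s υ s' => ?_, fun s o ho => ?_⟩
  · rw [hM _ (initIdx_lt _), model_atomConstraint_init, h1, hinj.eq_iff, Fin.val_inj, eq_comm]
  · rw [hM _ (stepIdx_lt _ _ _), model_atomConstraint_step, h2, hinj.eq_iff, Fin.val_inj, eq_comm]
  · rw [hM _ (labelIdx_lt s ho), model_atomConstraint_label, h3 s o ho]

theorem exists_diagram_of_model (h : M ⊨ (constraints (instanceCode φ ψ A b)).1) :
    ∃ (T : A.Family b) (t : ℕ), IsDiagram T t ∧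
      Agrees M t (indexBound (instanceCode φ ψ A b)) ∧ IsSolution (instanceCode φ ψ A b) t := by
  obtain ⟨t, -, ht, hM⟩ := (model_constraints M _).1 h
  obtain ⟨T, hT⟩ := exists_isDiagram ht.1
  exact ⟨T, t, hT, hM, ht⟩

theorem exists_represents (h : M ⊨ (constraints (instanceCode φ ψ A b)).1) :
    ∃ T : A.Family b, Represents M T :=
  have ⟨T, _, hT, hM, _⟩ := exists_diagram_of_model M h
  ⟨T, hT.represents M hM⟩

theorem realizes_of_represents (h : M ⊨ (constraints (instanceCode φ ψ A b)).1)
    {T : A.Family b} (hT : Represents M T) : A.Realizes T φ ψ :=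
  have ⟨_, _, hT', hM, ht⟩ := exists_diagram_of_model M h
  (isSolution_iff (hT'.of_represents M hM hT)).1 ht

/-- The diagram is the set of atomic constraints true in `M`; with distinct numerals it is a diagram
of `T`, so it passes the test and its description is a disjunct. -/
theorem model_constraints_of_realizes {T : A.Family b}
    (hinj : Function.Injective (numeral M)) (hT : Represents M T) (h : A.Realizes T φ ψ) :
    M ⊨ (constraints (instanceCode φ ψ A b)).1 := by
  obtain ⟨t, ht, hbit⟩ := exists_bitset (indexBound (instanceCode φ ψ A b))
    fun i => M ⊨ atomConstraint i
  have hM : Agrees M t (indexBound (instanceCode φ ψ A b)) := fun i hi => by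
    rw [hbit, and_iff_right hi]
  exact (model_constraints M _).2 ⟨t, ht,
    (isSolution_iff (isDiagram_of_represents M hinj hM hT)).2 h, hM⟩

end Represents

/-! ### The canonical structure of a family -/

theorem propVal_code_injective (I : Finset Atom) :
    Function.Injective (PropVal.code : PropVal I → ℕ) := by
  intro υ υ' h
  refine Subtype.ext (Finset.ext fun a => ?_)
  rw [← PropVal.bit_code, h, PropVal.bit_code]

section Canonical

variable {A : Architecture} {b : Fin A.n → ℕ}

/-- The natural numbers; the number `m` is represented by `m + 1`. -/
def Canonical (_ : A.Family b) : Type := ℕ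

instance (T : A.Family b) : PartialOrder (Canonical T) := inferInstanceAs (PartialOrder ℕ)

instance (T : A.Family b) : Nonempty (Canonical T) := inferInstanceAs (Nonempty ℕ)

/-- Where the family prescribes a value it is unique, so the choice operator returns it; elsewhere
the value is irrelevant. -/
noncomputable def canonicalFun (T : A.Family b) : (k : ℕ) → ℕ → (Fin k → ℕ) → ℕ
  | 0, f, _ => if f % 2 = 0 then f / 2 + 1 else
      Classical.epsilon fun y => ∃ q : Fin A.n, (q : ℕ) = f / 2 ∧ y = ((T q).init : ℕ) + 1
  | 2, f, x => Classical.epsilon fun y => ∃ (q : Fin A.n) (s : Fin (b q))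
      (υ : PropVal (A.asyncInp q)), (q : ℕ) = f ∧ x 0 = s + 1 ∧ x 1 = υ.code + 1 ∧
        y = ((T q).step s υ : ℕ) + 1
  | _, _, _ => 0

def canonicalRel (T : A.Family b) : (k : ℕ) → ℕ → (Fin k → ℕ) → Prop
  | 1, o, x => ∃ (q : Fin A.n) (s : Fin (b q)), x 0 = s + 1 ∧ o ∈ A.out (some q) ∧
      Atom.var o ∈ ((T q).label s).1
  | 2, R, x => R = 0 ∧ x 0 ≤ x 1
  | _, _, _ => False

noncomputable instance (T : A.Family b) : constraintLanguage.Structure (Canonical T) where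
  funMap {k} f x := canonicalFun T k f x
  RelMap {k} R x := canonicalRel T k R x

instance (T : A.Family b) : constraintLanguage.OrderedStructure (Canonical T) where
  relMap_leSymb _ := ⟨fun h => h.2, fun h => ⟨rfl, h⟩⟩

theorem numeral_canonical (T : A.Family b) (m : ℕ) :
    numeral (Canonical T) m = (m + 1 : ℕ) := by
  have h : numeral (Canonical T) m = canonicalFun T 0 (2 * m) ![] := rfl
  rw [h, canonicalFun, if_pos (by omega)]
  congr 1; omega

theorem numeral_canonical_injective (T : A.Family b) :
    Function.Injective (numeral (Canonical T)) := by
  intro m m' h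
  rw [numeral_canonical, numeral_canonical] at h
  exact Nat.succ_injective h

theorem represents_canonical (T : A.Family b) : Represents (Canonical T) T := by
  intro p
  refine ⟨?_, fun s υ => ?_, fun s o ho => ?_⟩
  · have h : initSymbol (Canonical T) p = canonicalFun T 0 (2 * p + 1) ![] := rfl
    rw [h, numeral_canonical, canonicalFun, if_neg (by omega)]
    obtain ⟨q, hq, hy⟩ := Classical.epsilon_spec
      (p := fun y => ∃ q : Fin A.n, (q : ℕ) = (2 * p + 1) / 2 ∧ y = ((T q).init : ℕ) + 1)
      ⟨_, p, by omega, rfl⟩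
    obtain rfl : q = p := Fin.ext (by omega)
    exact hy
  · have h : stepSymbol (Canonical T) p (numeral (Canonical T) s) (numeral (Canonical T) υ.code) =
        canonicalFun T 2 p ![(s + 1 : ℕ), (υ.code + 1 : ℕ)] := by
      rw [numeral_canonical, numeral_canonical]; rfl
    rw [h, numeral_canonical, canonicalFun]
    obtain ⟨q, s', υ', hq, hs, hυ, hy⟩ := Classical.epsilon_spec
      (p := fun y => ∃ (q : Fin A.n) (s' : Fin (b q)) (υ' : PropVal (A.asyncInp q)),
        (q : ℕ) = p ∧ ![(s + 1 : ℕ), (υ.code + 1 : ℕ)] 0 = s' + 1 ∧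
          ![(s + 1 : ℕ), (υ.code + 1 : ℕ)] 1 = υ'.code + 1 ∧ y = ((T q).step s' υ' : ℕ) + 1)
      ⟨_, p, s, υ, rfl, rfl, rfl, rfl⟩
    obtain rfl : q = p := Fin.ext hq
    obtain rfl : s = s' := Fin.ext (Nat.succ_injective hs)
    obtain rfl : υ = υ' := propVal_code_injective _ (Nat.succ_injective hυ)
    exact hy
  · have h : labelSymbol (Canonical T) o (numeral (Canonical T) s) ↔
        canonicalRel T 1 o ![(s + 1 : ℕ)] := by
      rw [numeral_canonical]; rfl
    rw [h]
    constructor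
    · rintro ⟨q, s', hs, hq, hl⟩
      -- A label symbol does not name its process; disjointness of the outputs determines it.
      obtain rfl : q = p := by
        by_contra hne
        exact Finset.disjoint_left.1 (A.out_disjoint (some q) (some p) (by simpa using hne)) hq ho
      obtain rfl : s = s' := Fin.ext (Nat.succ_injective hs)
      exact hl
    · exact fun hl => ⟨p, s, rfl, ho, hl⟩

end Canonical

variable {φ ψ : PromptLTL} {A : Architecture} {b : Fin A.n → ℕ}

theorem realizes_iff_exists_represents (T : A.Family b) : A.Realizes T φ ψ ↔
    ∃ M : (constraints (instanceCode φ ψ A b)).Solution, Represents M T := by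
  constructor
  · intro h
    have : Canonical T ⊨ constraintTheory ∪ {(constraints (instanceCode φ ψ A b)).1} :=
      model_constraint_iff.2 ⟨Language.model_partialOrder,
        model_constraints_of_realizes _ (numeral_canonical_injective T)
          (represents_canonical T) h⟩
    exact ⟨.of _ (Canonical T), represents_canonical T⟩
  · rintro ⟨M, hM⟩
    exact realizes_of_represents M (model_constraint_iff.1 M.is_model).2 hM

end Instance

/-! ### The main theorem -/

theorem mainTheorem2 :
    -- satisfiability of constraint systems is decidable
    ComputablePred (fun c : ℕ => ∃ C : ConstraintSystem, C.code = c ∧ C.Satisfiable) ∧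
    -- and there is an effective construction of constraint systems
    ∃ cs : PromptLTL → PromptLTL → (A : Architecture) → (Fin A.n → ℕ) → ConstraintSystem,
      (∃ f : ℕ → ℕ, Computable f ∧
        ∀ (φ ψ : PromptLTL) (A : Architecture) (b : Fin A.n → ℕ),
          f (instanceCode φ ψ A b) = (cs φ ψ A b).code) ∧
      ∀ (φ ψ : PromptLTL) (A : Architecture) (b : Fin A.n → ℕ),
        -- that are satisfiable iff there are implementations of the given sizes
        ((cs φ ψ A b).Satisfiable ↔ ∃ T : A.Family b, A.Realizes T φ ψ) ∧
        -- and whose solutions directly represent exactly these implementations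
        (∀ M : (cs φ ψ A b).Solution, ∃ T : A.Family b, Represents M T) ∧
        ∀ T : A.Family b,
          A.Realizes T φ ψ ↔ ∃ M : (cs φ ψ A b).Solution, Represents M T := by
  refine ⟨satisfiable_computablePred,
    fun φ ψ A b => Instance.constraints (instanceCode φ ψ A b),
    ⟨fun x => (Instance.constraints x).code, Instance.primrec_code_constraints.to_comp,
      fun _ _ _ _ => rfl⟩, fun φ ψ A b => ?_⟩
  have hrep : ∀ M : (Instance.constraints (instanceCode φ ψ A b)).Solution,
      ∃ T : A.Family b, Represents M T := fun M =>
    Instance.exists_represents M (model_constraint_iff.1 M.is_model).2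
  refine ⟨⟨fun ⟨M⟩ => ?_, fun ⟨T, hT⟩ => ?_⟩, hrep, Instance.realizes_iff_exists_represents⟩
  · obtain ⟨T, hT⟩ := hrep M
    exact ⟨T, (Instance.realizes_iff_exists_represents T).2 ⟨M, hT⟩⟩
  · obtain ⟨M, -⟩ := (Instance.realizes_iff_exists_represents T).1 hT
    exact ⟨M⟩
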